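/- \textbf{Discrete filtered sets.} A discrete filtered set $\Omega_\star$ centred at $0$ is a family of finite sets $\Omega_L\subset D(0,L)$, $L>0$, with $\Omega_{L_1}\subseteq\Omega_{L_2}$ for $L_1\le L_2$ and $\Omega_L=\{0\}$ for $L>0$ small enough. A piecewise $C^1$ path $\lambda:[0,1]\to\mathbb C$ with $\lambda(0)=0$ is $\Omega_\star$-allowed if for some $L>0$ it has length $<L$ and either is constant or there is $t_0\in[0,1)$ with $\lambda([0,t_0])=\{0\}$ and $\lambda((t_0,1])\subset D(0,L)\setminus\Omega_L$. Two allowed paths with the same endpoint are $\Omega_\star$-homotopic if they are joined by a continuous family $H_t(s)$ of allowed paths with fixed extremities, having a piecewise continuous partial derivative $\partial H/\partial s$ (on finitely many pieces whose break points in $s$ depend continuously on $t$). Let $\mathscr R_{\Omega_\star}$ be the set of homotopy classes of allowed paths, $\mathfrak p:\mathscr R_{\Omega_\star}\to\mathbb C$ the endpoint map, with the topology generated by the sheets $\{\mathrm{cl}(\lambda\cdot[\lambda(1),z]) : z\in V\}$, where $\lambda$ is allowed for the value $L$, $r>0$, $\mathrm{length}(\lambda)+r<L$, and $V\subset D(\lambda(1),r)$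 is open, star-shaped about $\lambda(1)$ and disjoint from $\Omega_L\setminus\{\lambda(1)\}$. The complex structure is pulled back by $\mathfrak p$; the base point is the class of the constant path. Let $\widehat{\mathscr R}_{\Omega_\star}$ be the space of germs of holomorphic functions at $0$ that can be analytically continued to $\mathscr R_{\Omega_\star}$, i.e. that are induced near the base point by a holomorphic function on $\mathscr R_{\Omega_\star}$. \textbf{Glimpsed points.} Let $\theta\in\mathbb S^1$. Put $\Omega_L^\star(\theta)=\Omega_L\cap\,]0,Le^{i\theta}[$. An $\Omega_\star(\theta,L)$-angle is an $\alpha\in(0,\pi/2)$ such that every point of $\Omega_L$ in the sector $\{\xi e^{i\eta} : |\eta-\theta|<\alpha,\ 0<\xi<L\}$ belongs to $\Omega_L^\star(\theta)$. A piecewise $C^1$ path $\gamma$ with $\gamma(0)=0$ and length $<L$ is called an $(\alpha,L)$-forward path if its one-sided derivatives never vanish and have argument in $(\theta-\alpha,\theta+\alpha)$. The set $\mathrm{GLIMP}^\star_{\Omega_\star}(\theta)$ is the unique closed discrete set $G\subset\mathbb C$ such that: (i) $G\cap D(0,L)\subset\Omega_L^\star(\theta)$ for all $L>0$; (ii) for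 all $L>0$ and all $\Omega_\star(\theta,L)$-angles $\alpha$, every $(\alpha,L)$-forward path that avoids $G$ can be lifted to $\mathscr R_{\Omega_\star}$ from the base point; (iii) no proper subset of $G$ satisfies (ii). Put $\mathrm{GLIMP}_{\Omega_\star}(\theta)=\mathrm{GLIMP}^\star_{\Omega_\star}(\theta)\cup\{0\}$. For a germ $\widehat f$ at $0$, $\mathrm{GLIMP}^\star_{\widehat f}(\theta)$, the set of glimpsed singular points of $\widehat f$ in the direction $\theta$, is the unique closed discrete set $K\subset\{re^{i\theta} : r>0\}$ such that: (a) for every $L>0$ there is $\alpha\in(0,\pi/2)$ such that $\widehat f$ can be analytically continued along every $(\alpha,L)$-forward path that avoids $K$; (b) no proper subset of $K$ satisfies (a). \textbf{Proposition.} Let $\Omega_\star,\Omega'_\star$ be discrete filtered sets centred at $0$, let $\theta\in\mathbb S^1$, let $\widehat\varphi\in\widehat{\mathscr R}_{\Omega_\star}$ and $\widehat\psi\in\widehat{\mathscr R}_{\Omega'_\star}$, and let $\widehat\varphi\ast\widehat\psi$ be the germ at $0$ of $\zeta\mapsto\int_0^\zeta\widehat\varphi(\eta)\widehat\psi(\zeta-\eta)\,d\eta$.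 Then the set $\mathrm{GLIMP}^\star_{\widehat\varphi\ast\widehat\psi}(\theta)$ is well defined and $$\mathrm{GLIMP}^\star_{\widehat\varphi\ast\widehat\psi}(\theta)\subseteq\bigl(\mathrm{GLIMP}_{\Omega_\star}(\theta)+\mathrm{GLIMP}_{\Omega'_\star}(\theta)\bigr)\setminus\{0\}.$$ -/

import Mathlib

open Filter Topology
open scoped Pointwise unitInterval

noncomputable section

namespace Endless

/-- A discrete filtered set centred at `c`: an increasing family of finite sets `Ω L`, `L > 0`,
with `Ω L` contained in the open disc `D(c, L)` and `Ω L = {c}` for small `L`.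
(The values of `toFun` at `L ≤ 0` play no role.) -/
structure DiscreteFilteredSet (c : ℂ) where
  toFun : ℝ → Set ℂ
  finite' : ∀ L : ℝ, 0 < L → (toFun L).Finite
  subset_ball' : ∀ L : ℝ, 0 < L → toFun L ⊆ Metric.ball c L
  mono' : ∀ L₁ L₂ : ℝ, 0 < L₁ → L₁ ≤ L₂ → toFun L₁ ⊆ toFun L₂
  eq_center' : ∃ ε : ℝ, 0 < ε ∧ ∀ L : ℝ, 0 < L → L ≤ ε → toFun L = {c}

instance (c : ℂ) : CoeFun (DiscreteFilteredSet c) (fun _ => ℝ → Set ℂ) :=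
  ⟨DiscreteFilteredSet.toFun⟩

/-! ### Paths

All paths are standard paths `γ : [0,1] → ℂ`. -/

/-- The extension of a path to the real line, constant outside `[0,1]`. -/
def ext (γ : C(I, ℂ)) : ℝ → ℂ := Set.IccExtend zero_le_one γ

/-- A piecewise `C¹` path: there is a subdivision `0 = τ 0 ≤ ⋯ ≤ τ n = 1` such that the path is
`C¹` on each closed piece. -/
def PiecewiseC1 (γ : C(I, ℂ)) : Prop :=
  ∃ (n : ℕ) (τ : ℕ → ℝ), Monotone τ ∧ τ 0 = 0 ∧ τ n = 1 ∧
    ∀ i < n, ContDiffOn ℝ 1 (ext γ) (Set.Icc (τ i) (τ (i + 1)))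

/-- The length of a piecewise `C¹` path. -/
def length (γ : C(I, ℂ)) : ℝ := ∫ t in (0 : ℝ)..1, ‖deriv (ext γ) t‖

variable {c : ℂ}

/-- The set of paths `𝔯_Ω(L)`: piecewise `C¹` paths that start at the centre `c`, have length `< L`,
and either are constant or rest at `c` on some `[0, t₀]`, `t₀ < 1`, and afterwards stay in
`D(c, L) \ Ω L`. -/
def AllowedAt (Ω : DiscreteFilteredSet c) (L : ℝ) (γ : C(I, ℂ)) : Prop :=
  γ 0 = c ∧ PiecewiseC1 γ ∧ length γ < L ∧
    ((∀ s, γ s = c) ∨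
      ∃ t₀ : I, t₀ < 1 ∧ (∀ s, s ≤ t₀ → γ s = c) ∧
        ∀ s, t₀ < s → γ s ∈ Metric.ball c L \ Ω L)

/-- `Ω`-allowed paths. -/
def Allowed (Ω : DiscreteFilteredSet c) (γ : C(I, ℂ)) : Prop :=
  ∃ L : ℝ, 0 < L ∧ AllowedAt Ω L γ

/-- The type of `Ω`-allowed paths. -/
def AllowedPath (Ω : DiscreteFilteredSet c) : Type := {γ : C(I, ℂ) // Allowed Ω γ}

/-- The path `H_t : s ↦ H (s, t)`. -/
def slice (H : C(I × I, ℂ)) (t : I) : C(I, ℂ) :=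
  H.comp ((ContinuousMap.id I).prodMk (ContinuousMap.const I t))

/-- `H (s, t)` is piecewise continuously differentiable in `s`: there are break points
`0 = τ₀(t) ≤ ⋯ ≤ τₙ(t) = 1`, continuous in `t`, such that on each closed piece
`{(s, t) | τᵢ(t) ≤ s ≤ τᵢ₊₁(t)}` the partial derivative `∂H/∂s` exists and is continuous in
`(s, t)`. -/
def PiecewiseC1InS (H : C(I × I, ℂ)) : Prop :=
  ∃ (n : ℕ) (τ : ℕ → I → ℝ), (∀ i, Continuous (τ i)) ∧ (∀ t, Monotone fun i => τ i t) ∧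
    (∀ t, τ 0 t = 0) ∧ (∀ t, τ n t = 1) ∧
    ∀ i < n, ∃ D : ℝ × I → ℂ,
      ContinuousOn D {p | p.1 ∈ Set.Icc (τ i p.2) (τ (i + 1) p.2)} ∧
      ∀ t, ∀ s ∈ Set.Icc (τ i t) (τ (i + 1) t),
        HasDerivWithinAt (ext (slice H t)) (D (s, t)) (Set.Icc (τ i t) (τ (i + 1) t)) s

/-- `Ω`-homotopy with fixed extremities between two `Ω`-allowed paths: every intermediate path is
`Ω`-allowed. (All allowed paths start at `c`, so only the terminal point has to be fixed.) -/
def Homotopic (Ω : DiscreteFilteredSet c) (a b : AllowedPath Ω) : Prop :=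
  ∃ H : C(I × I, ℂ), PiecewiseC1InS H ∧ (∀ t, Allowed Ω (slice H t)) ∧
    slice H 0 = a.1 ∧ slice H 1 = b.1 ∧ ∀ t, H (1, t) = a.1 1

/-! ### The Riemann surface of a discrete filtered set -/

/-- The set `𝓡_Ω` of classes of `Ω`-allowed paths modulo `Ω`-homotopy. -/
def Surface (Ω : DiscreteFilteredSet c) : Type := Quot (Homotopic Ω)

/-- The class of an allowed path. -/
def cl (Ω : DiscreteFilteredSet c) (a : AllowedPath Ω) : Surface Ω := Quot.mk _ a

/-- The projection `𝔭 : 𝓡_Ω → ℂ`, sending a class to the terminal point of its paths. -/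
def proj (Ω : DiscreteFilteredSet c) : Surface Ω → ℂ :=
  Quot.lift (fun a => a.1 1) (by
    rintro a b ⟨H, -, -, -, h1, hend⟩
    have h : slice H 1 1 = b.1 1 := by rw [h1]
    exact (hend 1).symm.trans h)

theorem allowed_const (Ω : DiscreteFilteredSet c) : Allowed Ω (ContinuousMap.const I c) := by
  have hc : ext (ContinuousMap.const I c) = fun _ => c := rfl
  refine ⟨1, one_pos, rfl, ⟨1, fun i => (i : ℝ), Nat.mono_cast, by simp, by simp, ?_⟩, ?_,
    Or.inl fun _ => rfl⟩
  · intro i _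
    rw [hc]
    exact contDiffOn_const
  · simp [length, hc]

/-- The base point of `𝓡_Ω`, the class of the constant path; it is the only point over `c`. -/
def base (Ω : DiscreteFilteredSet c) : Surface Ω := cl Ω ⟨ContinuousMap.const I c, allowed_const Ω⟩

/-- The path `γ` followed by the line segment from its terminal point to `z`. -/
def appendSegment (γ : C(I, ℂ)) (z : ℂ) : C(I, ℂ) :=
  ((⟨γ, rfl, rfl⟩ : Path (γ 0) (γ 1)).trans (Path.segment (γ 1) z)).toContinuousMap

/-- The sheet over `V` issued from `cl a`: classes of `a` followed by a segment ending in `V`. -/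
def sheet (Ω : DiscreteFilteredSet c) (a : AllowedPath Ω) (V : Set ℂ) : Set (Surface Ω) :=
  {q | ∃ z ∈ V, ∃ h : Allowed Ω (appendSegment a.1 z), q = cl Ω ⟨appendSegment a.1 z, h⟩}

/-- The topology of `𝓡_Ω`, generated by the sheets over star-shaped domains `V ⊆ D(a(1), r)`
about the terminal point `a(1)` of an allowed path `a ∈ 𝔯_Ω(L)`, where `length a + r < L` and `V`
does not meet `Ω L`, except possibly at `a(1)` itself (this happens only if `a` is constant). -/
instance (Ω : DiscreteFilteredSet c) : TopologicalSpace (Surface Ω) :=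
  TopologicalSpace.generateFrom
    {U | ∃ (a : AllowedPath Ω) (L r : ℝ) (V : Set ℂ),
      AllowedAt Ω L a.1 ∧ 0 < r ∧ length a.1 + r < L ∧
      IsOpen V ∧ a.1 1 ∈ V ∧ StarConvex ℝ (a.1 1) V ∧ V ⊆ Metric.ball (a.1 1) r ∧
      V ∩ Ω L ⊆ {a.1 1} ∧ U = sheet Ω a V}

/-- A path of `ℂ` starting at `c` can be lifted to `𝓡_Ω` with respect to `𝔭` from the base
point. -/
def Liftable (Ω : DiscreteFilteredSet c) (γ : C(I, ℂ)) : Prop :=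
  ∃ Λ : C(I, Surface Ω), Λ 0 = base Ω ∧ ∀ s, proj Ω (Λ s) = γ s

/-- A function on `𝓡_Ω` is holomorphic for the complex structure pulled back by `𝔭`. -/
def HolomorphicOnSurface (Ω : DiscreteFilteredSet c) (Φ : Surface Ω → ℂ) : Prop :=
  ∀ ζ : Surface Ω, ∃ g : ℂ → ℂ, AnalyticAt ℂ g (proj Ω ζ) ∧ ∀ᶠ ξ in 𝓝 ζ, Φ ξ = g (proj Ω ξ)

/-- The germ at `c` of `φ` is holomorphic and can be analytically continued to `𝓡_Ω`. -/
def ContinuableTo (Ω : DiscreteFilteredSet c) (φ : ℂ → ℂ) : Prop :=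
  AnalyticAt ℂ φ c ∧ ∃ Φ : Surface Ω → ℂ, HolomorphicOnSurface Ω Φ ∧
    ∀ᶠ ξ in 𝓝 (base Ω), Φ ξ = φ (proj Ω ξ)

/-! ### Forward paths and glimpsed points of a discrete filtered set -/

/-- The open sector `{c + ξ e^{iη} | |η - θ| < α, 0 < ξ < L}`. -/
def sector (c : ℂ) (θ α L : ℝ) : Set ℂ :=
  {z | ∃ η ∈ Set.Ioo (θ - α) (θ + α), ∃ ξ ∈ Set.Ioo 0 L, z = c + ξ * Complex.exp (η * Complex.I)}

/-- The open half-line `]c, c + e^{iθ}∞[`. -/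
def ray (c : ℂ) (θ : ℝ) : Set ℂ :=
  {z | ∃ r : ℝ, 0 < r ∧ z = c + r * Complex.exp (θ * Complex.I)}

/-- `Ω_L^⋆(θ)`, the points of `Ω L` on the segment `]c, c + e^{iθ}L[`. -/
def onRay (Ω : DiscreteFilteredSet c) (θ L : ℝ) : Set ℂ :=
  Ω L ∩ {z | ∃ r ∈ Set.Ioo 0 L, z = c + r * Complex.exp (θ * Complex.I)}

/-- `α` is an `Ω(θ, L)`-angle. -/
def IsAngle (Ω : DiscreteFilteredSet c) (θ L α : ℝ) : Prop :=
  α ∈ Set.Ioo 0 (Real.pi / 2) ∧ Ω L ∩ sector c θ α L = onRay Ω θ L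

/-- Nonzero complex numbers having an argument in `]θ - α, θ + α[`. -/
def cone (θ α : ℝ) : Set ℂ :=
  {z | ∃ η ∈ Set.Ioo (θ - α) (θ + α), ∃ ξ : ℝ, 0 < ξ ∧ z = ξ * Complex.exp (η * Complex.I)}

/-- Piecewise `C¹` paths that start at `c`, have length `< L`, and whose right and left
derivatives do not vanish and have argument in `]θ - α, θ + α[`. -/
def IsForward (c : ℂ) (θ α L : ℝ) (γ : C(I, ℂ)) : Prop :=
  γ 0 = c ∧ PiecewiseC1 γ ∧ length γ < L ∧
    (∀ t ∈ Set.Ico (0 : ℝ) 1, derivWithin (ext γ) (Set.Ici t) t ∈ cone θ α) ∧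
    (∀ t ∈ Set.Ioc (0 : ℝ) 1, derivWithin (ext γ) (Set.Iic t) t ∈ cone θ α)

/-- For every `L > 0`, every path of `𝔯(Ω, θ, L)` that circumvents the points of `G ∩ D(c, L)`
(that is, moves forward and avoids these points, leaving each one to its right or to its left)
can be lifted to `𝓡_Ω` from the base point. -/
def LiftsAround (Ω : DiscreteFilteredSet c) (θ : ℝ) (G : Set ℂ) : Prop :=
  ∀ L : ℝ, 0 < L → ∀ α, IsAngle Ω θ L α → ∀ γ, IsForward c θ α L γ →
    (∀ s, γ s ∉ G ∩ Metric.ball c L) → Liftable Ω γ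

/-- The defining properties of the set of glimpsed `Ω`-points in the direction `θ`. -/
def IsGlimpsedSet (Ω : DiscreteFilteredSet c) (θ : ℝ) (G : Set ℂ) : Prop :=
  IsClosed G ∧ IsDiscrete G ∧ (∀ L : ℝ, 0 < L → G ∩ Metric.ball c L ⊆ onRay Ω θ L) ∧
    LiftsAround Ω θ G ∧ ∀ G', G' ⊂ G → ¬ LiftsAround Ω θ G'

/-- The set of glimpsed `Ω`-points in the direction `θ`: the unique set with the property
`IsGlimpsedSet Ω θ` (formally, the union of all such sets). -/
def glimpsed (Ω : DiscreteFilteredSet c) (θ : ℝ) : Set ℂ := ⋃₀ {G | IsGlimpsedSet Ω θ G}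

/-- The completed set of glimpsed `Ω`-points in the direction `θ`. -/
def completedGlimpsed (Ω : DiscreteFilteredSet c) (θ : ℝ) : Set ℂ := glimpsed Ω θ ∪ {c}

/-! ### Glimpsed singular points of a germ -/

/-- The germ of `f` at `γ 0` can be analytically continued along `γ`: there are germs `F s` at
`γ s` of holomorphic functions, with `F 0` the germ of `f`, such that `F s'` is the germ at `γ s'`
induced by `F s` for all `s'` close to `s`. -/
def ContinuableAlong (f : ℂ → ℂ) (γ : C(I, ℂ)) : Prop :=
  ∃ F : I → ℂ → ℂ, (∀ s, AnalyticAt ℂ (F s) (γ s)) ∧ F 0 =ᶠ[𝓝 (γ 0)] f ∧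
    ∀ s, ∀ᶠ s' in 𝓝 s, F s' =ᶠ[𝓝 (γ s')] F s

/-- The germ of `f` at `c` can be analytically continued along any path that closely follows the
half-line `[c, c + e^{iθ}∞[` in the forward direction while circumventing, to the right or to the
left, each point of `K`. "Closely" means: for paths of length `< L`, the directions of the path
deviate from `θ` by less than some `α > 0` that may depend on `L`. -/
def ContinuesAround (f : ℂ → ℂ) (c : ℂ) (θ : ℝ) (K : Set ℂ) : Prop :=
  ∀ L : ℝ, 0 < L → ∃ α ∈ Set.Ioo 0 (Real.pi / 2), ∀ γ, IsForward c θ α L γ →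
    (∀ s, γ s ∉ K) → ContinuableAlong f γ

/-- The defining properties of the set of glimpsed singular points of the germ of `f` at `c` in the
direction `θ`. -/
def IsGlimpsedSingularSet (f : ℂ → ℂ) (c : ℂ) (θ : ℝ) (K : Set ℂ) : Prop :=
  IsClosed K ∧ IsDiscrete K ∧ K ⊆ ray c θ ∧ ContinuesAround f c θ K ∧
    ∀ K', K' ⊂ K → ¬ ContinuesAround f c θ K'

/-- The set of glimpsed singular points of the germ of `f` at `c` in the direction `θ`: the unique
set with the property `IsGlimpsedSingularSet f c θ` (formally, the union of all such sets). -/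
def glimpsedSingular (f : ℂ → ℂ) (c : ℂ) (θ : ℝ) : Set ℂ :=
  ⋃₀ {K | IsGlimpsedSingularSet f c θ K}

/-- The convolution product of two germs at `0`,
`(φ ∗ ψ)(ζ) = ∫_0^ζ φ(η) ψ(ζ - η) dη`, the integral being taken along the segment `η = t ζ`,
`0 ≤ t ≤ 1`. Only its germ at `0` is meaningful. -/
def conv (φ ψ : ℂ → ℂ) (ζ : ℂ) : ℂ :=
  ∫ t in (0 : ℝ)..1, φ (t * ζ) * ψ (ζ - t * ζ) * ζ

end Endless

end

/-! Call a point `w` of the ray persistent when it lies in `Ω L` for every `L > ‖w‖` (`persistent`).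
No point of the surface lies over a persistent point, since an allowed path ending at `w` has length
at least `‖w‖`. Conversely a forward path that avoids the persistent points lifts to the surface
(`liftsAround_persistent`): the lift at time `t` is the class of a copy of `γ` on `[0, t]`, squeezed
towards the ray and pushed slightly sideways, followed by a segment to `γ t`. The squeezing makes
the copy barely longer than `‖γ t‖` when `γ t` is a non-persistent point of `Ω L`, so the copy is
allowed for a smaller length at which that point is absent. Hence the persistent points form a
glimpsed set. Because the projection of the surface is open (`eventually_of_eventually_proj`), a
function on the surface yields continuation along liftable paths, so `φ` and `ψ` continue around
their persistent sets.

For the convolution, let `A` and `B` be the two persistent sets completed by `0`, and let `γ` be a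
forward path that avoids `A + B` after time `0`. The integration path must be deformed so that,
after time `0`, `η` avoids `A` and `ζ - η` avoids `B`; only the two constant trajectories, `η = 0`
and `ζ - η = 0`, are excepted. Let its points follow a discretization of `dZ = w dγ` with `w = d(Z,
A) / (d(Z, A) + d(γ - Z, B))`. The denominator is at least `d(γ, A + B) > 0`; a particle slows down
before reaching `A`; and `γ - Z` obeys the same law with `A` and `B` exchanged. As `0 ≤ w ≤ 1`,
moving particles go forward and no farther than `γ` does (`exists_flow`). Continuations along the
trajectories fit into families of germs over a square (`exists_germField_prod`), and Cauchy's
theorem on a fine polygon shows that the resulting integrals continue the convolution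
(`continuableAlong_conv_of_germField`, `continuesAround_conv`).

The set of glimpsed singular points exists because the sets around which a germ continues are stable
under intersection (`ContinuesAroundAt.inter`). With local finiteness, the intersection of all of
them is again such a set, hence the least one, and it lies inside any known one
(`isGlimpsedSingularSet_of_continuesAround`). -/

namespace Endless

/-! ### Families of germs of holomorphic functions -/

/-- A locally constant family of germs `F x` of holomorphic functions at the points `h x`. -/
def GermField {X : Type*} [TopologicalSpace X] (h : X → ℂ) (F : X → ℂ → ℂ) : Prop :=
  (∀ x, AnalyticAt ℂ (F x) (h x)) ∧ ∀ x, ∀ᶠ x' in 𝓝 x, F x' =ᶠ[𝓝 (h x')] F x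

theorem GermField.comp {X Y : Type*} [TopologicalSpace X] [TopologicalSpace Y] {h : X → ℂ}
    {F : X → ℂ → ℂ} (hF : GermField h F) {k : Y → X} (hk : Continuous k) :
    GermField (h ∘ k) (F ∘ k) :=
  ⟨fun y => hF.1 (k y), fun y => hk.continuousAt.eventually (hF.2 (k y))⟩

theorem continuableAlong_iff {f : ℂ → ℂ} {γ : C(I, ℂ)} :
    ContinuableAlong f γ ↔ ∃ F, GermField γ F ∧ F 0 =ᶠ[𝓝 (γ 0)] f := by
  constructor
  · rintro ⟨F, h1, h2, h3⟩
    exact ⟨F, ⟨h1, h3⟩, h2⟩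
  · rintro ⟨F, ⟨h1, h3⟩, h2⟩
    exact ⟨F, h1, h2, h3⟩

theorem eqOn_ball_of_eventuallyEq {f g : ℂ → ℂ} {z w : ℂ} {r : ℝ}
    (hf : AnalyticOnNhd ℂ f (Metric.ball z r)) (hg : AnalyticOnNhd ℂ g (Metric.ball z r))
    (hw : w ∈ Metric.ball z r) (h : f =ᶠ[𝓝 w] g) : Set.EqOn f g (Metric.ball z r) :=
  hf.eqOn_of_preconnected_of_eventuallyEq hg (convex_ball z r).isPreconnected hw h

/-- Uniqueness of analytic continuation. -/
theorem GermField.unique {X : Type*} [TopologicalSpace X] [PreconnectedSpace X] {h : X → ℂ}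
    (hc : Continuous h) {F G : X → ℂ → ℂ} (hF : GermField h F) (hG : GermField h G) {x₀ : X}
    (h0 : F x₀ =ᶠ[𝓝 (h x₀)] G x₀) (x : X) : F x =ᶠ[𝓝 (h x)] G x := by
  have key : IsClopen {x | F x =ᶠ[𝓝 (h x)] G x} := by
    constructor
    · rw [← isOpen_compl_iff, isOpen_iff_mem_nhds]
      intro x hx
      obtain ⟨r, hr, hr1⟩ := Metric.eventually_nhds_iff_ball.1
        ((hF.1 x).eventually_analyticAt.and (hG.1 x).eventually_analyticAt)
      have hb : ∀ᶠ x' in 𝓝 x, h x' ∈ Metric.ball (h x) r :=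
        hc.continuousAt.eventually (Metric.ball_mem_nhds _ hr)
      filter_upwards [hb, hF.2 x, hG.2 x] with x' h1 h2 h3 h4
      have : F x =ᶠ[𝓝 (h x')] G x := h2.symm.trans (EventuallyEq.trans h4 h3)
      have h5 := eqOn_ball_of_eventuallyEq (fun z hz => (hr1 z hz).1) (fun z hz => (hr1 z hz).2)
        h1 this
      exact hx (h5.eventuallyEq_of_mem (Metric.ball_mem_nhds _ hr))
    · rw [isOpen_iff_mem_nhds]
      intro x hx
      have hb : ∀ᶠ x' in 𝓝 x, F x =ᶠ[𝓝 (h x')] G x :=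
        hc.continuousAt.eventually (eventually_eventually_nhds.2 hx)
      filter_upwards [hb, hF.2 x, hG.2 x] with x' h1 h2 h3
      exact h2.trans (h1.trans h3.symm)
  have := key.eq_univ ⟨x₀, h0⟩
  have hx : x ∈ {x | F x =ᶠ[𝓝 (h x)] G x} := by rw [this]; trivial
  exact hx

/-- Over a compact space the germs have representatives on discs of a fixed radius. -/
theorem GermField.exists_uniform {X : Type*} [MetricSpace X] [CompactSpace X] {h : X → ℂ}
    (hc : Continuous h) {F : X → ℂ → ℂ} (hF : GermField h F) :
    ∃ ρ > 0, ∃ δ > 0, ∃ G : X → ℂ → ℂ, (∀ x, G x =ᶠ[𝓝 (h x)] F x) ∧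
      (∀ x, AnalyticOnNhd ℂ (G x) (Metric.ball (h x) ρ)) ∧
      ∀ x x', dist x x' < δ →
        Set.EqOn (G x) (G x') (Metric.ball (h x) ρ ∩ Metric.ball (h x') ρ) := by
  have h1 : ∀ x, ∃ r > 0, AnalyticOnNhd ℂ (F x) (Metric.ball (h x) (2 * r)) := by
    intro x
    obtain ⟨r, hr, hr1⟩ := Metric.eventually_nhds_iff_ball.1 (hF.1 x).eventually_analyticAt
    exact ⟨r / 2, by positivity, fun z hz => hr1 z (by simpa [mul_div_cancel₀] using hz)⟩
  choose r hr hr1 using h1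
  have h2 : ∀ x, ∃ U : Set X, IsOpen U ∧ x ∈ U ∧
      ∀ x' ∈ U, F x' =ᶠ[𝓝 (h x')] F x ∧ h x' ∈ Metric.ball (h x) (r x) := by
    intro x
    obtain ⟨U, hU, hUo, hxU⟩ := eventually_nhds_iff.1 ((hF.2 x).and
      (hc.continuousAt.eventually (Metric.ball_mem_nhds (h x) (hr x))))
    exact ⟨U, hUo, hxU, hU⟩
  choose U hUo hxU hU using h2
  obtain ⟨T, hT⟩ := isCompact_univ.elim_finite_subcover U hUo
    (fun x _ => Set.mem_iUnion.2 ⟨x, hxU x⟩)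
  rcases isEmpty_or_nonempty X with hX | hX
  · exact ⟨1, one_pos, 1, one_pos, F, fun x => hX.elim x, fun x => hX.elim x,
      fun x => hX.elim x⟩
  have hTne : T.Nonempty := by
    obtain ⟨x⟩ := hX
    obtain ⟨i, hi, -⟩ := Set.mem_iUnion₂.1 (hT (Set.mem_univ x))
    exact ⟨i, hi⟩
  set ρ := T.inf' hTne r with hρ
  have hρ0 : 0 < ρ := (Finset.lt_inf'_iff hTne).2 fun i _ => hr i
  -- Points closer than the Lebesgue number lie in a common `U i`, so finitely many germs `F i`
  -- serve as representatives and neighbouring choices can be compared.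
  obtain ⟨δ₁, hδ₁, hleb⟩ := lebesgue_number_lemma_of_metric (s := Set.univ) (c := fun i : T => U i)
    isCompact_univ (fun i => hUo i) (by
      intro x hx
      obtain ⟨i, hi, hxi⟩ := Set.mem_iUnion₂.1 (hT hx)
      exact Set.mem_iUnion.2 ⟨⟨i, hi⟩, hxi⟩)
  choose k hk using fun x => hleb x (Set.mem_univ x)
  obtain ⟨δ₂, hδ₂, huc⟩ := Metric.uniformContinuous_iff.1
    (CompactSpace.uniformContinuous_of_continuous hc) ρ hρ0
  have hxk : ∀ x, x ∈ U (k x) := fun x => hk x (Metric.mem_ball_self hδ₁)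
  have han : ∀ x, AnalyticOnNhd ℂ (F (k x)) (Metric.ball (h x) ρ) := by
    intro x z hz
    refine hr1 _ z ?_
    have h3 := (hU _ x (hxk x)).2
    have h4 : ρ ≤ r (k x) := Finset.inf'_le r (k x).2
    rw [Metric.mem_ball] at *
    linarith [dist_triangle z (h x) (h (k x))]
  refine ⟨ρ, hρ0, min δ₁ δ₂, lt_min hδ₁ hδ₂, fun x => F (k x), fun x => ?_, han, ?_⟩
  · exact (hU _ x (hxk x)).1.symm
  · intro x x' hd
    have h3 : x' ∈ U (k x) := hk x (by
      rw [Metric.mem_ball, dist_comm]; exact hd.trans_le (min_le_left _ _))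
    have h4 : F (k x) =ᶠ[𝓝 (h x')] F (k x') := (hU _ x' h3).1.symm.trans (hU _ x' (hxk x')).1
    refine AnalyticOnNhd.eqOn_of_preconnected_of_eventuallyEq (𝕜 := ℂ) (z₀ := h x')
      (fun z hz => han x z hz.1) (fun z hz => han x' z hz.2)
      ((convex_ball _ _).inter (convex_ball _ _)).isPreconnected ⟨?_, Metric.mem_ball_self hρ0⟩ h4
    rw [Metric.mem_ball, dist_comm]
    exact huc (hd.trans_le (min_le_right _ _))

/-- Continuation along each path of a continuous family of paths with fixed origin is a
continuation over the whole parameter space. -/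
theorem exists_germField_prod {X : Type*} [TopologicalSpace X] {H : X × I → ℂ} (hH : Continuous H)
    {f : ℂ → ℂ} {c₀ : ℂ} (h0 : ∀ s, H (s, 0) = c₀)
    (hf : ∀ s, ContinuableAlong f ⟨fun t => H (s, t), by fun_prop⟩) :
    ∃ F : X × I → ℂ → ℂ, GermField H F ∧ ∀ s, F (s, 0) =ᶠ[𝓝 c₀] f := by
  choose F hF hF0 using fun s => continuableAlong_iff.1 (hf s)
  have hF0' : ∀ s, F s 0 =ᶠ[𝓝 c₀] f := fun s => by
    have := hF0 s
    simpa [h0] using this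
  refine ⟨fun p => F p.1 p.2, ⟨fun p => (hF p.1).1 p.2, ?_⟩, hF0'⟩
  rintro ⟨s₀, t₀⟩
  have hc : ∀ s, Continuous fun t => H (s, t) := fun s => by fun_prop
  obtain ⟨ρ, hρ, δ, hδ, G, hG1, hG2, hG3⟩ := (hF s₀).exists_uniform (hc s₀)
  have hnear : ∀ᶠ s in 𝓝 s₀, ∀ t ∈ (Set.univ : Set I), dist (H (s, t)) (H (s₀, t)) < ρ := by
    refine isCompact_univ.eventually_forall_of_forall_eventually fun t _ => ?_
    have : Continuous fun p : X × I => dist (H p) (H (s₀, p.2)) := by fun_prop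
    exact this.continuousAt.eventually (gt_mem_nhds (by simpa using hρ))
  -- The representatives `G t` chosen along the path `s₀` are still defined at the points `H (s,
  -- t)`; they give a continuation along the path `s`, which agrees with `F s` by uniqueness.
  have hstep : ∀ s, (∀ t ∈ (Set.univ : Set I), dist (H (s, t)) (H (s₀, t)) < ρ) →
      ∀ t, F s t =ᶠ[𝓝 (H (s, t))] G t := by
    intro s hs
    have hGs : GermField (fun t => H (s, t)) G := by
      refine ⟨fun t => hG2 t _ (hs t trivial), fun t => ?_⟩
      have h1 : ∀ᶠ t' in 𝓝 t, H (s, t') ∈ Metric.ball (H (s₀, t)) ρ :=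
        (hc s).continuousAt.eventually (Metric.isOpen_ball.mem_nhds (hs t trivial))
      have h2 : ∀ᶠ t' in 𝓝 t, dist t' t < δ := Metric.eventually_nhds_iff.2 ⟨δ, hδ, fun _ h => h⟩
      filter_upwards [h1, h2] with t' h1 h2
      exact (hG3 t' t h2).eventuallyEq_of_mem ((Metric.isOpen_ball.inter Metric.isOpen_ball).mem_nhds
        ⟨hs t' trivial, h1⟩)
    refine (hF s).unique (hc s) hGs (x₀ := 0) ?_
    have h3 := hG1 0
    simp only [h0] at h3 ⊢
    exact (hF0' s).trans ((hF0' s₀).symm.trans h3.symm)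
  have h1 : ∀ᶠ p : X × I in 𝓝 (s₀, t₀), H p ∈ Metric.ball (H (s₀, t₀)) ρ :=
    hH.continuousAt.eventually (Metric.ball_mem_nhds _ hρ)
  have h2 : ∀ᶠ p : X × I in 𝓝 (s₀, t₀), dist p.2 t₀ < δ :=
    (continuous_snd.tendsto (s₀, t₀)).eventually
      (Metric.ball_mem_nhds t₀ hδ : ∀ᶠ t in 𝓝 t₀, dist t t₀ < δ)
  have h3 : ∀ᶠ p : X × I in 𝓝 (s₀, t₀), G t₀ =ᶠ[𝓝 (H p)] F s₀ t₀ :=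
    hH.continuousAt.eventually (eventually_eventually_nhds.2 (hG1 t₀))
  filter_upwards [h1, h2, h3, continuous_fst.continuousAt.eventually hnear] with p h1 h2 h3 h4
  refine (hstep p.1 h4 p.2).trans (EventuallyEq.trans ?_ h3)
  exact (hG3 p.2 t₀ h2).eventuallyEq_of_mem ((Metric.isOpen_ball.inter Metric.isOpen_ball).mem_nhds
    ⟨h4 p.2 trivial, h1⟩)


/-! ### Rotated coordinates -/

/-- The coordinate along the direction `e^{iθ}`. -/
noncomputable def xc (θ : ℝ) : ℂ →L[ℝ] ℝ := Real.cos θ • Complex.reCLM + Real.sin θ • Complex.imCLM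

/-- The coordinate along the direction `i e^{iθ}`. -/
noncomputable def yc (θ : ℝ) : ℂ →L[ℝ] ℝ := Real.cos θ • Complex.imCLM - Real.sin θ • Complex.reCLM

/-- The unit vector `e^{iθ}`. -/
noncomputable def dir (θ : ℝ) : ℂ := Complex.exp (θ * Complex.I)

theorem xc_apply (θ : ℝ) (z : ℂ) : xc θ z = Real.cos θ * z.re + Real.sin θ * z.im := by
  simp [xc]

theorem yc_apply (θ : ℝ) (z : ℂ) : yc θ z = Real.cos θ * z.im - Real.sin θ * z.re := by
  simp [yc]

theorem dir_re (θ : ℝ) : (dir θ).re = Real.cos θ := by simp [dir, Complex.exp_ofReal_mul_I_re]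

theorem dir_im (θ : ℝ) : (dir θ).im = Real.sin θ := by simp [dir, Complex.exp_ofReal_mul_I_im]

theorem norm_dir (θ : ℝ) : ‖dir θ‖ = 1 := Complex.norm_exp_ofReal_mul_I θ

theorem xc_ofReal_mul (θ r : ℝ) (z : ℂ) : xc θ (r * z) = r * xc θ z := by
  simp [xc_apply]; ring

theorem yc_ofReal_mul (θ r : ℝ) (z : ℂ) : yc θ (r * z) = r * yc θ z := by
  simp [yc_apply]; ring

theorem xc_dir (θ : ℝ) : xc θ (dir θ) = 1 := by
  rw [xc_apply, dir_re, dir_im]; nlinarith [Real.sin_sq_add_cos_sq θ]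

theorem yc_dir (θ : ℝ) : yc θ (dir θ) = 0 := by
  rw [yc_apply, dir_re, dir_im]; ring

theorem xc_I_dir (θ : ℝ) : xc θ (Complex.I * dir θ) = 0 := by
  rw [xc_apply]; simp [dir_re, dir_im]; ring

theorem yc_I_dir (θ : ℝ) : yc θ (Complex.I * dir θ) = 1 := by
  rw [yc_apply]; simp [dir_re, dir_im]; nlinarith [Real.sin_sq_add_cos_sq θ]

theorem eq_coord (θ : ℝ) (z : ℂ) : z = xc θ z * dir θ + yc θ z * (Complex.I * dir θ) := by
  have h := Real.sin_sq_add_cos_sq θ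
  apply Complex.ext
  · simp only [xc_apply, yc_apply, dir_re, dir_im, Complex.add_re, Complex.mul_re, Complex.mul_im,
      Complex.ofReal_re, Complex.ofReal_im, Complex.I_re, Complex.I_im]
    linear_combination (-z.re) * h
  · simp only [xc_apply, yc_apply, dir_re, dir_im, Complex.add_im, Complex.mul_re, Complex.mul_im,
      Complex.ofReal_re, Complex.ofReal_im, Complex.I_re, Complex.I_im]
    linear_combination (-z.im) * h

theorem coord_ext {θ : ℝ} {z w : ℂ} (hx : xc θ z = xc θ w) (hy : yc θ z = yc θ w) : z = w := by
  rw [eq_coord θ z, eq_coord θ w, hx, hy]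

theorem norm_sq_coord (θ : ℝ) (z : ℂ) : ‖z‖ ^ 2 = xc θ z ^ 2 + yc θ z ^ 2 := by
  rw [Complex.sq_norm, Complex.normSq_apply, xc_apply, yc_apply]
  linear_combination (-(z.re ^ 2 + z.im ^ 2)) * Real.sin_sq_add_cos_sq θ

theorem abs_xc_le_norm (θ : ℝ) (z : ℂ) : |xc θ z| ≤ ‖z‖ :=
  abs_le_of_sq_le_sq (by nlinarith [norm_sq_coord θ z, sq_nonneg (yc θ z)]) (norm_nonneg _)

theorem xc_le_norm (θ : ℝ) (z : ℂ) : xc θ z ≤ ‖z‖ := (le_abs_self _).trans (abs_xc_le_norm θ z)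

theorem abs_yc_le_norm (θ : ℝ) (z : ℂ) : |yc θ z| ≤ ‖z‖ :=
  abs_le_of_sq_le_sq (by nlinarith [norm_sq_coord θ z, sq_nonneg (xc θ z)]) (norm_nonneg _)

theorem norm_eq_xc {θ : ℝ} {z : ℂ} (hy : yc θ z = 0) (hx : 0 ≤ xc θ z) : ‖z‖ = xc θ z := by
  have := norm_sq_coord θ z
  rw [hy] at this
  exact (sq_eq_sq₀ (norm_nonneg _) hx).1 (by linarith)

/-- Since `α < π / 2`, the angular condition becomes two linear inequalities in rotated coordinates.
All later estimates on directions use this convex form. -/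
theorem mem_cone_iff {θ α : ℝ} (hα : α ∈ Set.Ioo 0 (Real.pi / 2)) {z : ℂ} :
    z ∈ cone θ α ↔ 0 < xc θ z ∧ |yc θ z| < Real.tan α * xc θ z := by
  have hpi := Real.pi_pos
  constructor
  · rintro ⟨η, hη, ξ, hξ, rfl⟩
    have h1 : |η - θ| < α := abs_lt.2 ⟨by linarith [hη.1], by linarith [hη.2]⟩
    have h2 := abs_lt.1 h1
    have hcos : 0 < Real.cos (η - θ) :=
      Real.cos_pos_of_mem_Ioo ⟨by linarith [hα.2], by linarith [hα.2]⟩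
    have hx : xc θ (ξ * Complex.exp (η * Complex.I)) = ξ * Real.cos (η - θ) := by
      change xc θ (ξ * dir η) = _
      rw [xc_ofReal_mul, xc_apply, dir_re, dir_im, Real.cos_sub]; ring
    have hy : yc θ (ξ * Complex.exp (η * Complex.I)) = ξ * Real.sin (η - θ) := by
      change yc θ (ξ * dir η) = _
      rw [yc_ofReal_mul, yc_apply, dir_re, dir_im, Real.sin_sub]; ring
    rw [hx, hy]
    refine ⟨by positivity, ?_⟩
    have h3 : |Real.sin (η - θ)| < Real.tan α * Real.cos (η - θ) := by
      have h4 : Real.tan (η - θ) < Real.tan α :=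
        Real.tan_lt_tan_of_lt_of_lt_pi_div_two (by linarith [hα.2]) hα.2 (by linarith)
      have h5 : Real.tan (-α) < Real.tan (η - θ) :=
        Real.tan_lt_tan_of_lt_of_lt_pi_div_two (by linarith [hα.2]) (by linarith [hα.2])
          (by linarith)
      rw [Real.tan_neg] at h5
      rw [Real.tan_eq_sin_div_cos (η - θ)] at h4 h5
      rw [div_lt_iff₀ hcos] at h4
      rw [lt_div_iff₀ hcos] at h5
      exact abs_lt.2 ⟨by linarith, h4⟩
    rw [abs_mul, abs_of_pos hξ]
    nlinarith
  · rintro ⟨hx, hy⟩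
    -- `β` is the angle between `z` and the direction `θ`.
    set β := Real.arctan (yc θ z / xc θ z) with hβ
    have hb : |β| < α := by
      have h1 : |yc θ z / xc θ z| < Real.tan α := by
        rw [abs_div, abs_of_pos hx, div_lt_iff₀ hx]; exact hy
      have h2 := abs_lt.1 h1
      have h3 : Real.arctan (Real.tan α) = α := Real.arctan_tan (by linarith [hα.1]) hα.2
      rw [abs_lt]
      constructor
      · have := Real.arctan_strictMono h2.1
        rwa [Real.arctan_neg, h3] at this
      · have := Real.arctan_strictMono h2.2
        rwa [h3] at this
    have hc : 0 < Real.cos β := Real.cos_arctan_pos _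
    have hs : Real.sin β = Real.cos β * (yc θ z / xc θ z) := by
      rw [← Real.tan_arctan (yc θ z / xc θ z), ← hβ, Real.tan_eq_sin_div_cos]; field_simp
    have h2 := abs_lt.1 hb
    refine ⟨θ + β, ⟨by linarith, by linarith⟩, xc θ z / Real.cos β, by positivity, ?_⟩
    change z = _ * dir (θ + β)
    refine coord_ext (θ := θ) ?_ ?_
    · rw [xc_ofReal_mul, xc_apply θ (dir (θ + β)), dir_re, dir_im, Real.cos_add, Real.sin_add]
      have := Real.sin_sq_add_cos_sq θ
      field_simp
      linear_combination (-Real.cos β) * this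
    · rw [yc_ofReal_mul, yc_apply θ (dir (θ + β)), dir_re, dir_im, Real.cos_add, Real.sin_add]
      have := Real.sin_sq_add_cos_sq θ
      have h3 : xc θ z / Real.cos β * Real.sin β = yc θ z := by rw [hs]; field_simp
      linear_combination (-yc θ z) * this - (Real.cos θ ^ 2 + Real.sin θ ^ 2) * h3

theorem mem_sector_iff {θ α L : ℝ} (z : ℂ) : z ∈ sector 0 θ α L ↔ z ∈ cone θ α ∧ ‖z‖ < L := by
  have hn : ∀ η ξ : ℝ, 0 < ξ → ‖(ξ : ℂ) * Complex.exp (η * Complex.I)‖ = ξ := by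
    intro η ξ h
    rw [norm_mul, Complex.norm_exp_ofReal_mul_I, Complex.norm_real, Real.norm_eq_abs,
      abs_of_pos h, mul_one]
  constructor
  · rintro ⟨η, hη, ξ, hξ, rfl⟩
    rw [zero_add]
    exact ⟨⟨η, hη, ξ, hξ.1, rfl⟩, by rw [hn _ _ hξ.1]; exact hξ.2⟩
  · rintro ⟨⟨η, hη, ξ, hξ, rfl⟩, h⟩
    rw [hn _ _ hξ] at h
    exact ⟨η, hη, ξ, ⟨hξ, h⟩, by rw [zero_add]⟩

theorem mem_ray_iff {θ : ℝ} (z : ℂ) : z ∈ ray 0 θ ↔ 0 < xc θ z ∧ yc θ z = 0 := by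
  constructor
  · rintro ⟨r, hr, rfl⟩
    change 0 < xc θ (0 + r * dir θ) ∧ yc θ (0 + r * dir θ) = 0
    rw [zero_add, xc_ofReal_mul, yc_ofReal_mul, xc_dir, yc_dir]
    simpa using hr
  · rintro ⟨hx, hy⟩
    refine ⟨xc θ z, hx, ?_⟩
    have := eq_coord θ z
    rw [hy] at this
    simpa [dir] using this

theorem mem_onRay_iff {Ω : DiscreteFilteredSet 0} {θ L : ℝ} (z : ℂ) :
    z ∈ onRay Ω θ L ↔ z ∈ Ω L ∧ z ∈ ray 0 θ ∧ ‖z‖ < L := by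
  have hn : ∀ ξ : ℝ, 0 < ξ → ‖(ξ : ℂ) * Complex.exp (θ * Complex.I)‖ = ξ := by
    intro ξ h
    rw [norm_mul, Complex.norm_exp_ofReal_mul_I, Complex.norm_real, Real.norm_eq_abs,
      abs_of_pos h, mul_one]
  constructor
  · rintro ⟨h, r, hr, rfl⟩
    refine ⟨h, ⟨r, hr.1, rfl⟩, ?_⟩
    rw [zero_add, hn r hr.1]; exact hr.2
  · rintro ⟨h, ⟨r, hr, rfl⟩, h2⟩
    rw [zero_add, hn r hr] at h2
    exact ⟨h, r, ⟨hr, h2⟩, rfl⟩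


/-! ### Piecewise `C¹` paths -/

/-- A subdivision of `[0,1]` into `n` closed pieces. -/
structure IsSubdivision (n : ℕ) (τ : ℕ → ℝ) : Prop where
  mono : Monotone τ
  zero : τ 0 = 0
  one : τ n = 1

/-- `g` is a continuous derivative of `f` on `[a, b]`. -/
def PieceDeriv (f g : ℝ → ℂ) (a b : ℝ) : Prop :=
  ContinuousOn g (Set.Icc a b) ∧ ∀ t ∈ Set.Icc a b, HasDerivWithinAt f (g t) (Set.Icc a b) t

/-- Break points of a subdivision may coincide; on such a degenerate piece any function counts as
the derivative. -/
theorem pieceDeriv_of_le {f : ℝ → ℂ} {a b : ℝ} (h : b ≤ a) (g : ℝ → ℂ) :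
    PieceDeriv f g a b := by
  have hs : (Set.Icc a b).Subsingleton := by
    intro x hx y hy
    linarith [hx.1, hx.2, hy.1, hy.2]
  refine ⟨hs.continuousOn g, fun t ht => ?_⟩
  rw [hs.eq_singleton_of_mem ht]
  exact HasFDerivWithinAt.singleton

theorem PieceDeriv.contDiffOn {f g : ℝ → ℂ} {a b : ℝ} (h : PieceDeriv f g a b) :
    ContDiffOn ℝ 1 f (Set.Icc a b) := by
  rcases lt_trichotomy a b with hab | rfl | hab
  · rw [contDiffOn_one_iff_derivWithin (uniqueDiffOn_Icc hab)]
    refine ⟨fun t ht => (h.2 t ht).differentiableWithinAt, h.1.congr fun t ht => ?_⟩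
    exact (h.2 t ht).derivWithin (uniqueDiffOn_Icc hab t ht)
  · rw [Set.Icc_self]
    exact (contDiffOn_const (c := f a)).congr (by simp)
  · rw [Set.Icc_eq_empty (not_le.2 hab)]
    exact contDiffOn_empty

theorem exists_pieceDeriv {f : ℝ → ℂ} {a b : ℝ} (h : ContDiffOn ℝ 1 f (Set.Icc a b)) :
    ∃ g, PieceDeriv f g a b := by
  rcases lt_or_ge a b with hab | hab
  · rw [contDiffOn_one_iff_derivWithin (uniqueDiffOn_Icc hab)] at h
    exact ⟨_, h.2, fun t ht => (h.1 t ht).hasDerivWithinAt⟩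
  · exact ⟨0, pieceDeriv_of_le hab 0⟩

theorem PieceDeriv.mono {f g : ℝ → ℂ} {a b a' b' : ℝ} (h : PieceDeriv f g a b)
    (ha : a ≤ a') (hb : b' ≤ b) : PieceDeriv f g a' b' :=
  have hs : Set.Icc a' b' ⊆ Set.Icc a b := Set.Icc_subset_Icc ha hb
  ⟨h.1.mono hs, fun t ht => (h.2 t (hs ht)).mono hs⟩

theorem PieceDeriv.hasDerivAt {f g : ℝ → ℂ} {a b : ℝ} (h : PieceDeriv f g a b) {t : ℝ}
    (ht : t ∈ Set.Ioo a b) : HasDerivAt f (g t) t :=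
  (h.2 t (Set.Ioo_subset_Icc_self ht)).hasDerivAt (Icc_mem_nhds ht.1 ht.2)

theorem PieceDeriv.hasDerivWithinAt_Ici {f g : ℝ → ℂ} {a b : ℝ} (h : PieceDeriv f g a b) {t : ℝ}
    (ht : t ∈ Set.Ico a b) : HasDerivWithinAt f (g t) (Set.Ici t) t :=
  ((h.2 t (Set.Ico_subset_Icc_self ht)).mono (Set.Icc_subset_Icc ht.1 le_rfl)).mono_of_mem_nhdsWithin
    (Icc_mem_nhdsGE ht.2)

theorem PieceDeriv.hasDerivWithinAt_Iic {f g : ℝ → ℂ} {a b : ℝ} (h : PieceDeriv f g a b) {t : ℝ}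
    (ht : t ∈ Set.Ioc a b) : HasDerivWithinAt f (g t) (Set.Iic t) t :=
  ((h.2 t (Set.Ioc_subset_Icc_self ht)).mono (Set.Icc_subset_Icc le_rfl ht.2)).mono_of_mem_nhdsWithin
    (Icc_mem_nhdsLE ht.1)

theorem pieceDeriv_congr {f f' g : ℝ → ℂ} {a b : ℝ} (h : PieceDeriv f g a b)
    (hf : Set.EqOn f' f (Set.Icc a b)) : PieceDeriv f' g a b :=
  ⟨h.1, fun t ht => (h.2 t ht).congr hf (hf ht)⟩

theorem piecewiseC1_iff {γ : C(I, ℂ)} : PiecewiseC1 γ ↔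
    ∃ n τ, IsSubdivision n τ ∧ ∀ i < n, ∃ g, PieceDeriv (ext γ) g (τ i) (τ (i + 1)) := by
  constructor
  · rintro ⟨n, τ, h1, h2, h3, h4⟩
    exact ⟨n, τ, ⟨h1, h2, h3⟩, fun i hi => exists_pieceDeriv (h4 i hi)⟩
  · rintro ⟨n, τ, h, h4⟩
    exact ⟨n, τ, h.mono, h.zero, h.one, fun i hi => (h4 i hi).choose_spec.contDiffOn⟩

theorem exists_mem_Ico {τ : ℕ → ℝ} {n : ℕ} {t : ℝ} (h0 : τ 0 ≤ t) (h1 : t < τ n) :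
    ∃ i < n, t ∈ Set.Ico (τ i) (τ (i + 1)) := by
  induction n with
  | zero => exact absurd h1 (not_lt.2 h0)
  | succ n ih =>
    rcases lt_or_ge t (τ n) with h | h
    · obtain ⟨i, hi, hi'⟩ := ih h
      exact ⟨i, by omega, hi'⟩
    · exact ⟨n, by omega, h, h1⟩

theorem exists_mem_Ioc {τ : ℕ → ℝ} {n : ℕ} {t : ℝ} (h0 : τ 0 < t) (h1 : t ≤ τ n) :
    ∃ i < n, t ∈ Set.Ioc (τ i) (τ (i + 1)) := by
  induction n with
  | zero => exact absurd h0 (not_lt.2 h1)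
  | succ n ih =>
    rcases le_or_gt t (τ n) with h | h
    · obtain ⟨i, hi, hi'⟩ := ih h
      exact ⟨i, by omega, hi'⟩
    · exact ⟨n, by omega, h, h1⟩

theorem continuous_ext (γ : C(I, ℂ)) : Continuous (ext γ) := γ.continuous.Icc_extend'

theorem ext_coe (γ : C(I, ℂ)) (t : I) : ext γ t = γ t := Set.IccExtend_val zero_le_one γ t

theorem ext_of_mem (γ : C(I, ℂ)) {t : ℝ} (ht : t ∈ I) : ext γ t = γ ⟨t, ht⟩ :=
  Set.IccExtend_of_mem zero_le_one γ ht

/-- The finite set of break points of a piecewise differentiable function. -/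
theorem exists_finite_hasDerivAt {f : ℝ → ℂ} {n : ℕ} {τ : ℕ → ℝ} (hτ : IsSubdivision n τ)
    (h : ∀ i < n, ∃ g, PieceDeriv f g (τ i) (τ (i + 1))) :
    ∃ S : Set ℝ, S.Finite ∧ ∀ t ∈ Set.Ioo (0 : ℝ) 1 \ S, HasDerivAt f (deriv f t) t := by
  refine ⟨τ '' Set.Iic n, (Set.finite_Iic n).image τ, fun t ht => ?_⟩
  obtain ⟨i, hi, hi'⟩ := exists_mem_Ico (τ := τ) (n := n) (t := t) (by rw [hτ.zero]; exact ht.1.1.le)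
    (by rw [hτ.one]; exact ht.1.2)
  obtain ⟨g, hg⟩ := h i hi
  have hne : τ i ≠ t := fun he => ht.2 ⟨i, hi.le, he⟩
  exact (hg.hasDerivAt ⟨lt_of_le_of_ne hi'.1 hne, hi'.2⟩).differentiableAt.hasDerivAt

theorem intervalIntegrable_deriv {f : ℝ → ℂ} {n : ℕ} {τ : ℕ → ℝ} (hτ : IsSubdivision n τ)
    (h : ∀ i < n, ∃ g, PieceDeriv f g (τ i) (τ (i + 1))) :
    IntervalIntegrable (deriv f) MeasureTheory.volume 0 1 := by
  rw [← hτ.zero, ← hτ.one]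
  refine IntervalIntegrable.trans_iterate fun i hi => ?_
  obtain ⟨g, hg⟩ := h i hi
  have hle := hτ.mono (Nat.le_succ i)
  have : IntervalIntegrable g MeasureTheory.volume (τ i) (τ (i + 1)) :=
    ContinuousOn.intervalIntegrable (by rw [Set.uIcc_of_le hle]; exact hg.1)
  refine this.congr_uIoo fun t ht => ?_
  rw [Set.uIoo_of_le hle] at ht
  exact (hg.hasDerivAt ht).deriv.symm

theorem PiecewiseC1.exists_finite {γ : C(I, ℂ)} (h : PiecewiseC1 γ) :
    ∃ S : Set ℝ, S.Finite ∧ ∀ t ∈ Set.Ioo (0 : ℝ) 1 \ S, HasDerivAt (ext γ) (deriv (ext γ) t) t := by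
  obtain ⟨n, τ, hτ, h⟩ := piecewiseC1_iff.1 h
  exact exists_finite_hasDerivAt hτ h

theorem PiecewiseC1.intervalIntegrable {γ : C(I, ℂ)} (h : PiecewiseC1 γ) :
    IntervalIntegrable (deriv (ext γ)) MeasureTheory.volume 0 1 := by
  obtain ⟨n, τ, hτ, h⟩ := piecewiseC1_iff.1 h
  exact intervalIntegrable_deriv hτ h

theorem PiecewiseC1.norm_sub_le {γ : C(I, ℂ)} (h : PiecewiseC1 γ) {a b : ℝ} (ha : 0 ≤ a)
    (hab : a ≤ b) (hb : b ≤ 1) :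
    ‖ext γ b - ext γ a‖ ≤ ∫ t in a..b, ‖deriv (ext γ) t‖ := by
  obtain ⟨S, hS, hd⟩ := h.exists_finite
  have hint : IntervalIntegrable (deriv (ext γ)) MeasureTheory.volume a b :=
    h.intervalIntegrable.mono_set (by
      rw [Set.uIcc_of_le hab, Set.uIcc_of_le zero_le_one]; exact Set.Icc_subset_Icc ha hb)
  rw [← MeasureTheory.integral_eq_of_hasDerivAt_off_countable_of_le _ _ hab hS.countable
    (continuous_ext γ).continuousOn (fun t ht => hd t ⟨⟨ha.trans_lt ht.1.1, ht.1.2.trans_le hb⟩, ht.2⟩)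
    hint]
  exact intervalIntegral.norm_integral_le_integral_norm hab

theorem PiecewiseC1.norm_sub_le_length {γ : C(I, ℂ)} (h : PiecewiseC1 γ) (s : I) :
    ‖γ s - γ 0‖ ≤ length γ := by
  have h1 := h.norm_sub_le le_rfl s.2.1 s.2.2
  rw [ext_coe, ext_of_mem γ (by simp : (0 : ℝ) ∈ I)] at h1
  refine h1.trans ?_
  exact intervalIntegral.integral_mono_interval le_rfl s.2.1 s.2.2
    (Filter.Eventually.of_forall fun t => norm_nonneg _) h.intervalIntegrable.norm

/-- Comparison of the length with an integral. -/
theorem length_le_integral {γ : C(I, ℂ)} (h : PiecewiseC1 γ) {u : ℝ → ℝ}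
    (hu : IntervalIntegrable u MeasureTheory.volume 0 1) {S : Set ℝ} (hS : S.Finite)
    (hle : ∀ t ∈ Set.Ioo (0 : ℝ) 1 \ S, ‖deriv (ext γ) t‖ ≤ u t) :
    length γ ≤ ∫ t in (0 : ℝ)..1, u t := by
  refine intervalIntegral.integral_mono_ae_restrict zero_le_one h.intervalIntegrable.norm hu ?_
  have h1 : ∀ᵐ t : ℝ, t ∉ S ∪ {0, 1} :=
    (hS.union (Set.toFinite _)).countable.ae_notMem _
  filter_upwards [MeasureTheory.ae_restrict_of_ae h1,
    MeasureTheory.ae_restrict_mem measurableSet_Icc] with t h2 h3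
  simp only [Set.mem_union, Set.mem_insert_iff, Set.mem_singleton_iff, not_or] at h2
  exact hle t ⟨⟨lt_of_le_of_ne h3.1 (Ne.symm h2.2.1), lt_of_le_of_ne h3.2 h2.2.2⟩, h2.1⟩

theorem length_nonneg (γ : C(I, ℂ)) : 0 ≤ length γ :=
  intervalIntegral.integral_nonneg zero_le_one fun _ _ => norm_nonneg _


/-! ### Forward paths -/

/-- `d` lies in the cone `|y| ≤ tan α x` with margin `c`. -/
def Slack (θ α c : ℝ) (d : ℂ) : Prop := c ≤ xc θ d ∧ |yc θ d| + c ≤ Real.tan α * xc θ d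

theorem Slack.mono {θ α c c' : ℝ} {d : ℂ} (h : Slack θ α c d) (hc : c' ≤ c) : Slack θ α c' d :=
  ⟨hc.trans h.1, by linarith [h.2]⟩

theorem Slack.smul {θ α c p : ℝ} {d : ℂ} (h : Slack θ α c d) (hp : 0 ≤ p) :
    Slack θ α (p * c) (p * d) := by
  refine ⟨by rw [xc_ofReal_mul]; exact mul_le_mul_of_nonneg_left h.1 hp, ?_⟩
  rw [xc_ofReal_mul, yc_ofReal_mul, abs_mul, abs_of_nonneg hp]
  nlinarith [h.2]

theorem Slack.add_small {θ α c κ : ℝ} {d e : ℂ} (h : Slack θ α c d) (ha : 0 ≤ Real.tan α)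
    (he : ‖e‖ ≤ κ) : Slack θ α (c - (1 + Real.tan α) * κ) (d + e) := by
  have h1 := abs_le.1 ((abs_xc_le_norm θ e).trans he)
  have h2 := (abs_yc_le_norm θ e).trans he
  have h3 := (norm_nonneg e).trans he
  refine ⟨?_, ?_⟩
  · rw [map_add]; nlinarith [h.1]
  · rw [map_add, map_add]
    nlinarith [h.2, abs_add_le (yc θ d) (yc θ e)]

theorem Slack.mem_cone {θ α c : ℝ} (hα : α ∈ Set.Ioo 0 (Real.pi / 2)) {d : ℂ} (h : Slack θ α c d)
    (hc : 0 < c) : d ∈ cone θ α :=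
  (mem_cone_iff hα).2 ⟨hc.trans_le h.1, by linarith [h.2]⟩

/-- `f` is piecewise `C¹` on `[0,1]` and its derivatives have margin `c` in the cone. -/
def Fwd (θ α c : ℝ) (f : ℝ → ℂ) (n : ℕ) (τ : ℕ → ℝ) : Prop :=
  IsSubdivision n τ ∧ ∀ i < n, ∃ g, PieceDeriv f g (τ i) (τ (i + 1)) ∧
    ∀ t ∈ Set.Icc (τ i) (τ (i + 1)), Slack θ α c (g t)

theorem tan_pos_of_mem {α : ℝ} (hα : α ∈ Set.Ioo 0 (Real.pi / 2)) : 0 < Real.tan α :=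
  Real.tan_pos_of_pos_of_lt_pi_div_two hα.1 hα.2

theorem exists_forall_lt_of_antitone {P : ℕ → ℝ → Prop} (hP : ∀ i c c', c' ≤ c → P i c → P i c')
    (n : ℕ) (h : ∀ i < n, ∃ c > 0, P i c) : ∃ c > 0, ∀ i < n, P i c := by
  induction n with
  | zero => exact ⟨1, one_pos, by simp⟩
  | succ n ih =>
    obtain ⟨c, hc, h1⟩ := ih fun i hi => h i (by omega)
    obtain ⟨c', hc', h2⟩ := h n (by omega)
    refine ⟨min c c', lt_min hc hc', fun i hi => ?_⟩
    rcases Nat.lt_succ_iff_lt_or_eq.1 hi with h3 | rfl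
    · exact hP _ _ _ (min_le_left _ _) (h1 i h3)
    · exact hP _ _ _ (min_le_right _ _) h2

/-- On each closed piece the derivative is continuous and takes values in the open cone, so
compactness gives a uniform margin. This margin is what small perturbations can spend. -/
theorem IsForward.exists_fwd {θ α L : ℝ} (hα : α ∈ Set.Ioo 0 (Real.pi / 2)) {γ : C(I, ℂ)}
    (h : IsForward 0 θ α L γ) : ∃ c > 0, ∃ n τ, Fwd θ α c (ext γ) n τ := by
  obtain ⟨-, hpc, -, hr, hl⟩ := h
  obtain ⟨n, τ, hτ, hd⟩ := piecewiseC1_iff.1 hpc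
  obtain ⟨c, hc, h⟩ := exists_forall_lt_of_antitone
    (P := fun i c => ∃ g, PieceDeriv (ext γ) g (τ i) (τ (i + 1)) ∧
      ∀ t ∈ Set.Icc (τ i) (τ (i + 1)), Slack θ α c (g t))
    (fun i c c' hc ⟨g, h1, h2⟩ => ⟨g, h1, fun t ht => (h2 t ht).mono hc⟩) n (by
      intro i hi
      rcases lt_or_ge (τ i) (τ (i + 1)) with hlt | hge
      · obtain ⟨g, hg⟩ := hd i hi
        have h0 : 0 ≤ τ i := hτ.zero ▸ hτ.mono (Nat.zero_le i)
        have h1 : τ (i + 1) ≤ 1 := hτ.one ▸ hτ.mono hi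
        have hcone : ∀ t ∈ Set.Icc (τ i) (τ (i + 1)), g t ∈ cone θ α := by
          intro t ht
          -- The right derivative of the path identifies `g t` except at the end of the piece, where
          -- the left derivative is used.
          rcases lt_or_eq_of_le ht.2 with h2 | h2
          · rw [← (hg.hasDerivWithinAt_Ici ⟨ht.1, h2⟩).derivWithin (uniqueDiffWithinAt_Ici t)]
            exact hr t ⟨h0.trans ht.1, h2.trans_le h1⟩
          · have h3 : τ i < t := h2 ▸ hlt
            rw [← (hg.hasDerivWithinAt_Iic ⟨h3, ht.2⟩).derivWithin (uniqueDiffWithinAt_Iic t)]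
            exact hl t ⟨h0.trans_lt h3, ht.2.trans h1⟩
        set u : ℝ → ℝ := fun t => min (xc θ (g t)) (Real.tan α * xc θ (g t) - |yc θ (g t)|) with hu
        have hcont : ContinuousOn u (Set.Icc (τ i) (τ (i + 1))) := by
          have h4 : ContinuousOn (fun t => xc θ (g t)) (Set.Icc (τ i) (τ (i + 1))) :=
            (xc θ).continuous.comp_continuousOn hg.1
          have h5 : ContinuousOn (fun t => yc θ (g t)) (Set.Icc (τ i) (τ (i + 1))) :=
            (yc θ).continuous.comp_continuousOn hg.1
          exact ContinuousOn.inf h4 ((continuousOn_const.mul h4).sub h5.abs)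
        obtain ⟨t₀, ht₀, hmin⟩ := isCompact_Icc.exists_isMinOn (Set.nonempty_Icc.2 hlt.le) hcont
        have hpos := (mem_cone_iff hα).1 (hcone t₀ ht₀)
        refine ⟨u t₀, lt_min hpos.1 (by linarith [hpos.2]), g, hg, fun t ht => ?_⟩
        have h6 := hmin ht
        simp only [hu, Set.mem_ofPred_eq] at h6
        exact ⟨h6.trans (min_le_left _ _), by linarith [h6.trans (min_le_right _ _)]⟩
      · refine ⟨min 1 (Real.tan α), lt_min one_pos (tan_pos_of_mem hα), fun _ => dir θ,
          pieceDeriv_of_le hge _, fun t _ => ⟨?_, ?_⟩⟩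
        · rw [xc_dir]; exact min_le_left _ _
        · rw [xc_dir, yc_dir]; simp)
  exact ⟨c, hc, n, τ, hτ, h⟩

theorem Fwd.piecewiseC1 {θ α c : ℝ} {γ : C(I, ℂ)} {n : ℕ} {τ : ℕ → ℝ}
    (h : Fwd θ α c (ext γ) n τ) : PiecewiseC1 γ :=
  piecewiseC1_iff.2 ⟨n, τ, h.1, fun i hi => (h.2 i hi).imp fun _ hg => hg.1⟩

theorem Fwd.right {θ α c : ℝ} {f : ℝ → ℂ} {n : ℕ} {τ : ℕ → ℝ} (h : Fwd θ α c f n τ) {t : ℝ}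
    (ht : t ∈ Set.Ico (0 : ℝ) 1) : ∃ d, HasDerivWithinAt f d (Set.Ici t) t ∧ Slack θ α c d := by
  obtain ⟨i, hi, hi'⟩ := exists_mem_Ico (τ := τ) (n := n) (t := t) (by rw [h.1.zero]; exact ht.1)
    (by rw [h.1.one]; exact ht.2)
  obtain ⟨g, hg, hs⟩ := h.2 i hi
  exact ⟨g t, hg.hasDerivWithinAt_Ici hi', hs t (Set.Ico_subset_Icc_self hi')⟩

theorem Fwd.left {θ α c : ℝ} {f : ℝ → ℂ} {n : ℕ} {τ : ℕ → ℝ} (h : Fwd θ α c f n τ) {t : ℝ}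
    (ht : t ∈ Set.Ioc (0 : ℝ) 1) : ∃ d, HasDerivWithinAt f d (Set.Iic t) t ∧ Slack θ α c d := by
  obtain ⟨i, hi, hi'⟩ := exists_mem_Ioc (τ := τ) (n := n) (t := t) (by rw [h.1.zero]; exact ht.1)
    (by rw [h.1.one]; exact ht.2)
  obtain ⟨g, hg, hs⟩ := h.2 i hi
  exact ⟨g t, hg.hasDerivWithinAt_Iic hi', hs t (Set.Ioc_subset_Icc_self hi')⟩

theorem Fwd.isForward {θ α c L : ℝ} (hα : α ∈ Set.Ioo 0 (Real.pi / 2)) {γ : C(I, ℂ)} {n : ℕ}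
    {τ : ℕ → ℝ} (h : Fwd θ α c (ext γ) n τ) (hc : 0 < c) (h0 : γ 0 = 0) (hL : length γ < L) :
    IsForward 0 θ α L γ := by
  refine ⟨h0, h.piecewiseC1, hL, fun t ht => ?_, fun t ht => ?_⟩
  · obtain ⟨d, hd, hs⟩ := h.right ht
    rw [hd.derivWithin (uniqueDiffWithinAt_Ici t)]
    exact hs.mem_cone hα hc
  · obtain ⟨d, hd, hs⟩ := h.left ht
    rw [hd.derivWithin (uniqueDiffWithinAt_Iic t)]
    exact hs.mem_cone hα hc

/-- A function with right derivative bounded below increases at least linearly. -/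
theorem le_sub_of_right_deriv {u : ℝ → ℝ} {a b c : ℝ} (hab : a ≤ b)
    (hu : ContinuousOn u (Set.Icc a b))
    (hd : ∀ t ∈ Set.Ico a b, ∃ d, HasDerivWithinAt u d (Set.Ici t) t ∧ c ≤ d) :
    c * (b - a) ≤ u b - u a := by
  choose! u' hu' hc using hd
  have := image_le_of_deriv_right_le_deriv_boundary (f := fun t => u a + c * (t - a))
    (f' := fun _ => c) (B := u) (B' := u') (a := a) (b := b) (by fun_prop)
    (fun t _ => by
      have := (((hasDerivAt_id t).sub_const a).const_mul c).const_add (u a)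
      simpa using this.hasDerivWithinAt) (by simp) hu hu' hc (Set.right_mem_Icc.2 hab)
  linarith

/-- The margin says that the functionals `x`, `tan α x - y` and `tan α x + y` have right derivative
at least `c` along the path; each inequality is then integrated. -/
theorem Fwd.slack_sub {θ α c : ℝ} {f : ℝ → ℂ} {n : ℕ} {τ : ℕ → ℝ} (h : Fwd θ α c f n τ)
    (hf : Continuous f) {a b : ℝ} (ha : 0 ≤ a) (hab : a ≤ b) (hb : b ≤ 1) :
    Slack θ α (c * (b - a)) (f b - f a) := by
  have hd : ∀ t ∈ Set.Ico a b, ∃ d, HasDerivWithinAt f d (Set.Ici t) t ∧ Slack θ α c d :=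
    fun t ht => h.right ⟨ha.trans ht.1, ht.2.trans_le hb⟩
  have hx := le_sub_of_right_deriv (u := fun t => xc θ (f t)) (c := c) hab (by fun_prop)
    fun t ht => by
      obtain ⟨d, hd, hs⟩ := hd t ht
      exact ⟨xc θ d, (xc θ).hasFDerivAt.comp_hasDerivWithinAt t hd, hs.1⟩
  have hy1 := le_sub_of_right_deriv (u := fun t => Real.tan α * xc θ (f t) - yc θ (f t)) (c := c)
    hab (by fun_prop) fun t ht => by
      obtain ⟨d, hd, hs⟩ := hd t ht
      refine ⟨_, (((xc θ).hasFDerivAt.comp_hasDerivWithinAt t hd).const_mul _).sub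
        ((yc θ).hasFDerivAt.comp_hasDerivWithinAt t hd), ?_⟩
      linarith [hs.2, le_abs_self (yc θ d)]
  have hy2 := le_sub_of_right_deriv (u := fun t => Real.tan α * xc θ (f t) + yc θ (f t)) (c := c)
    hab (by fun_prop) fun t ht => by
      obtain ⟨d, hd, hs⟩ := hd t ht
      refine ⟨_, (((xc θ).hasFDerivAt.comp_hasDerivWithinAt t hd).const_mul _).add
        ((yc θ).hasFDerivAt.comp_hasDerivWithinAt t hd), ?_⟩
      linarith [hs.2, neg_abs_le (yc θ d)]
  refine ⟨by rw [map_sub]; exact hx, ?_⟩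
  rw [map_sub, map_sub]
  have : |yc θ (f b) - yc θ (f a)| ≤
      Real.tan α * (xc θ (f b) - xc θ (f a)) - c * (b - a) :=
    abs_le.2 ⟨by linarith, by linarith⟩
  linarith

/-! ### Perturbations of forward paths -/

/-- The path `γ` pushed in the direction `i e^{iθ}`, with the same origin and the same position
at time `T`. -/
noncomputable def perturb (θ : ℝ) (γ : C(I, ℂ)) (ε T : ℝ) : C(I, ℂ) :=
  ⟨fun u => γ u + ((ε * (u * (T - u)) : ℝ) : ℂ) * (Complex.I * dir θ), by fun_prop⟩

theorem norm_I_dir (θ : ℝ) : ‖Complex.I * dir θ‖ = 1 := by simp [norm_dir]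

theorem PieceDeriv.add {f g k k' : ℝ → ℂ} {a b : ℝ} (h : PieceDeriv f g a b)
    (hk : PieceDeriv k k' a b) : PieceDeriv (f + k) (g + k') a b :=
  ⟨h.1.add hk.1, fun t ht => (h.2 t ht).add (hk.2 t ht)⟩

theorem hasDerivAt_bump (θ ε T t : ℝ) :
    HasDerivAt (fun u : ℝ => ((ε * (u * (T - u)) : ℝ) : ℂ) * (Complex.I * dir θ))
      (((ε * (T - 2 * t) : ℝ) : ℂ) * (Complex.I * dir θ)) t := by
  have h : HasDerivAt (fun u : ℝ => ε * (u * (T - u))) (ε * (T - 2 * t)) t := by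
    have := ((hasDerivAt_id t).mul ((hasDerivAt_id t).const_sub T)).const_mul ε
    refine this.congr_deriv ?_
    simp only [id]; ring
  exact h.ofReal_comp.mul_const _

theorem norm_bump_deriv_le {θ ε T t : ℝ} (hT : T ∈ I) (ht : t ∈ I) :
    ‖((ε * (T - 2 * t) : ℝ) : ℂ) * (Complex.I * dir θ)‖ ≤ 2 * |ε| := by
  rw [norm_mul, norm_I_dir, mul_one, Complex.norm_real, Real.norm_eq_abs, abs_mul, mul_comm]
  refine mul_le_mul_of_nonneg_right ?_ (abs_nonneg _)
  exact abs_le.2 ⟨by linarith [hT.1, ht.2], by linarith [hT.2, ht.1]⟩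

theorem ext_perturb (θ : ℝ) (γ : C(I, ℂ)) (ε T : ℝ) : Set.EqOn (ext (perturb θ γ ε T))
    (ext γ + fun u : ℝ => ((ε * (u * (T - u)) : ℝ) : ℂ) * (Complex.I * dir θ)) (Set.Icc 0 1) := by
  intro t ht
  rw [ext_of_mem _ ht, Pi.add_apply, ext_of_mem _ ht]
  rfl

theorem IsSubdivision.nonneg {n : ℕ} {τ : ℕ → ℝ} (h : IsSubdivision n τ) (i : ℕ) : 0 ≤ τ i :=
  h.zero ▸ h.mono (Nat.zero_le i)

theorem IsSubdivision.le_one {n : ℕ} {τ : ℕ → ℝ} (h : IsSubdivision n τ) {i : ℕ} (hi : i ≤ n) :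
    τ i ≤ 1 := h.one ▸ h.mono hi

theorem IsSubdivision.Icc_subset {n : ℕ} {τ : ℕ → ℝ} (h : IsSubdivision n τ) {i : ℕ} (hi : i < n) :
    Set.Icc (τ i) (τ (i + 1)) ⊆ Set.Icc 0 1 :=
  Set.Icc_subset_Icc (h.nonneg i) (h.le_one hi)

theorem Fwd.perturb {θ α c : ℝ} (hα : 0 ≤ Real.tan α) {γ : C(I, ℂ)} {n : ℕ} {τ : ℕ → ℝ}
    (h : Fwd θ α c (ext γ) n τ) (ε : ℝ) {T : ℝ} (hT : T ∈ I) :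
    Fwd θ α (c - (1 + Real.tan α) * (2 * |ε|)) (ext (Endless.perturb θ γ ε T)) n τ := by
  refine ⟨h.1, fun i hi => ?_⟩
  obtain ⟨g, hg, hs⟩ := h.2 i hi
  have hsub := h.1.Icc_subset hi
  refine ⟨_, pieceDeriv_congr (hg.add (k := fun u : ℝ =>
    ((ε * (u * (T - u)) : ℝ) : ℂ) * (Complex.I * dir θ)) (k' := fun t : ℝ =>
    ((ε * (T - 2 * t) : ℝ) : ℂ) * (Complex.I * dir θ)) ⟨by fun_prop, fun t _ =>
      (hasDerivAt_bump θ ε T t).hasDerivWithinAt⟩) ((ext_perturb θ γ ε T).mono hsub), fun t ht => ?_⟩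
  exact (hs t ht).add_small hα (norm_bump_deriv_le hT (hsub ht))

theorem length_perturb_le {θ : ℝ} {γ : C(I, ℂ)} (h : PiecewiseC1 γ) (ε : ℝ) {T : ℝ} (hT : T ∈ I)
    (h' : PiecewiseC1 (perturb θ γ ε T)) :
    length (perturb θ γ ε T) ≤ length γ + 2 * |ε| := by
  obtain ⟨S, hS, hd⟩ := h.exists_finite
  have hint := h.intervalIntegrable.norm
  refine (length_le_integral h' (u := fun t => ‖deriv (ext γ) t‖ + 2 * |ε|)
    (hint.add intervalIntegrable_const) hS fun t ht => ?_).trans_eq ?_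
  · have h1 : HasDerivAt (ext (perturb θ γ ε T)) (deriv (ext γ) t +
        ((ε * (T - 2 * t) : ℝ) : ℂ) * (Complex.I * dir θ)) t :=
      ((hd t ht).add (hasDerivAt_bump θ ε T t)).congr_of_eventuallyEq
        ((ext_perturb θ γ ε T).eventuallyEq_of_mem (Icc_mem_nhds ht.1.1 ht.1.2))
    rw [h1.deriv]
    exact (norm_add_le _ _).trans (by gcongr; exact norm_bump_deriv_le hT ⟨ht.1.1.le, ht.1.2.le⟩)
  · rw [intervalIntegral.integral_add hint intervalIntegrable_const]
    simp [length]

theorem IsForward.perturb {θ α L : ℝ} (hα : α ∈ Set.Ioo 0 (Real.pi / 2)) {γ : C(I, ℂ)}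
    (h : IsForward 0 θ α L γ) :
    ∃ ε₀ > 0, ∀ ε, |ε| ≤ ε₀ → ∀ T ∈ I, IsForward 0 θ α L (Endless.perturb θ γ ε T) := by
  obtain ⟨c, hc, n, τ, hF⟩ := h.exists_fwd hα
  have ht := tan_pos_of_mem hα
  have hlen : 0 < L - length γ := by linarith [h.2.2.1]
  -- The bump has derivative at most `2 |ε|`: the first bound keeps half of the margin `c`, the
  -- second uses at most half of the spare length.
  refine ⟨min (c / (4 * (1 + Real.tan α))) ((L - length γ) / 4), by positivity,
    fun ε hε T hT => ?_⟩
  have h1 := hF.perturb ht.le ε hT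
  have h2 : |ε| * (4 * (1 + Real.tan α)) ≤ c :=
    (le_div_iff₀ (by positivity)).1 (hε.trans (min_le_left _ _))
  have h3 := hε.trans (min_le_right _ _)
  refine h1.isForward hα (by nlinarith) ?_ ?_
  · simp [Endless.perturb, h.1]
  · have := length_perturb_le (θ := θ) h.2.1 ε hT h1.piecewiseC1
    linarith

/-! ### Refinement and contraction -/

/-- Every piece is cut into `M` equal parts with `1 / M < δ`; the `k`-th new point is number `k % M`
in the piece `k / M`. -/
theorem IsSubdivision.exists_refinement {n : ℕ} {τ : ℕ → ℝ} (h : IsSubdivision n τ) {δ : ℝ}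
    (hδ : 0 < δ) : ∃ n' τ', IsSubdivision n' τ' ∧
      ∀ i < n', τ' (i + 1) - τ' i ≤ δ ∧ ∃ j < n, τ j ≤ τ' i ∧ τ' (i + 1) ≤ τ (j + 1) := by
  obtain ⟨M, hM⟩ := exists_nat_gt (1 / δ)
  have hM0 : 0 < M := by
    rcases Nat.eq_zero_or_pos M with h0 | h0
    · rw [h0] at hM
      have : 0 < 1 / δ := by positivity
      norm_num at hM
      linarith
    · exact h0
  have hMr : (0 : ℝ) < M := by exact_mod_cast hM0
  set τ' : ℕ → ℝ := fun k => τ (k / M) + ((k % M : ℕ) : ℝ) / M * (τ (k / M + 1) - τ (k / M)) with hτ'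
  have hsucc : ∀ k, τ' (k + 1) - τ' k = (τ (k / M + 1) - τ (k / M)) / M := by
    intro k
    have hk := Nat.div_add_mod k M
    have hlt := Nat.mod_lt k hM0
    rcases Nat.lt_or_ge (k % M + 1) M with h1 | h1
    · have h2 : (k + 1) / M = k / M := by
        have h5 := mul_comm M (k / M)
        refine Nat.div_eq_of_lt_le (by omega) ?_
        rw [Nat.succ_mul]; omega
      have h3 : (k + 1) % M = k % M + 1 := by
        have := Nat.div_add_mod (k + 1) M
        rw [h2] at this
        omega
      simp only [hτ', h2, h3]
      push_cast
      ring
    -- The carry: point `k + 1` is the first one of the next piece.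
    · have h4 : k % M + 1 = M := by omega
      have h2 : (k + 1) / M = k / M + 1 := by
        have h5 := mul_comm M (k / M)
        refine Nat.div_eq_of_lt_le ?_ ?_
        · rw [Nat.succ_mul]; omega
        · rw [Nat.succ_mul, Nat.succ_mul]; omega
      have h3 : (k + 1) % M = 0 := by
        have := Nat.div_add_mod (k + 1) M
        rw [h2, mul_add] at this
        omega
      have h5 : ((k % M : ℕ) : ℝ) = M - 1 := by
        rw [eq_sub_iff_add_eq]; exact_mod_cast h4
      simp only [hτ', h2, h3, h5]
      field_simp
      push_cast
      ring
  have hnn : ∀ k, 0 ≤ τ (k / M + 1) - τ (k / M) := fun k => sub_nonneg.2 (h.mono (Nat.le_succ _))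
  have hmono : Monotone τ' := monotone_nat_of_le_succ fun k => by
    have := hsucc k
    have h1 : 0 ≤ (τ (k / M + 1) - τ (k / M)) / M := div_nonneg (hnn k) hMr.le
    linarith
  have hfrac : ∀ k, ((k % M : ℕ) : ℝ) / M + 1 / M ≤ 1 := by
    intro k
    rw [← add_div, div_le_one hMr]
    exact_mod_cast Nat.mod_lt k hM0
  refine ⟨n * M, τ', ⟨hmono, by simp [hτ', h.zero], by simp [hτ', hM0, h.one]⟩, fun k hk => ?_⟩
  have hj : k / M < n := (Nat.div_lt_iff_lt_mul hM0).2 hk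
  have h0 : 0 ≤ ((k % M : ℕ) : ℝ) / M := by positivity
  refine ⟨?_, k / M, hj, ?_, ?_⟩
  · rw [hsucc]
    have h1 := h.le_one (i := k / M + 1) hj
    have h2 := h.nonneg (k / M)
    rw [div_le_iff₀ hMr]
    rw [div_lt_iff₀ hδ] at hM
    nlinarith
  · simp only [hτ']
    nlinarith [mul_nonneg h0 (hnn k)]
  · have h1 := hsucc k
    have h2 := mul_le_mul_of_nonneg_right (hfrac k) (hnn k)
    have h3 : τ' k = τ (k / M) + ((k % M : ℕ) : ℝ) / M * (τ (k / M + 1) - τ (k / M)) := rfl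
    have h4 : (τ (k / M + 1) - τ (k / M)) / M = 1 / M * (τ (k / M + 1) - τ (k / M)) := by ring
    nlinarith

theorem Fwd.exists_refinement {θ α c : ℝ} {f : ℝ → ℂ} {n : ℕ} {τ : ℕ → ℝ} (h : Fwd θ α c f n τ)
    {δ : ℝ} (hδ : 0 < δ) : ∃ n' τ', Fwd θ α c f n' τ' ∧ ∀ i < n', τ' (i + 1) - τ' i ≤ δ := by
  obtain ⟨n', τ', h1, h2⟩ := h.1.exists_refinement hδ
  refine ⟨n', τ', ⟨h1, fun i hi => ?_⟩, fun i hi => (h2 i hi).1⟩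
  obtain ⟨-, j, hj, hj1, hj2⟩ := h2 i hi
  obtain ⟨g, hg, hs⟩ := h.2 j hj
  exact ⟨g, hg.mono hj1 hj2, fun t ht => hs t (Set.Icc_subset_Icc hj1 hj2 ht)⟩

/-- A path whose increments on each piece are multiples of those of a forward path. -/
theorem Fwd.isForward_of_multiples {θ α c L : ℝ} (hα : α ∈ Set.Ioo 0 (Real.pi / 2))
    {γ h : C(I, ℂ)} {n : ℕ} {τ : ℕ → ℝ} (hF : Fwd θ α c (ext γ) n τ) (hc : 0 < c)
    (hL : length γ < L) (h0 : h 0 = 0) {p : ℕ → ℝ} (hp : ∀ i < n, 0 < p i ∧ p i ≤ 1)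
    (hh : ∀ i < n, ∀ t ∈ Set.Icc (τ i) (τ (i + 1)),
      ext h t = ext h (τ i) + p i * (ext γ t - ext γ (τ i))) : IsForward 0 θ α L h := by
  obtain ⟨m, hm, hmp⟩ := exists_forall_lt_of_antitone (P := fun i m => m ≤ p i)
    (fun i m m' h1 h2 => h1.trans h2) n (fun i hi => ⟨p i, (hp i hi).1, le_rfl⟩)
  have hpd : ∀ i < n, ∀ g, PieceDeriv (ext γ) g (τ i) (τ (i + 1)) →
      PieceDeriv (ext h) (fun t => p i * g t) (τ i) (τ (i + 1)) := by
    intro i hi g hg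
    refine ⟨continuousOn_const.mul hg.1, fun t ht => ?_⟩
    exact ((((hg.2 t ht).sub_const _).const_mul _).const_add _).congr (hh i hi) (hh i hi t ht)
  have hF' : Fwd θ α (m * c) (ext h) n τ := by
    refine ⟨hF.1, fun i hi => ?_⟩
    obtain ⟨g, hg, hs⟩ := hF.2 i hi
    refine ⟨_, hpd i hi g hg, fun t ht => ((hs t ht).smul (hp i hi).1.le).mono ?_⟩
    exact mul_le_mul_of_nonneg_right (hmp i hi) hc.le
  refine hF'.isForward hα (by positivity) h0 (lt_of_le_of_lt ?_ hL)
  obtain ⟨S, hS, hd⟩ := hF.piecewiseC1.exists_finite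
  refine length_le_integral hF'.piecewiseC1 hF.piecewiseC1.intervalIntegrable.norm
    ((Set.finite_Iic n).image τ) fun t ht => ?_
  obtain ⟨i, hi, hi'⟩ := exists_mem_Ico (τ := τ) (n := n) (t := t) (by rw [hF.1.zero]; exact ht.1.1.le)
    (by rw [hF.1.one]; exact ht.1.2)
  obtain ⟨g, hg, -⟩ := hF.2 i hi
  have hne : τ i ≠ t := fun he => ht.2 ⟨i, hi.le, he⟩
  have hti : t ∈ Set.Ioo (τ i) (τ (i + 1)) := ⟨lt_of_le_of_ne hi'.1 hne, hi'.2⟩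
  rw [((hpd i hi g hg).hasDerivAt hti).deriv, (hg.hasDerivAt hti).deriv, norm_mul,
    Complex.norm_real, Real.norm_eq_abs, abs_of_pos (hp i hi).1]
  exact mul_le_of_le_one_left (norm_nonneg _) (hp i hi).2


/-! ### The set of glimpsed singular points -/

theorem IsForward.norm_lt {θ α L : ℝ} {γ : C(I, ℂ)} (h : IsForward 0 θ α L γ) (s : I) :
    ‖γ s‖ < L := by
  have := h.2.1.norm_sub_le_length s
  rw [h.1, sub_zero] at this
  exact this.trans_lt h.2.2.1

theorem cone_mono {θ α α' : ℝ} (h : α ≤ α') : cone θ α ⊆ cone θ α' := by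
  rintro z ⟨η, hη, ξ, hξ, rfl⟩
  exact ⟨η, ⟨by linarith [hη.1], by linarith [hη.2]⟩, ξ, hξ, rfl⟩

theorem IsForward.mono {θ α α' L L' : ℝ} {γ : C(I, ℂ)} (h : IsForward 0 θ α L γ) (hα : α ≤ α')
    (hL : L ≤ L') : IsForward 0 θ α' L' γ :=
  ⟨h.1, h.2.1, h.2.2.1.trans_le hL, fun t ht => cone_mono hα (h.2.2.2.1 t ht),
    fun t ht => cone_mono hα (h.2.2.2.2 t ht)⟩

theorem IsForward.exists_xc_le {θ α L : ℝ} (hα : α ∈ Set.Ioo 0 (Real.pi / 2)) {γ : C(I, ℂ)}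
    (h : IsForward 0 θ α L γ) : ∃ c > 0, ∀ a b : I, a ≤ b →
      Slack θ α (c * (b - a)) (γ b - γ a) := by
  obtain ⟨c, hc, n, τ, hF⟩ := h.exists_fwd hα
  refine ⟨c, hc, fun a b hab => ?_⟩
  have := hF.slack_sub (continuous_ext γ) a.2.1 hab b.2.2
  rwa [ext_coe, ext_coe] at this

theorem IsForward.strictMono {θ α L : ℝ} (hα : α ∈ Set.Ioo 0 (Real.pi / 2)) {γ : C(I, ℂ)}
    (h : IsForward 0 θ α L γ) : StrictMono fun s : I => xc θ (γ s) := by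
  obtain ⟨c, hc, hs⟩ := h.exists_xc_le hα
  intro a b hab
  have h1 := (hs a b hab.le).1
  rw [map_sub] at h1
  have h2 : (0 : ℝ) < b - a := sub_pos.2 hab
  nlinarith [mul_pos hc h2]

theorem xc_perturb (θ : ℝ) (γ : C(I, ℂ)) (ε T : ℝ) (u : I) :
    xc θ (perturb θ γ ε T u) = xc θ (γ u) := by
  change xc θ (γ u + _) = _
  rw [map_add, xc_ofReal_mul, xc_I_dir, mul_zero, add_zero]

theorem yc_perturb (θ : ℝ) (γ : C(I, ℂ)) (ε T : ℝ) (u : I) :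
    yc θ (perturb θ γ ε T u) = yc θ (γ u) + ε * (u * (T - u)) := by
  change yc θ (γ u + _) = _
  rw [map_add, yc_ofReal_mul, yc_I_dir, mul_one]

theorem exists_pos_forall_lt {ι : Type*} {U : Set ι} (hU : U.Finite) {v : ι → ℝ}
    (hv : ∀ i ∈ U, 0 < v i) : ∃ ε > 0, ∀ i ∈ U, ε < v i := by
  induction U, hU using Set.Finite.induction_on with
  | empty => exact ⟨1, one_pos, by simp⟩
  | @insert a s _ _ ih =>
    obtain ⟨ε, hε, h⟩ := ih fun i hi => hv i (Set.mem_insert_of_mem _ hi)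
    have ha := hv a (Set.mem_insert _ _)
    refine ⟨min ε (v a / 2), lt_min hε (by positivity), fun i hi => ?_⟩
    rcases hi with rfl | hi
    · exact (min_le_right _ _).trans_lt (by linarith)
    · exact (min_le_left _ _).trans_lt (h i hi)

theorem abs_mul_sub_le_one {u T : ℝ} (hu : u ∈ I) (hT : T ∈ I) : |u * (T - u)| ≤ 1 := by
  rw [abs_mul, abs_of_nonneg hu.1]
  have : |T - u| ≤ 1 := abs_le.2 ⟨by linarith [hT.1, hu.2], by linarith [hT.2, hu.1]⟩
  nlinarith [abs_nonneg (T - u), hu.1, hu.2]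

/-- Small perturbations of a forward path meet given points of the ray only at the chosen time. -/
theorem IsForward.exists_perturb {θ α L : ℝ} (hα : α ∈ Set.Ioo 0 (Real.pi / 2)) {γ : C(I, ℂ)}
    (h : IsForward 0 θ α L γ) {S : Set ℂ} (hS : (S ∩ Metric.ball 0 L).Finite) (hr : S ⊆ ray 0 θ) :
    ∃ ε > 0, ∀ T : I, IsForward 0 θ α L (Endless.perturb θ γ ε T) ∧
      ∀ u : I, Endless.perturb θ γ ε T u ∈ S → u = T := by
  obtain ⟨ε₀, hε₀, hp⟩ := h.perturb hα
  -- `U` collects the times at which `γ` passes beside a relevant point of `S`, at the same abscissa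
  -- but off the ray. Strict monotonicity of the abscissa makes it finite, and a bump smaller than
  -- each of these offsets cannot bring the path back to the ray there.
  set U : Set I := {u | xc θ (γ u) ∈ xc θ '' (S ∩ Metric.ball 0 L) ∧ yc θ (γ u) ≠ 0} with hU
  have hUf : U.Finite := by
    refine Set.Finite.subset ((hS.image (xc θ)).preimage
      (f := fun u : I => xc θ (γ u)) (h.strictMono hα).injective.injOn) fun u hu => hu.1
  obtain ⟨ε₁, hε₁, hlt⟩ := exists_pos_forall_lt hUf (v := fun u => |yc θ (γ u)|)
    fun u hu => abs_pos.2 hu.2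
  have hε : 0 < min ε₀ ε₁ := lt_min hε₀ hε₁
  refine ⟨min ε₀ ε₁, hε, fun T => ?_⟩
  have hf := hp (min ε₀ ε₁) (by rw [abs_of_pos hε]; exact min_le_left _ _) T T.2
  refine ⟨hf, fun u hu => ?_⟩
  have hx := xc_perturb θ γ (min ε₀ ε₁) T u
  have hy := yc_perturb θ γ (min ε₀ ε₁) T u
  have hray := (mem_ray_iff _).1 (hr hu)
  rw [hray.2] at hy
  have hy0 : yc θ (γ u) = 0 := by
    by_contra hne
    have h1 := hlt u ⟨⟨_, ⟨hu, by simpa using hf.norm_lt u⟩, hx⟩, hne⟩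
    have h2 : |yc θ (γ u)| = |min ε₀ ε₁ * (u * (T - u))| := by
      rw [← abs_neg]; congr 1; linarith
    rw [abs_mul, abs_of_pos hε] at h2
    have h3 := abs_mul_sub_le_one u.2 T.2
    have h4 := min_le_right ε₀ ε₁
    nlinarith
  -- At the remaining times the offset is the bump itself, which vanishes only for `u = 0`, excluded
  -- because `0` is not on the ray, or for `u = T`.
  rw [hy0, zero_add, zero_eq_mul, mul_eq_zero] at hy
  rcases hy with hy | hy | hy
  · exact absurd hy hε.ne'
  · have hu0 : u = 0 := Subtype.ext hy
    rw [hx, hu0, h.1] at hray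
    simp at hray
  · exact Subtype.ext (by linarith)

/-- The condition of `ContinuesAround` for a given length. -/
def ContinuesAroundAt (f : ℂ → ℂ) (θ L : ℝ) (K : Set ℂ) : Prop :=
  ∃ α ∈ Set.Ioo 0 (Real.pi / 2), ∀ γ, IsForward 0 θ α L γ →
    (∀ s, γ s ∉ K) → ContinuableAlong f γ

/-- For each time `T`, bend the path so that it still passes through `γ T` at time `T` but meets `K₁
∪ K₂` at no other time. The bent path avoids one of the two sets, so the germ continues along it.
These continuations are coherent in `T`, and on the diagonal of the square the family of paths is
`γ` itself. -/
theorem ContinuesAroundAt.inter {f : ℂ → ℂ} {θ L : ℝ} {K₁ K₂ : Set ℂ}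
    (h₁ : ContinuesAroundAt f θ L K₁) (h₂ : ContinuesAroundAt f θ L K₂)
    (hf₁ : (K₁ ∩ Metric.ball 0 L).Finite) (hf₂ : (K₂ ∩ Metric.ball 0 L).Finite)
    (hr₁ : K₁ ⊆ ray 0 θ) (hr₂ : K₂ ⊆ ray 0 θ) : ContinuesAroundAt f θ L (K₁ ∩ K₂) := by
  obtain ⟨α₁, hα₁, h₁⟩ := h₁
  obtain ⟨α₂, hα₂, h₂⟩ := h₂
  have hα : min α₁ α₂ ∈ Set.Ioo 0 (Real.pi / 2) :=
    ⟨lt_min hα₁.1 hα₂.1, (min_le_left _ _).trans_lt hα₁.2⟩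
  refine ⟨min α₁ α₂, hα, fun γ hγ hav => ?_⟩
  obtain ⟨ε, hε, hp⟩ := hγ.exists_perturb hα (S := K₁ ∪ K₂)
    (by rw [Set.union_inter_distrib_right]; exact hf₁.union hf₂) (Set.union_subset hr₁ hr₂)
  set H : I × I → ℂ := fun p => perturb θ γ ε p.1 p.2 with hH
  have hHc : Continuous H := by
    have : H = fun p : I × I => γ p.2 +
      ((ε * (p.2 * (p.1 - p.2)) : ℝ) : ℂ) * (Complex.I * dir θ) := rfl
    rw [this]
    fun_prop
  have hH0 : ∀ T : I, H (T, 0) = 0 := fun T => by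
    change γ 0 + _ = _
    simp [hγ.1]
  have hdiag : ∀ T : I, H (T, T) = γ T := fun T => by
    change γ T + _ = _
    simp
  obtain ⟨F, hF, hF0⟩ := exists_germField_prod (f := f) hHc hH0 fun T => by
    change ContinuableAlong f (perturb θ γ ε T)
    obtain ⟨hfw, hmeet⟩ := hp T
    -- The only possible meeting point is `γ T`, which is missing from at least one of `K₁`, `K₂`.
    by_cases hT : γ T ∈ K₁
    · refine h₂ _ (hfw.mono (min_le_right _ _) le_rfl) fun s hs => ?_
      have h3 := hmeet s (Or.inr hs)
      rw [h3] at hs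
      exact hav T ⟨hT, by rw [← hdiag]; exact hs⟩
    · refine h₁ _ (hfw.mono (min_le_left _ _) le_rfl) fun s hs => ?_
      have h3 := hmeet s (Or.inl hs)
      rw [h3] at hs
      exact hT (by rw [← hdiag]; exact hs)
  rw [continuableAlong_iff]
  have h4 := hF.comp (k := fun T : I => (T, T)) (by fun_prop)
  have h5 : H ∘ (fun T : I => (T, T)) = γ := funext hdiag
  rw [h5] at h4
  exact ⟨_, h4, by simpa [hγ.1] using hF0 0⟩

theorem isClosed_of_locallyFinite {K : Set ℂ} (h : ∀ L : ℝ, (K ∩ Metric.ball 0 L).Finite) :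
    IsClosed K := by
  rw [← isOpen_compl_iff, isOpen_iff_mem_nhds]
  intro x hx
  have hb : Metric.ball (0 : ℂ) (‖x‖ + 1) ∈ 𝓝 x := Metric.isOpen_ball.mem_nhds (by simp)
  filter_upwards [hb, (h (‖x‖ + 1)).isClosed.isOpen_compl.mem_nhds fun hc => hx hc.1] with y h1 h2 h3
  exact h2 ⟨h3, h1⟩

theorem isDiscrete_of_locallyFinite {K : Set ℂ} (h : ∀ L : ℝ, (K ∩ Metric.ball 0 L).Finite) :
    IsDiscrete K := by
  rw [isDiscrete_iff_nhdsWithin]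
  intro x hx
  have hb : Metric.ball (0 : ℂ) (‖x‖ + 1) ∈ 𝓝 x := Metric.isOpen_ball.mem_nhds (by simp)
  rw [← nhdsWithin_inter_of_mem' (mem_nhdsWithin_of_mem_nhds hb)]
  exact isDiscrete_iff_nhdsWithin.1 (h (‖x‖ + 1)).isDiscrete x ⟨hx, by simp⟩

theorem finite_inter_ball {K : Set ℂ} (hc : IsClosed K) (hd : IsDiscrete K) (L : ℝ) :
    (K ∩ Metric.ball 0 L).Finite := by
  rw [Set.inter_comm]
  exact Metric.finite_isBounded_inter_isClosed hd Metric.isBounded_ball hc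

/-- If a germ continues around a locally finite set of points of a ray, then its set of glimpsed
singular points is well defined and contained in that set. -/
theorem isGlimpsedSingularSet_of_continuesAround {f : ℂ → ℂ} {θ : ℝ} {K₀ : Set ℂ}
    (hr : K₀ ⊆ ray 0 θ) (hK : ∀ L : ℝ, (K₀ ∩ Metric.ball 0 L).Finite)
    (hf : ContinuesAround f 0 θ K₀) :
    IsGlimpsedSingularSet f 0 θ (glimpsedSingular f 0 θ) ∧ glimpsedSingular f 0 θ ⊆ K₀ := by
  set A : Set (Set ℂ) := {K | IsClosed K ∧ IsDiscrete K ∧ K ⊆ ray 0 θ ∧ ContinuesAround f 0 θ K}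
    with hA
  have hinter : ∀ K₁ ∈ A, ∀ K₂ ∈ A, K₁ ∩ K₂ ∈ A := by
    rintro K₁ ⟨c1, d1, r1, h1⟩ K₂ ⟨c2, d2, r2, h2⟩
    exact ⟨c1.inter c2, d1.mono Set.inter_subset_left, Set.inter_subset_left.trans r1,
      fun L hL => ContinuesAroundAt.inter (h1 L hL) (h2 L hL) (finite_inter_ball c1 d1 L)
        (finite_inter_ball c2 d2 L) r1 r2⟩
  have hK₀ : K₀ ∈ A :=
    ⟨isClosed_of_locallyFinite hK, isDiscrete_of_locallyFinite hK, hr, hf⟩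
  -- Stability under finite intersections: a finite set disjoint from the total intersection is
  -- already disjoint from a single member of `A`.
  have hsep : ∀ T : Set ℂ, T.Finite → T ∩ ⋂₀ A = ∅ → ∃ K ∈ A, K ∩ T = ∅ := by
    intro T hT
    induction T, hT using Set.Finite.induction_on with
    | empty => exact fun _ => ⟨K₀, hK₀, Set.inter_empty _⟩
    | @insert a s _ _ ih =>
      intro h
      have h1 : s ∩ ⋂₀ A = ∅ := Set.eq_empty_of_forall_notMem fun z hz =>
        (Set.eq_empty_iff_forall_notMem.1 h z) ⟨Set.mem_insert_of_mem _ hz.1, hz.2⟩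
      obtain ⟨K, hK, hKs⟩ := ih h1
      have h2 : a ∉ ⋂₀ A := fun ha =>
        (Set.eq_empty_iff_forall_notMem.1 h a) ⟨Set.mem_insert _ _, ha⟩
      simp only [Set.mem_sInter, not_forall] at h2
      obtain ⟨K', hK', haK'⟩ := h2
      refine ⟨K ∩ K', hinter _ hK _ hK', Set.eq_empty_of_forall_notMem ?_⟩
      rintro z ⟨⟨hz1, hz2⟩, rfl | hz3⟩
      · exact haK' hz2
      · exact (Set.eq_empty_iff_forall_notMem.1 hKs z) ⟨hz1, hz3⟩
  have hmin : ⋂₀ A ∈ A := by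
    refine ⟨isClosed_sInter fun K hK => hK.1, hK₀.2.1.mono (Set.sInter_subset_of_mem hK₀),
      (Set.sInter_subset_of_mem hK₀).trans hr, fun L hL => ?_⟩
    -- A path of length `< L` stays in the disc of radius `L`, so only finitely many superfluous
    -- points of `K₀` have to be removed; the admissible angle is that of `K ∩ K₀`.
    obtain ⟨K, hKA, hKT⟩ := hsep ((K₀ ∩ Metric.ball 0 L) \ ⋂₀ A) ((hK L).sdiff)
      (Set.sdiff_inter_self)
    obtain ⟨α, hα, h⟩ := (hinter _ hKA _ hK₀).2.2.2 L hL
    refine ⟨α, hα, fun γ hγ hav => h γ hγ fun s hs => ?_⟩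
    refine (Set.eq_empty_iff_forall_notMem.1 hKT (γ s)) ⟨hs.1, ⟨hs.2, ?_⟩, hav s⟩
    simpa using hγ.norm_lt s
  have heq : ∀ K, IsGlimpsedSingularSet f 0 θ K ↔ K = ⋂₀ A := by
    intro K
    constructor
    · rintro ⟨h1, h2, h3, h4, h5⟩
      have hsub : ⋂₀ A ⊆ K := Set.sInter_subset_of_mem ⟨h1, h2, h3, h4⟩
      by_contra hne
      exact h5 _ (hsub.ssubset_of_ne (Ne.symm hne)) hmin.2.2.2
    · rintro rfl
      refine ⟨hmin.1, hmin.2.1, hmin.2.2.1, hmin.2.2.2, fun K' hK' hc => ?_⟩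
      exact hK'.not_subset (Set.sInter_subset_of_mem
        ⟨isClosed_of_locallyFinite fun L => (hK L).subset (Set.inter_subset_inter_left _
          (hK'.subset.trans (Set.sInter_subset_of_mem hK₀))),
          hmin.2.1.mono hK'.subset, hK'.subset.trans hmin.2.2.1, hc⟩)
  have hgl : glimpsedSingular f 0 θ = ⋂₀ A := by
    rw [glimpsedSingular]
    have : {K | IsGlimpsedSingularSet f 0 θ K} = {⋂₀ A} := by
      ext K; exact heq K
    rw [this, Set.sUnion_singleton]
  rw [hgl]
  exact ⟨(heq _).2 rfl, Set.sInter_subset_of_mem hK₀⟩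


/-! ### The convolution of two families of germs -/

/-- The integral of `g` along the segment from `a` to `b`. -/
noncomputable def segInt (g : ℂ → ℂ) (a b : ℂ) : ℂ :=
  ∫ u in (0 : ℝ)..1, g (a + u * (b - a)) * (b - a)

theorem segInt_self (g : ℂ → ℂ) (a : ℂ) : segInt g a a = 0 := by simp [segInt]

theorem add_mul_mem {U : Set ℂ} (hU : Convex ℝ U) {a b : ℂ} (ha : a ∈ U) (hb : b ∈ U) {u : ℝ}
    (hu : u ∈ I) : a + u * (b - a) ∈ U := by
  have := hU.add_smul_sub_mem ha hb hu
  rwa [Complex.real_smul] at this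

theorem segInt_eq {g P : ℂ → ℂ} {U : Set ℂ} (hU : Convex ℝ U) (hP : ∀ z ∈ U, HasDerivAt P (g z) z)
    (hg : ContinuousOn g U) {a b : ℂ} (ha : a ∈ U) (hb : b ∈ U) : segInt g a b = P b - P a := by
  have hl : ∀ u : ℝ, HasDerivAt (fun u : ℝ => a + u * (b - a)) (b - a) u := fun u => by
    simpa using ((Complex.ofRealCLM.hasDerivAt (x := u)).mul_const (b - a)).const_add a
  have hm : ∀ u ∈ Set.uIcc (0 : ℝ) 1, a + u * (b - a) ∈ U := fun u hu => by
    rw [Set.uIcc_of_le zero_le_one] at hu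
    exact add_mul_mem hU ha hb hu
  rw [segInt, intervalIntegral.integral_eq_sub_of_hasDerivAt
    (f := fun u : ℝ => P (a + u * (b - a)))]
  · simp
  · exact fun u hu => (hP _ (hm u hu)).comp u (hl u)
  · refine ContinuousOn.intervalIntegrable ((hg.comp (Continuous.continuousOn ?_) hm).mul
      continuousOn_const)
    fun_prop

theorem segInt_congr {g g' : ℂ → ℂ} {U : Set ℂ} (hU : Convex ℝ U) {a b : ℂ} (ha : a ∈ U)
    (hb : b ∈ U) (h : Set.EqOn g g' U) : segInt g a b = segInt g' a b := by
  refine intervalIntegral.integral_congr fun u hu => ?_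
  rw [Set.uIcc_of_le zero_le_one] at hu
  simp only [h (add_mul_mem hU ha hb hu)]

/-- Differentiation under the integral sign, with a bound for the derivative from compactness of a
closed disc times `[0,1]`, gives complex differentiability on an open disc, hence analyticity. -/
theorem analyticAt_integral {f f' : ℝ → ℂ → ℂ} {ζ₀ : ℂ} {r : ℝ} (hr : 0 < r)
    (hd : ∀ u ∈ Set.Icc (0 : ℝ) 1, ∀ ζ ∈ Metric.ball ζ₀ r, HasDerivAt (f u) (f' u ζ) ζ)
    (hf : ContinuousOn (fun p : ℝ × ℂ => f p.1 p.2) (Set.Icc 0 1 ×ˢ Metric.ball ζ₀ r))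
    (hf' : ContinuousOn (fun p : ℝ × ℂ => f' p.1 p.2) (Set.Icc 0 1 ×ˢ Metric.ball ζ₀ r)) :
    AnalyticAt ℂ (fun ζ => ∫ u in (0 : ℝ)..1, f u ζ) ζ₀ := by
  have hdiff : DifferentiableOn ℂ (fun ζ => ∫ u in (0 : ℝ)..1, f u ζ) (Metric.ball ζ₀ r) := by
    intro ζ hζ
    obtain ⟨ε, hε, hsub⟩ := Metric.nhds_basis_closedBall.mem_iff.1
      (Metric.isOpen_ball.mem_nhds hζ)
    obtain ⟨C, hC⟩ := ((isCompact_Icc (a := (0 : ℝ)) (b := 1)).prod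
      (isCompact_closedBall ζ ε)).exists_bound_of_continuousOn
        (hf'.mono (Set.prod_mono le_rfl hsub))
    have hslice : ∀ z ∈ Metric.ball ζ₀ r, ∀ k : ℝ → ℂ → ℂ,
        ContinuousOn (fun p : ℝ × ℂ => k p.1 p.2) (Set.Icc 0 1 ×ˢ Metric.ball ζ₀ r) →
        IntervalIntegrable (fun u => k u z) MeasureTheory.volume 0 1 := by
      intro z hz k hk
      refine ContinuousOn.intervalIntegrable ?_
      rw [Set.uIcc_of_le zero_le_one]
      exact hk.comp (f := fun u : ℝ => (u, z)) (by fun_prop) fun u hu => ⟨hu, hz⟩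
    have hun : Set.uIoc (0 : ℝ) 1 ⊆ Set.Icc 0 1 := by
      rw [Set.uIoc_of_le zero_le_one]; exact Set.Ioc_subset_Icc_self
    have := intervalIntegral.hasDerivAt_integral_of_dominated_loc_of_deriv_le
      (μ := MeasureTheory.volume) (F := fun z u => f u z) (F' := fun z u => f' u z) (x₀ := ζ)
      (s := Metric.closedBall ζ ε) (a := 0) (b := 1) (bound := fun _ => C)
      (Metric.closedBall_mem_nhds ζ hε)
      (by
        filter_upwards [Metric.isOpen_ball.mem_nhds hζ] with z hz
        exact (hslice z hz f hf).def'.aestronglyMeasurable)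
      (hslice ζ hζ f hf) (hslice ζ hζ f' hf').def'.aestronglyMeasurable
      (Filter.Eventually.of_forall fun u hu z hz => hC (u, z) ⟨hun hu, hz⟩)
      intervalIntegrable_const
      (Filter.Eventually.of_forall fun u hu z hz => hd u (hun hu) z (hsub hz))
    exact this.2.differentiableAt.differentiableWithinAt
  exact hdiff.analyticAt (Metric.ball_mem_nhds ζ₀ hr)

/-- A convolution integral over a segment one end of which may follow the variable is
holomorphic. -/
theorem analyticAt_segInt_conv {F G : ℂ → ℂ} {a b z₀ : ℂ} {ρ : ℝ} (hρ : 0 < ρ) (e : ℝ) (he : e ∈ I)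
    (hF : AnalyticOnNhd ℂ F (Metric.ball a ρ)) (hG : AnalyticOnNhd ℂ G (Metric.ball (z₀ - a) ρ))
    (hab : ‖b - a‖ < ρ / 4) :
    AnalyticAt ℂ (fun ζ => segInt (fun η => F η * G (ζ - η)) a (b + e * (ζ - z₀))) z₀ := by
  -- For `ζ` within `ρ / 4` of `z₀`, the point `η` of the segment stays within `ρ / 2` of `a`, and
  -- `ζ - η` within `3 ρ / 4` of `z₀ - a`.
  have hmem : ∀ u ∈ Set.Icc (0 : ℝ) 1, ∀ ζ ∈ Metric.ball z₀ (ρ / 4),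
      a + u * (b + e * (ζ - z₀) - a) ∈ Metric.ball a ρ ∧
      ζ - (a + u * (b + e * (ζ - z₀) - a)) ∈ Metric.ball (z₀ - a) ρ := by
    intro u hu ζ hζ
    rw [mem_ball_iff_norm] at hζ
    have h1 : ‖(e : ℂ) * (ζ - z₀)‖ ≤ ρ / 4 := by
      rw [norm_mul, Complex.norm_real, Real.norm_eq_abs, abs_of_nonneg he.1]
      nlinarith [norm_nonneg (ζ - z₀), he.2]
    have h2 : ‖(u : ℂ) * (b + e * (ζ - z₀) - a)‖ ≤ ρ / 2 := by
      have h3 : ‖b + e * (ζ - z₀) - a‖ ≤ ρ / 2 := by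
        have : b + e * (ζ - z₀) - a = (b - a) + e * (ζ - z₀) := by ring
        rw [this]
        exact (norm_add_le _ _).trans (by linarith)
      rw [norm_mul, Complex.norm_real, Real.norm_eq_abs, abs_of_nonneg hu.1]
      nlinarith [norm_nonneg (b + e * (ζ - z₀) - a), hu.2]
    rw [mem_ball_iff_norm, mem_ball_iff_norm]
    refine ⟨by rw [add_sub_cancel_left]; linarith, ?_⟩
    have : ζ - (a + u * (b + e * (ζ - z₀) - a)) - (z₀ - a) =
        (ζ - z₀) - u * (b + e * (ζ - z₀) - a) := by ring
    rw [this]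
    exact (norm_sub_le _ _).trans_lt (by linarith)
  set η : ℝ → ℂ → ℂ := fun u ζ => a + u * (b + e * (ζ - z₀) - a) with hη
  have hηd : ∀ u ζ, HasDerivAt (η u) (u * e) ζ := fun u ζ => by
    have := (((((hasDerivAt_id ζ).sub_const z₀).const_mul (e : ℂ)).const_add b).sub_const
      a).const_mul (u : ℂ) |>.const_add a
    simpa [hη] using this
  have hηc : Continuous fun p : ℝ × ℂ => η p.1 p.2 := by simp only [hη]; fun_prop
  have hcomp : ∀ K : ℂ → ℂ, ContinuousOn K (Metric.ball a ρ) →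
      ContinuousOn (fun p : ℝ × ℂ => K (η p.1 p.2)) (Set.Icc 0 1 ×ˢ Metric.ball z₀ (ρ / 4)) :=
    fun K hK => hK.comp hηc.continuousOn fun p hp => (hmem p.1 hp.1 p.2 hp.2).1
  have hcomp' : ∀ K : ℂ → ℂ, ContinuousOn K (Metric.ball (z₀ - a) ρ) →
      ContinuousOn (fun p : ℝ × ℂ => K (p.2 - η p.1 p.2))
        (Set.Icc 0 1 ×ˢ Metric.ball z₀ (ρ / 4)) :=
    fun K hK => hK.comp (continuous_snd.sub hηc).continuousOn
      fun p hp => (hmem p.1 hp.1 p.2 hp.2).2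
  refine analyticAt_integral (r := ρ / 4) (by positivity)
    (f := fun u ζ => F (η u ζ) * G (ζ - η u ζ) * (b + e * (ζ - z₀) - a))
    (f' := fun u ζ => (deriv F (η u ζ) * (u * e) * G (ζ - η u ζ) +
      F (η u ζ) * (deriv G (ζ - η u ζ) * (1 - u * e))) * (b + e * (ζ - z₀) - a) +
      F (η u ζ) * G (ζ - η u ζ) * e) ?_ ?_ ?_
  · intro u hu ζ hζ
    obtain ⟨h1, h2⟩ := hmem u hu ζ hζ
    have h3 := (hF _ h1).differentiableAt.hasDerivAt.comp ζ (hηd u ζ)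
    have h4 := (hG _ h2).differentiableAt.hasDerivAt.comp ζ ((hasDerivAt_id ζ).sub (hηd u ζ))
    have h5 : HasDerivAt (fun ζ => b + e * (ζ - z₀) - a) e ζ := by
      simpa using ((((hasDerivAt_id ζ).sub_const z₀).const_mul (e : ℂ)).const_add b).sub_const a
    exact (h3.mul h4).mul h5
  · exact ((hcomp F hF.continuousOn).mul (hcomp' G hG.continuousOn)).mul (by fun_prop)
  · have c1 := hcomp F hF.continuousOn
    have c2 := hcomp' G hG.continuousOn
    have c3 := hcomp _ hF.deriv.continuousOn
    have c4 := hcomp' _ hG.deriv.continuousOn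
    have c5 : ContinuousOn (fun p : ℝ × ℂ => (p.1 : ℂ) * e) (Set.Icc 0 1 ×ˢ Metric.ball z₀ (ρ / 4)) := by
      fun_prop
    have c6 : ContinuousOn (fun p : ℝ × ℂ => b + e * (p.2 - z₀) - a)
      (Set.Icc 0 1 ×ˢ Metric.ball z₀ (ρ / 4)) := by fun_prop
    exact ((((c3.mul c5).mul c2).add (c1.mul (c4.mul (continuousOn_const.sub c5)))).mul c6).add
      ((c1.mul c2).mul continuousOn_const)


/-- The `k`-th point of the uniform subdivision of `[0,1]` into `N` pieces. -/
noncomputable def node (N k : ℕ) : I := Set.projIcc 0 1 zero_le_one ((k : ℝ) / N)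

theorem node_zero (N : ℕ) : node N 0 = 0 := by
  simp [node]

theorem node_self {N : ℕ} (hN : 0 < N) : node N N = 1 := by
  have : (N : ℝ) ≠ 0 := by positivity
  simp [node, div_self this]

theorem dist_node_succ_le {N : ℕ} (k : ℕ) : dist (node N k) (node N (k + 1)) ≤ 1 / N := by
  refine (LipschitzWith.projIcc (zero_le_one (α := ℝ))).dist_le_mul _ _ |>.trans ?_
  rw [NNReal.coe_one, one_mul, Real.dist_eq]
  push_cast
  rw [← sub_div, sub_add_cancel_left, abs_div, abs_neg, abs_one, Nat.abs_cast]

theorem hasDerivAt_primitive {g : ℂ → ℂ} {z : ℂ} {r : ℝ} (hg : AnalyticOnNhd ℂ g (Metric.ball z r)) :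
    ∃ P : ℂ → ℂ, ∀ w ∈ Metric.ball z r, HasDerivAt P (g w) w := by
  obtain ⟨P, hP⟩ := hg.differentiableOn.isExactOn_ball
  exact ⟨P, hP⟩

/-- If two germs continue along the paths `t ↦ H (s, t)` and `t ↦ γ t - H (s, t)`, coherently in
`s`, then their convolution product continues along `γ`. -/
theorem continuableAlong_conv_of_germField {φ ψ : ℂ → ℂ} {γ : C(I, ℂ)} {H : I × I → ℂ}
    (hH : Continuous H) (hH0 : ∀ s, H (s, 0) = 0) (hγ0 : γ 0 = 0) (h0 : ∀ t, H (0, t) = 0)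
    (h1 : ∀ t, H (1, t) = γ t) {Φ₀ Ψ₀ : I × I → ℂ → ℂ} (hΦ₀ : GermField H Φ₀)
    (hΨ₀ : GermField (fun p => γ p.2 - H p) Ψ₀) (hφ : ∀ s, Φ₀ (s, 0) =ᶠ[𝓝 0] φ)
    (hψ : ∀ s, Ψ₀ (s, 0) =ᶠ[𝓝 0] ψ) : ContinuableAlong (conv φ ψ) γ := by
  obtain ⟨ρ₁, hρ₁, δ₁, hδ₁, Φ, hΦeq, hΦan, hΦc⟩ := hΦ₀.exists_uniform hH
  obtain ⟨ρ₂, hρ₂, δ₂, hδ₂, Ψ, hΨeq, hΨan, hΨc⟩ := hΨ₀.exists_uniform (by fun_prop)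
  obtain ⟨ρ, hρ, hρle₁, hρle₂⟩ : ∃ ρ > 0, ρ ≤ ρ₁ ∧ ρ ≤ ρ₂ :=
    ⟨min ρ₁ ρ₂, lt_min hρ₁ hρ₂, min_le_left _ _, min_le_right _ _⟩
  obtain ⟨δ, hδ, hδle₁, hδle₂⟩ : ∃ δ > 0, δ ≤ δ₁ ∧ δ ≤ δ₂ :=
    ⟨min δ₁ δ₂, lt_min hδ₁ hδ₂, min_le_left _ _, min_le_right _ _⟩
  obtain ⟨δ₃, hδ₃, huc⟩ := Metric.uniformContinuous_iff.1
    (CompactSpace.uniformContinuous_of_continuous hH) (ρ / 8) (by positivity)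
  obtain ⟨N, hNpos, hN⟩ : ∃ N : ℕ, 0 < N ∧ 1 / (N : ℝ) < min δ δ₃ := by
    obtain ⟨n, hn⟩ := exists_nat_one_div_lt (lt_min hδ hδ₃)
    exact ⟨n + 1, Nat.succ_pos n, by push_cast; exact hn⟩
  have hdist : ∀ k t, dist ((node N k, t) : I × I) (node N (k + 1), t) < min δ δ₃ := by
    intro k t
    rw [Prod.dist_eq, dist_self, max_eq_left dist_nonneg]
    exact (dist_node_succ_le k).trans_lt hN
  set z : ℕ → I → ℂ := fun k t => H (node N k, t) with hz
  have hz0 : ∀ t, z 0 t = 0 := fun t => by simp only [hz, node_zero, h0]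
  have hzN : ∀ t, z N t = γ t := fun t => by simp only [hz, node_self hNpos, h1]
  have hstep : ∀ k t, ‖z (k + 1) t - z k t‖ < ρ / 8 := fun k t => by
    rw [← dist_eq_norm, dist_comm]
    exact huc ((hdist k t).trans_le (min_le_right _ _))
  -- Only the last vertex of the integration polygon follows the variable `ζ`; the others stay at
  -- the nodes `z k t`.
  set e : ℕ → ℝ := fun k => if k = N then 1 else 0 with he
  set v : ℕ → I → ℂ → ℂ := fun k t ζ => z k t + e k * (ζ - γ t) with hv
  have heI : ∀ k, e k ∈ I := fun k => by
    simp only [he]; split_ifs <;> simp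
  have hvlt : ∀ k t ζ, k < N → v k t ζ = z k t := fun k t ζ hk => by
    simp [hv, he, hk.ne]
  have hvN : ∀ t ζ, v N t ζ = ζ := fun t ζ => by simp [hv, he, hzN]
  set g : ℕ → I → ℂ → ℂ → ℂ := fun k t ζ η => Φ (node N k, t) η * Ψ (node N k, t) (ζ - η) with hg
  -- The germ at `γ t`: the convolution integral over the polygon through the nodes and ending at
  -- `ζ`, each edge using the representatives attached to its initial node.
  set E : I → ℂ → ℂ := fun t ζ => ∑ k ∈ Finset.range N, segInt (g k t ζ) (z k t) (v (k + 1) t ζ)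
    with hE
  have hb1 : ∀ k t, Metric.ball (z k t) ρ ⊆ Metric.ball (H (node N k, t)) ρ₁ := fun k t =>
    Metric.ball_subset_ball hρle₁
  have hb2 : ∀ k t, Metric.ball (γ t - z k t) ρ ⊆ Metric.ball (γ t - H (node N k, t)) ρ₂ :=
    fun k t => Metric.ball_subset_ball hρle₂
  refine ⟨E, fun t => ?_, ?_, fun t => ?_⟩
  · refine Finset.analyticAt_fun_sum _ fun k hk => ?_
    exact analyticAt_segInt_conv hρ (e (k + 1)) (heI _)
      (fun w hw => hΦan _ w (hb1 k t hw)) (fun w hw => hΨan _ w (hb2 k t hw))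
      ((hstep k t).trans (by linarith))
  -- At time `0` all nodes are at `0`, so only the last edge, from `0` to `ζ`, contributes.
  · obtain ⟨M, rfl⟩ : ∃ M, N = M + 1 := ⟨N - 1, by omega⟩
    have hz0' : ∀ k, z k 0 = 0 := fun k => hH0 _
    have hE0 : ∀ ζ, E 0 ζ = segInt (g M 0 ζ) 0 ζ := by
      intro ζ
      simp only [hE]
      rw [Finset.sum_range_succ, Finset.sum_eq_zero, zero_add, hvN, hz0']
      intro k hk
      rw [hvlt (k + 1) 0 ζ (by simpa using hk), hz0', hz0', segInt_self]
    have h2 : Φ (node (M + 1) M, 0) =ᶠ[𝓝 0] φ := by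
      have := hΦeq (node (M + 1) M, 0)
      rw [hH0] at this
      exact this.trans (hφ _)
    have h3 : Ψ (node (M + 1) M, 0) =ᶠ[𝓝 0] ψ := by
      have := hΨeq (node (M + 1) M, 0)
      simp only [hH0, hγ0, sub_zero] at this
      exact this.trans (hψ _)
    obtain ⟨r, hr, h4⟩ := Metric.eventually_nhds_iff_ball.1 (h2.and h3)
    rw [hγ0]
    filter_upwards [Metric.ball_mem_nhds (0 : ℂ) hr] with ζ hζ
    rw [hE0, conv, segInt]
    refine intervalIntegral.integral_congr fun u hu => ?_
    rw [Set.uIcc_of_le zero_le_one] at hu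
    rw [mem_ball_zero_iff] at hζ
    have h5 : (u : ℂ) * ζ ∈ Metric.ball (0 : ℂ) r := by
      rw [mem_ball_zero_iff, norm_mul, Complex.norm_real, Real.norm_eq_abs, abs_of_nonneg hu.1]
      nlinarith [norm_nonneg ζ, hu.2]
    have h6 : ζ - (u : ℂ) * ζ ∈ Metric.ball (0 : ℂ) r := by
      have : ζ - (u : ℂ) * ζ = ((1 - u : ℝ) : ℂ) * ζ := by push_cast; ring
      rw [this, mem_ball_zero_iff, norm_mul, Complex.norm_real, Real.norm_eq_abs,
        abs_of_nonneg (by linarith [hu.2])]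
      nlinarith [norm_nonneg ζ, hu.1]
    simp only [sub_zero, zero_add, hg]
    rw [(h4 _ h5).1, (h4 _ h6).2]
  · have hnear : ∀ᶠ t' in 𝓝 t, ∀ s ∈ (Set.univ : Set I), dist (H (s, t')) (H (s, t)) < ρ / 8 := by
      refine isCompact_univ.eventually_forall_of_forall_eventually fun s _ => ?_
      have : Continuous fun p : I × I => dist (H (p.2, p.1)) (H (p.2, t)) := by fun_prop
      exact this.continuousAt.eventually (gt_mem_nhds (by simpa using by positivity))
    filter_upwards [hnear, Metric.ball_mem_nhds t hδ] with t' hnear ht'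
    have hn : ∀ k, ‖z k t' - z k t‖ < ρ / 8 := fun k => by
      rw [← dist_eq_norm]; exact hnear _ trivial
    have hγn : ‖γ t' - γ t‖ < ρ / 8 := by rw [← hzN, ← hzN]; exact hn N
    filter_upwards [Metric.ball_mem_nhds (γ t') (by positivity : (0 : ℝ) < ρ / 8)] with ζ hζ
    rw [mem_ball_iff_norm] at hζ
    have hζ' : ‖ζ - γ t‖ < ρ / 4 := by
      have := norm_add_le (ζ - γ t') (γ t' - γ t)
      rw [sub_add_sub_cancel] at this
      linarith
    -- `D k` contains the `k`-th edges of both polygons, for `t` and for `t'`, and the integrand is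
    -- holomorphic on it; edge integrals become differences of a primitive `P k`.
    set D : ℕ → Set ℂ := fun k => Metric.ball (z k t) (ρ / 2) with hD
    have hDc : ∀ k, Convex ℝ (D k) := fun k => convex_ball _ _
    have hDmem : ∀ k, ∀ η ∈ D k, η ∈ Metric.ball (z k t) ρ ∧
        ζ - η ∈ Metric.ball (γ t - z k t) ρ := by
      intro k η hη
      rw [hD, mem_ball_iff_norm] at hη
      rw [mem_ball_iff_norm, mem_ball_iff_norm]
      have h2 : ζ - η - (γ t - z k t) = (ζ - γ t) - (η - z k t) := by ring
      exact ⟨by linarith, by rw [h2]; exact (norm_sub_le _ _).trans_lt (by linarith)⟩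
    have hDmem' : ∀ k, ∀ η ∈ D k, η ∈ Metric.ball (z k t') ρ ∧
        ζ - η ∈ Metric.ball (γ t' - z k t') ρ := by
      intro k η hη
      rw [hD, mem_ball_iff_norm] at hη
      rw [mem_ball_iff_norm, mem_ball_iff_norm]
      have h2 : ζ - η - (γ t' - z k t') = (ζ - γ t') - (η - z k t) + (z k t' - z k t) := by ring
      have h3 : η - z k t' = (η - z k t) - (z k t' - z k t) := by ring
      refine ⟨by rw [h3]; exact (norm_sub_le _ _).trans_lt (by linarith [hn k]), ?_⟩
      rw [h2]
      have := norm_sub_le (ζ - γ t') (η - z k t)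
      exact (norm_add_le _ _).trans_lt (by linarith [hn k])
    have hgan : ∀ k, AnalyticOnNhd ℂ (g k t ζ) (D k) := by
      intro k η hη
      obtain ⟨h2, h3⟩ := hDmem k η hη
      refine (hΦan _ η (hb1 k t h2)).mul ?_
      exact (hΨan _ _ (hb2 k t h3)).fun_comp (analyticAt_const.sub analyticAt_id)
    have hgt : ∀ k, Set.EqOn (g k t' ζ) (g k t ζ) (D k) := by
      intro k η hη
      have hd : dist ((node N k, t') : I × I) (node N k, t) < δ := by
        rw [Prod.dist_eq, dist_self, max_eq_right dist_nonneg]; exact ht'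
      obtain ⟨h2, h3⟩ := hDmem k η hη
      obtain ⟨h4, h5⟩ := hDmem' k η hη
      simp only [hg]
      rw [hΦc _ _ (hd.trans_le hδle₁) ⟨hb1 k t' h4, hb1 k t h2⟩,
        hΨc _ _ (hd.trans_le hδle₂) ⟨hb2 k t' h5, hb2 k t h3⟩]
    have hgk : ∀ k, Set.EqOn (g k t ζ) (g (k + 1) t ζ) (D k ∩ D (k + 1)) := by
      intro k η hη
      have hd := (hdist k t).trans_le (min_le_left _ _)
      obtain ⟨h2, h3⟩ := hDmem k η hη.1
      obtain ⟨h4, h5⟩ := hDmem (k + 1) η hη.2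
      simp only [hg]
      rw [hΦc _ _ (hd.trans_le hδle₁) ⟨hb1 k t h2, hb1 (k + 1) t h4⟩,
        hΨc _ _ (hd.trans_le hδle₂) ⟨hb2 k t h3, hb2 (k + 1) t h5⟩]
    choose P hP using fun k => hasDerivAt_primitive (hgan k)
    have hz1 : ∀ k, z k t ∈ D k := fun k => Metric.mem_ball_self (by positivity)
    have hz2 : ∀ k, z k t' ∈ D k := fun k => by
      rw [hD, mem_ball_iff_norm]; linarith [hn k]
    have hz3 : ∀ k, z (k + 1) t ∈ D k := fun k => by
      rw [hD, mem_ball_iff_norm]; linarith [hstep k t]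
    have hz4 : ∀ k, z (k + 1) t' ∈ D k := fun k => by
      rw [hD, mem_ball_iff_norm]
      have h2 : z (k + 1) t' - z k t = (z (k + 1) t' - z (k + 1) t) + (z (k + 1) t - z k t) := by
        ring
      rw [h2]
      exact (norm_add_le _ _).trans_lt (by linarith [hstep k t, hn (k + 1)])
    have hζD : ∀ k, k + 1 = N → ζ ∈ D k := fun k hk => by
      rw [hD, mem_ball_iff_norm]
      have h2 : ζ - z k t = (ζ - γ t) + (z (k + 1) t - z k t) := by rw [hk, hzN]; ring
      rw [h2]
      exact (norm_add_le _ _).trans_lt (by linarith [hstep k t])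
    -- `Δ k` is the integral from the node `z k t` to the displaced node `z k t'`. It is `0` for `k
    -- = N`, since both polygons end at the same `ζ`, and for `k = 0`, since both start at `0`. The
    -- difference of the two integrals telescopes in `Δ`.
    set Δ : ℕ → ℂ := fun k => if k < N then P k (z k t') - P k (z k t) else 0 with hΔ
    have hterm : ∀ k ∈ Finset.range N, segInt (g k t' ζ) (z k t') (v (k + 1) t' ζ) -
        segInt (g k t ζ) (z k t) (v (k + 1) t ζ) = Δ (k + 1) - Δ k := by
      intro k hk
      rw [Finset.mem_range] at hk
      have hΔk : Δ k = P k (z k t') - P k (z k t) := by simp [hΔ, hk]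
      rcases lt_or_eq_of_le (Nat.succ_le_of_lt hk) with hlt | heq
      · have hΔk' : Δ (k + 1) = P (k + 1) (z (k + 1) t') - P (k + 1) (z (k + 1) t) := by
          simp only [hΔ]; rw [if_pos hlt]
        rw [hvlt _ _ _ hlt, hvlt _ _ _ hlt, segInt_congr (hDc k) (hz2 k) (hz4 k) (hgt k),
          segInt_eq (hDc k) (hP k) (hgan k).continuousOn (hz2 k) (hz4 k),
          segInt_eq (hDc k) (hP k) (hgan k).continuousOn (hz1 k) (hz3 k), hΔk, hΔk']
        -- On the overlap of consecutive discs the integrands agree, so either primitive computes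
        -- the integral from a node to its displacement.
        have h5 := segInt_congr ((hDc k).inter (hDc (k + 1))) ⟨hz3 k, hz1 (k + 1)⟩
          ⟨hz4 k, hz2 (k + 1)⟩ (hgk k)
        rw [segInt_eq (hDc k) (hP k) (hgan k).continuousOn (hz3 k) (hz4 k),
          segInt_eq (hDc (k + 1)) (hP (k + 1)) (hgan (k + 1)).continuousOn (hz1 (k + 1))
            (hz2 (k + 1))] at h5
        linear_combination h5
      · have hΔk' : Δ (k + 1) = 0 := by
          simp only [hΔ]; rw [if_neg (by omega)]
        have heq' : k + 1 = N := heq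
        rw [heq', hvN, hvN, ← heq', segInt_congr (hDc k) (hz2 k) (hζD k heq') (hgt k),
          segInt_eq (hDc k) (hP k) (hgan k).continuousOn (hz2 k) (hζD k heq'),
          segInt_eq (hDc k) (hP k) (hgan k).continuousOn (hz1 k) (hζD k heq'), hΔk, hΔk']
        ring
    have hsum : E t' ζ - E t ζ = Δ N - Δ 0 := by
      simp only [hE]
      rw [← Finset.sum_sub_distrib, Finset.sum_congr rfl hterm, Finset.sum_range_sub]
    have hΔ0 : Δ 0 = 0 := by simp [hΔ, hz0]
    have hΔN : Δ N = 0 := by simp [hΔ]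
    rw [hΔ0, hΔN, sub_zero, sub_eq_zero] at hsum
    exact hsum


/-! ### The discretized flow that deforms the path of integration -/

/-- The proportion of an increment of `z₀` that is given to the point `Z`: none when `Z` is in `A`,
everything when `z₀ - Z` is in `B`. -/
noncomputable def wt (A B : Set ℂ) (z₀ Z : ℂ) : ℝ :=
  Metric.infDist Z A / (Metric.infDist Z A + Metric.infDist (z₀ - Z) B)

section flow

variable (A B : Set ℂ) (r : ℝ) (τ : ℕ → ℝ) (f : ℝ → ℂ)

/-- The position at time `τ i` of the particle with label `s`. -/
noncomputable def flowPt : ℕ → ℝ → ℂ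
  | 0, _ => 0
  | i + 1, s => flowPt i s +
      ((if τ i < r then s else wt A B (f (τ i)) (flowPt i s) : ℝ) : ℂ) * (f (τ (i + 1)) - f (τ i))

/-- The weight of the particle with label `s` between the times `τ i` and `τ (i + 1)`. -/
noncomputable def flowWt (i : ℕ) (s : ℝ) : ℝ :=
  if τ i < r then s else wt A B (f (τ i)) (flowPt A B r τ f i s)

/-- The position at time `t` of the particle with label `s`. -/
noncomputable def flow (n : ℕ) (s t : ℝ) : ℂ :=
  ∑ i ∈ Finset.range n, (flowWt A B r τ f i s : ℂ) *
    (f (max (τ i) (min t (τ (i + 1)))) - f (τ i))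

variable {A B r τ f}

theorem flowPt_succ (i : ℕ) (s : ℝ) : flowPt A B r τ f (i + 1) s =
    flowPt A B r τ f i s + (flowWt A B r τ f i s : ℂ) * (f (τ (i + 1)) - f (τ i)) := rfl

/-- The clamped time makes every earlier piece contribute its whole increment and every later one
nothing. -/
theorem flow_eq (hτ : Monotone τ) {n i : ℕ} (hi : i < n) {s t : ℝ}
    (ht : t ∈ Set.Icc (τ i) (τ (i + 1))) : flow A B r τ f n s t =
      flowPt A B r τ f i s + (flowWt A B r τ f i s : ℂ) * (f t - f (τ i)) := by
  have h1 : ∀ j ≤ i, flow A B r τ f j s t = flowPt A B r τ f j s := by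
    intro j
    induction j with
    | zero => intro _; simp [flow, flowPt]
    | succ j ih =>
      intro hj
      have h2 : τ (j + 1) ≤ t := (hτ hj).trans ht.1
      have h3 := ih (by omega)
      rw [flow] at h3
      rw [flow, Finset.sum_range_succ, h3, flowPt_succ, min_eq_right h2,
        max_eq_right (hτ (Nat.le_succ j))]
  have h2 : ∀ j, i + 1 ≤ j → flow A B r τ f j s t =
      flowPt A B r τ f i s + (flowWt A B r τ f i s : ℂ) * (f t - f (τ i)) := by
    intro j hj
    induction j, hj using Nat.le_induction with
    | base =>
      have h3 := h1 i le_rfl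
      rw [flow] at h3
      rw [flow, Finset.sum_range_succ, h3, min_eq_left ht.2, max_eq_right ht.1]
    | succ j hj ih =>
      have h3 : t ≤ τ j := ht.2.trans (hτ hj)
      rw [flow] at ih
      rw [flow, Finset.sum_range_succ, ih, max_eq_left ((min_le_left _ _).trans h3), sub_self,
        mul_zero, add_zero]
  exact h2 n hi

theorem wt_swap {z₀ Z : ℂ} (h : 0 < Metric.infDist Z A + Metric.infDist (z₀ - Z) B) :
    wt B A z₀ (z₀ - Z) = 1 - wt A B z₀ Z := by
  rw [wt, wt, sub_sub_cancel, eq_sub_iff_add_eq, add_comm (Metric.infDist (z₀ - Z) B), ← add_div,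
    add_comm, div_self h.ne']

theorem wt_mem {z₀ Z : ℂ} : wt A B z₀ Z ∈ I := by
  have h1 := Metric.infDist_nonneg (x := Z) (s := A)
  have h2 := Metric.infDist_nonneg (x := z₀ - Z) (s := B)
  exact ⟨div_nonneg h1 (add_nonneg h1 h2), div_le_one_of_le₀ (by linarith) (add_nonneg h1 h2)⟩

theorem flowWt_mem {i : ℕ} {s : ℝ} (hs : s ∈ I) : flowWt A B r τ f i s ∈ I := by
  rw [flowWt]
  split_ifs
  · exact hs
  · exact wt_mem

variable {n : ℕ} {m : ℝ}

/-- Complementary weights add up to `1`, so `f - Z` is a particle of the flow with `A` and `B`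
exchanged and label `1 - s`. Everything proved about `A` thus transfers to `B`. -/
theorem flow_swap (hm : 0 < m) (h0 : f (τ 0) = 0) (hd : ∀ i, r ≤ τ i → i < n →
    ∀ Z, m ≤ Metric.infDist Z A + Metric.infDist (f (τ i) - Z) B) (s : ℝ) :
    ∀ i ≤ n, flowPt B A r τ f i (1 - s) = f (τ i) - flowPt A B r τ f i s ∧
      (i < n → flowWt B A r τ f i (1 - s) = 1 - flowWt A B r τ f i s) := by
  have hw : ∀ i, i < n → flowPt B A r τ f i (1 - s) = f (τ i) - flowPt A B r τ f i s →
      flowWt B A r τ f i (1 - s) = 1 - flowWt A B r τ f i s := by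
    intro i hi h
    rw [flowWt, flowWt]
    split_ifs with h1
    · rfl
    · rw [h, wt_swap (hm.trans_le (hd i (not_lt.1 h1) hi _))]
  intro i
  induction i with
  | zero =>
    intro _
    have h1 : flowPt B A r τ f 0 (1 - s) = f (τ 0) - flowPt A B r τ f 0 s := by
      simp [flowPt, h0]
    exact ⟨h1, fun hi => hw 0 hi h1⟩
  | succ i ih =>
    intro hi
    have h2 := ih (by omega)
    have h1 : flowPt B A r τ f (i + 1) (1 - s) = f (τ (i + 1)) - flowPt A B r τ f (i + 1) s := by
      rw [flowPt_succ, flowPt_succ, h2.1, h2.2 hi]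
      push_cast
      ring
    exact ⟨h1, fun hi => hw _ hi h1⟩

/-- As `0 ∈ A`, a particle at `0` has weight `0` in the second regime; in the first regime its
weight is its label `0`. -/
theorem flow_zero (hA : (0 : ℂ) ∈ A) (i : ℕ) :
    flowPt A B r τ f i 0 = 0 ∧ flowWt A B r τ f i 0 = 0 := by
  have hw : ∀ i, flowPt A B r τ f i 0 = 0 → flowWt A B r τ f i 0 = 0 := by
    intro i h
    rw [flowWt, h, wt, Metric.infDist_zero_of_mem hA, zero_div, ite_self]
  induction i with
  | zero => exact ⟨rfl, hw 0 rfl⟩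
  | succ i ih =>
    have : flowPt A B r τ f (i + 1) 0 = 0 := by rw [flowPt_succ, ih.1, ih.2]; simp
    exact ⟨this, hw _ this⟩

/-- The lower bound `m` on the denominators keeps the weights continuous in the label. -/
theorem continuous_flowPt (hm : 0 < m) (hd : ∀ i, r ≤ τ i → i < n →
    ∀ Z, m ≤ Metric.infDist Z A + Metric.infDist (f (τ i) - Z) B) :
    ∀ i ≤ n, Continuous (flowPt A B r τ f i) ∧ (i < n → Continuous (flowWt A B r τ f i)) := by
  have hw : ∀ i, i < n → Continuous (flowPt A B r τ f i) → Continuous (flowWt A B r τ f i) := by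
    intro i hi h
    by_cases h1 : τ i < r
    · have : flowWt A B r τ f i = fun s => s := by
        funext s; rw [flowWt, if_pos h1]
      rw [this]
      exact continuous_id
    · have : flowWt A B r τ f i = fun s => wt A B (f (τ i)) (flowPt A B r τ f i s) := by
        funext s; rw [flowWt, if_neg h1]
      rw [this]
      have h2 : Continuous fun s => Metric.infDist (flowPt A B r τ f i s) A :=
        (Metric.continuous_infDist_pt A).comp h
      have h3 : Continuous fun s => Metric.infDist (f (τ i) - flowPt A B r τ f i s) B :=
        (Metric.continuous_infDist_pt B).comp (continuous_const.sub h)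
      exact h2.div (h2.add h3) fun s => (hm.trans_le (hd i (not_lt.1 h1) hi _)).ne'
  intro i
  induction i with
  | zero =>
    intro _
    have : Continuous (flowPt A B r τ f 0) := by
      have : flowPt A B r τ f 0 = fun _ => 0 := rfl
      rw [this]; exact continuous_const
    exact ⟨this, fun hi => hw 0 hi this⟩
  | succ i ih =>
    intro hi
    obtain ⟨h1, h2⟩ := ih (by omega)
    have h3 : Continuous (flowPt A B r τ f (i + 1)) := by
      have : flowPt A B r τ f (i + 1) = fun s => flowPt A B r τ f i s +
        (flowWt A B r τ f i s : ℂ) * (f (τ (i + 1)) - f (τ i)) := rfl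
      rw [this]
      exact h1.add ((Complex.continuous_ofReal.comp (h2 hi)).mul continuous_const)
    exact ⟨h3, fun hi => hw _ hi h3⟩

theorem continuous_flow (hf : Continuous f) (hm : 0 < m) (hd : ∀ i, r ≤ τ i → i < n →
    ∀ Z, m ≤ Metric.infDist Z A + Metric.infDist (f (τ i) - Z) B) :
    Continuous fun p : ℝ × ℝ => flow A B r τ f n p.1 p.2 := by
  unfold flow
  refine continuous_finsetSum _ fun i hi => ?_
  have h1 := (continuous_flowPt hm hd i (Finset.mem_range.1 hi).le).2 (Finset.mem_range.1 hi)
  exact (Complex.continuous_ofReal.comp (h1.comp continuous_fst)).mul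
    ((hf.comp (by fun_prop)).sub continuous_const)

/-- The particles avoid the set `A`. -/
theorem flow_notMem (hτ : Monotone τ) (hτ0 : τ 0 = 0) (h0 : f (τ 0) = 0) (hr : 0 < r) (hm : 0 < m)
    (hA : IsClosed A) (hAne : A.Nonempty)
    (hd : ∀ i, r ≤ τ i → i < n → ∀ Z, m ≤ Metric.infDist Z A + Metric.infDist (f (τ i) - Z) B)
    (hmesh : ∀ i < n, τ (i + 1) - τ i ≤ r)
    (hosc : ∀ i < n, ∀ t ∈ Set.Icc (τ i) (τ (i + 1)), ‖f t - f (τ i)‖ < m)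
    {s : ℝ} (hsm : ∀ t ∈ Set.Ioc 0 (2 * r), (s : ℂ) * f t ∉ A) :
    ∀ i < n, (r ≤ τ i → flowPt A B r τ f i s ∉ A) ∧
      ∀ t ∈ Set.Icc (τ i) (τ (i + 1)), 0 < t →
        flowPt A B r τ f i s + (flowWt A B r τ f i s : ℂ) * (f t - f (τ i)) ∉ A := by
  -- In the initial regime the flow is linear, `Z = s f`. The weights of the second regime cannot be
  -- used from the start, because `f` begins at `0 ∈ A + B`.
  have hlin : ∀ i, (∀ k < i, τ k < r) → flowPt A B r τ f i s = s * f (τ i) := by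
    intro i
    induction i with
    | zero => intro _; simp [flowPt, h0]
    | succ i ih =>
      intro h
      rw [flowPt_succ, ih fun k hk => h k (by omega), flowWt, if_pos (h i (by omega))]
      ring
  have hstep : ∀ i < n, (r ≤ τ i → flowPt A B r τ f i s ∉ A) →
      ∀ t ∈ Set.Icc (τ i) (τ (i + 1)), 0 < t →
        flowPt A B r τ f i s + (flowWt A B r τ f i s : ℂ) * (f t - f (τ i)) ∉ A := by
    intro i hi hn t ht ht0
    by_cases h1 : τ i < r
    · rw [hlin i fun k hk => (hτ hk.le).trans_lt h1, flowWt, if_pos h1]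
      have h2 : (s : ℂ) * f (τ i) + s * (f t - f (τ i)) = s * f t := by ring
      rw [h2]
      -- A piece that starts before `r` ends before `2 r`.
      exact hsm t ⟨ht0, by linarith [hmesh i hi, ht.2]⟩
    · rw [not_lt] at h1
      set Z := flowPt A B r τ f i s with hZ
      have h2 : 0 < Metric.infDist Z A := (hA.notMem_iff_infDist_pos hAne).1 (hn h1)
      have h3 := hd i h1 hi Z
      -- The increment of `f` is shorter than `m`, which is at most the denominator of the weight;
      -- hence the particle moves by less than its distance to `A`.
      have h4 : flowWt A B r τ f i s * m ≤ Metric.infDist Z A := by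
        rw [flowWt, if_neg (not_lt.2 h1), wt, div_mul_eq_mul_div, div_le_iff₀ (hm.trans_le h3)]
        exact mul_le_mul_of_nonneg_left h3 h2.le
      have h5 : 0 ≤ flowWt A B r τ f i s := by
        rw [flowWt, if_neg (not_lt.2 h1)]; exact wt_mem.1
      intro hmem
      have h6 := Metric.infDist_le_dist_of_mem (x := Z) hmem
      rw [dist_self_add_right, norm_mul, Complex.norm_real, Real.norm_eq_abs, abs_of_nonneg h5] at h6
      have h7 := hosc i hi t ht
      rcases h5.eq_or_lt with h8 | h8
      · rw [← h8, zero_mul] at h6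
        linarith
      · nlinarith [mul_lt_mul_of_pos_left h7 h8]
  intro i
  induction i with
  | zero =>
    intro hi
    have h1 : r ≤ τ 0 → flowPt A B r τ f 0 s ∉ A := by
      intro h
      rw [hτ0] at h
      exact absurd h (not_le.2 hr)
    exact ⟨h1, hstep 0 hi h1⟩
  | succ i ih =>
    intro hi
    have h1 : r ≤ τ (i + 1) → flowPt A B r τ f (i + 1) s ∉ A := by
      intro h
      rw [flowPt_succ]
      exact (ih (by omega)).2 _ ⟨hτ (Nat.le_succ i), le_rfl⟩ (hr.trans_le h)
    exact ⟨h1, hstep _ hi h1⟩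

end flow


/-! ### Trajectories of the flow as forward paths -/

/-- If `a` and `b` are nearly closest to `Z` and `z₀ - Z`, then `a + b` is close to `z₀`. This
bounds the denominator of `wt` from below, uniformly in the particle. -/
theorem infDist_add_le {A B : Set ℂ} (hA : A.Nonempty) (hB : B.Nonempty) (z₀ Z : ℂ) :
    Metric.infDist z₀ (A + B) ≤ Metric.infDist Z A + Metric.infDist (z₀ - Z) B := by
  refine le_of_forall_pos_le_add fun ε hε => ?_
  obtain ⟨a, ha, hda⟩ := (Metric.infDist_lt_iff hA).1
    (lt_add_of_pos_right (Metric.infDist Z A) (half_pos hε))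
  obtain ⟨b, hb, hdb⟩ := (Metric.infDist_lt_iff hB).1
    (lt_add_of_pos_right (Metric.infDist (z₀ - Z) B) (half_pos hε))
  have h1 := Metric.infDist_le_dist_of_mem (x := z₀) (Set.add_mem_add ha hb)
  have h2 : dist z₀ (a + b) ≤ dist Z a + dist (z₀ - Z) b := by
    rw [dist_eq_norm, dist_eq_norm, dist_eq_norm]
    have : z₀ - (a + b) = (Z - a) + (z₀ - Z - b) := by ring
    rw [this]
    exact norm_add_le _ _
  linarith

theorem exists_mem_Icc {n : ℕ} {τ : ℕ → ℝ} (hτ : IsSubdivision n τ) {t : ℝ} (ht : t ∈ I) :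
    ∃ i < n, t ∈ Set.Icc (τ i) (τ (i + 1)) := by
  rcases ht.2.lt_or_eq with h | h
  · obtain ⟨i, hi, hi'⟩ := exists_mem_Ico (τ := τ) (n := n) (t := t) (by rw [hτ.zero]; exact ht.1)
      (by rw [hτ.one]; exact h)
    exact ⟨i, hi, Set.Ico_subset_Icc_self hi'⟩
  · obtain ⟨i, hi, hi'⟩ := exists_mem_Ioc (τ := τ) (n := n) (t := t) (by rw [hτ.zero, h]; exact one_pos)
      (by rw [hτ.one]; exact ht.2)
    exact ⟨i, hi, Set.Ioc_subset_Icc_self hi'⟩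

/-- The trajectories of the particles with positive labels are forward paths that avoid `A`. -/
theorem flow_isForward {θ α L c : ℝ} (hα : α ∈ Set.Ioo 0 (Real.pi / 2)) {γ : C(I, ℂ)}
    {A B : Set ℂ} {n : ℕ} {τ : ℕ → ℝ} {r m : ℝ} (hF : Fwd θ α c (ext γ) n τ) (hc : 0 < c)
    (h0 : γ 0 = 0) (hL : length γ < L) (hr : 0 < r) (hm : 0 < m) (hA : IsClosed A)
    (hAne : A.Nonempty)
    (hd : ∀ i, r ≤ τ i → i < n →
      ∀ Z, m ≤ Metric.infDist Z A + Metric.infDist (ext γ (τ i) - Z) B)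
    (hmesh : ∀ i < n, τ (i + 1) - τ i ≤ r)
    (hosc : ∀ i < n, ∀ t ∈ Set.Icc (τ i) (τ (i + 1)), ‖ext γ t - ext γ (τ i)‖ < m)
    (hsm : ∀ s ∈ Set.Ioc (0 : ℝ) 1, ∀ t ∈ Set.Ioc 0 (2 * r), (s : ℂ) * ext γ t ∉ A)
    {s : ℝ} (hs : s ∈ Set.Ioc 0 1) (h : C(I, ℂ))
    (hh : ∀ t : I, h t = flow A B r τ (ext γ) n s t) :
    IsForward 0 θ α L h ∧ ∀ t : I, 0 < t → h t ∉ A := by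
  have hf0 : ext γ (τ 0) = 0 := by
    rw [hF.1.zero, ext_of_mem γ (by simp : (0 : ℝ) ∈ I)]; exact h0
  have hav := flow_notMem hF.1.mono hF.1.zero hf0 hr hm hA hAne hd hmesh hosc (hsm s hs)
  have hexth : ∀ i < n, ∀ t ∈ Set.Icc (τ i) (τ (i + 1)), ext h t = flowPt A B r τ (ext γ) i s +
      (flowWt A B r τ (ext γ) i s : ℂ) * (ext γ t - ext γ (τ i)) := by
    intro i hi t ht
    rw [ext_of_mem h (hF.1.Icc_subset hi ht), hh, ← flow_eq hF.1.mono hi ht]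
  constructor
  · refine hF.isForward_of_multiples hα hc hL ?_ (p := fun i => flowWt A B r τ (ext γ) i s) ?_ ?_
    -- The piece found for `t = 0` need not be the first one, as several initial break points may be
    -- `0`; the particle does not move on those.
    · obtain ⟨i, hi, hi'⟩ := exists_mem_Icc hF.1 (t := 0) (by simp)
      have h1 : τ i = 0 := le_antisymm hi'.1 (hF.1.nonneg i)
      have h2 := hexth i hi 0 hi'
      rw [ext_of_mem h (by simp : (0 : ℝ) ∈ I), h1, sub_self, mul_zero, add_zero] at h2
      change h 0 = _ at h2
      have h3 : ∀ j ≤ i, flowPt A B r τ (ext γ) j s = 0 := by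
        intro j
        induction j with
        | zero => intro _; rfl
        | succ j ih =>
          intro hj
          have h4 : τ j = 0 := le_antisymm ((hF.1.mono (by omega)).trans h1.le) (hF.1.nonneg j)
          have h5 : τ (j + 1) = 0 := le_antisymm ((hF.1.mono hj).trans h1.le) (hF.1.nonneg _)
          rw [flowPt_succ, ih (by omega), h4, h5]
          simp
      rw [h2, h3 i le_rfl]
    · intro i hi
      refine ⟨?_, (flowWt_mem ⟨hs.1.le, hs.2⟩).2⟩
      rw [flowWt]
      split_ifs with h1
      · exact hs.1
      · rw [not_lt] at h1
        have h2 := (hA.notMem_iff_infDist_pos hAne).1 ((hav i hi).1 h1)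
        exact div_pos h2 (hm.trans_le (hd i h1 hi _))
    · intro i hi t ht
      rw [hexth i hi t ht, hexth i hi (τ i) ⟨le_rfl, hF.1.mono (Nat.le_succ i)⟩]
      ring
  · intro t ht
    obtain ⟨i, hi, hi'⟩ := exists_mem_Icc hF.1 t.2
    rw [hh, flow_eq hF.1.mono hi hi']
    exact (hav i hi).2 t hi' ht

/-- A deformation `H (·, t)` of the segment `[0, 0]` into paths from `0` to `γ t`, along which the
points `H (s, t)` and `γ t - H (s, t)` move forward and avoid `A`, respectively `B`. -/
theorem exists_flow {θ α L : ℝ} (hα : α ∈ Set.Ioo 0 (Real.pi / 2)) {γ : C(I, ℂ)}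
    (hγ : IsForward 0 θ α L γ) {A B : Set ℂ} (hA : IsClosed A) (hB : IsClosed B) (hA0 : (0 : ℂ) ∈ A)
    (hB0 : (0 : ℂ) ∈ B) {r₀ : ℝ} (hr₀ : 0 < r₀) (hAr : ∀ a ∈ A, ‖a‖ < r₀ → a = 0)
    (hBr : ∀ b ∈ B, ‖b‖ < r₀ → b = 0) (hAB : IsClosed (A + B)) (hav : ∀ t : I, 0 < t → γ t ∉ A + B) :
    ∃ H : I × I → ℂ, Continuous H ∧ (∀ s, H (s, 0) = 0) ∧ (∀ t, H (0, t) = 0) ∧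
      (∀ t, H (1, t) = γ t) ∧ ∀ (s : I) (h : C(I, ℂ)),
        (0 < s → (∀ t, h t = H (s, t)) → IsForward 0 θ α L h ∧ ∀ t, 0 < t → h t ∉ A) ∧
        (s < 1 → (∀ t, h t = γ t - H (s, t)) → IsForward 0 θ α L h ∧ ∀ t, 0 < t → h t ∉ B) := by
  obtain ⟨c, hc, n₀, τ₀, hF₀⟩ := hγ.exists_fwd hα
  have hcont := continuous_ext γ
  have hext0 : ext γ 0 = 0 := by rw [ext_of_mem γ (by simp : (0 : ℝ) ∈ I)]; exact hγ.1
  obtain ⟨δ₀, hδ₀, hsmall⟩ : ∃ δ₀ > 0, ∀ t : ℝ, |t| < δ₀ → ‖ext γ t‖ < r₀ := by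
    obtain ⟨δ, hδ, h⟩ := Metric.continuousAt_iff.1 (hcont.continuousAt (x := 0)) r₀ hr₀
    refine ⟨δ, hδ, fun t ht => ?_⟩
    have := h (show dist t 0 < δ by simpa using ht)
    rwa [hext0, dist_zero_right] at this
  have hpos : ∀ t ∈ Set.Ioc (0 : ℝ) 1, ext γ t ≠ 0 := by
    intro t ht h
    have := (hF₀.slack_sub hcont le_rfl ht.1.le ht.2).1
    rw [h, hext0, sub_self, map_zero, sub_zero] at this
    nlinarith [mul_pos hc ht.1]
  -- Up to time `2 r`, which is `< δ₀` and `≤ 1`, the path stays in the disc where `A` and `B`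
  -- contain only `0`.
  set r := min (δ₀ / 3) (1 / 2) with hr
  have hr0 : 0 < r := by positivity
  have hr1 : r ≤ δ₀ / 3 := min_le_left _ _
  have hr2 : r ≤ 1 / 2 := min_le_right _ _
  have hsm : ∀ C : Set ℂ, (∀ a ∈ C, ‖a‖ < r₀ → a = 0) → ∀ s ∈ Set.Ioc (0 : ℝ) 1,
      ∀ t ∈ Set.Ioc 0 (2 * r), (s : ℂ) * ext γ t ∉ C := by
    intro C hC s hs t ht hmem
    have h1 : ‖ext γ t‖ < r₀ := hsmall t (by rw [abs_of_pos ht.1]; linarith [ht.2])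
    have h2 := hC _ hmem (by
      rw [norm_mul, Complex.norm_real, Real.norm_eq_abs, abs_of_pos hs.1]
      nlinarith [hs.2, norm_nonneg (ext γ t)])
    rcases mul_eq_zero.1 h2 with h3 | h3
    · exact hs.1.ne' (by exact_mod_cast h3)
    · exact hpos t ⟨ht.1, by linarith [ht.2]⟩ h3
  -- `m` will be the minimal distance from `γ` on `[r, 1]` to `A + B`.
  obtain ⟨t₁, ht₁, hmin⟩ := (isCompact_Icc (a := r) (b := 1)).exists_isMinOn
    (Set.nonempty_Icc.2 (by linarith))
    (((Metric.continuous_infDist_pt (A + B)).comp hcont).continuousOn)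
  set m := Metric.infDist (ext γ t₁) (A + B) with hm
  have hne : (A + B).Nonempty := ⟨0 + 0, Set.add_mem_add hA0 hB0⟩
  have hm0 : 0 < m := by
    refine (hAB.notMem_iff_infDist_pos hne).1 ?_
    rw [ext_of_mem γ ⟨by linarith [ht₁.1], ht₁.2⟩]
    exact hav _ (hr0.trans_le ht₁.1)
  obtain ⟨δ₁, hδ₁, huc⟩ := Metric.uniformContinuous_iff.1
    (CompactSpace.uniformContinuous_of_continuous γ.continuous) m hm0
  obtain ⟨n, τ, hF, hmesh⟩ := hF₀.exists_refinement (lt_min hr0 (half_pos hδ₁))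
  have hosc : ∀ i < n, ∀ t ∈ Set.Icc (τ i) (τ (i + 1)), ‖ext γ t - ext γ (τ i)‖ < m := by
    intro i hi t ht
    have hsub := hF.1.Icc_subset hi
    have hti : τ i ∈ Set.Icc (τ i) (τ (i + 1)) := ⟨le_rfl, hF.1.mono (Nat.le_succ i)⟩
    rw [ext_of_mem γ (hsub ht), ext_of_mem γ (hsub hti), ← dist_eq_norm]
    refine huc ?_
    rw [Subtype.dist_eq, Real.dist_eq, abs_of_nonneg (sub_nonneg.2 ht.1)]
    linarith [(hmesh i hi).trans (min_le_right _ _), ht.2]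
  have hmesh' : ∀ i < n, τ (i + 1) - τ i ≤ r := fun i hi => (hmesh i hi).trans (min_le_left _ _)
  have hlow : ∀ i, r ≤ τ i → i < n → m ≤ Metric.infDist (ext γ (τ i)) (A + B) :=
    fun i h hi => hmin ⟨h, hF.1.le_one hi.le⟩
  have hdA : ∀ i, r ≤ τ i → i < n →
      ∀ Z, m ≤ Metric.infDist Z A + Metric.infDist (ext γ (τ i) - Z) B :=
    fun i h hi Z => (hlow i h hi).trans (infDist_add_le ⟨0, hA0⟩ ⟨0, hB0⟩ _ _)
  have hdB : ∀ i, r ≤ τ i → i < n →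
      ∀ Z, m ≤ Metric.infDist Z B + Metric.infDist (ext γ (τ i) - Z) A := by
    intro i h hi Z
    have := hlow i h hi
    rw [add_comm A B] at this
    exact this.trans (infDist_add_le ⟨0, hB0⟩ ⟨0, hA0⟩ _ _)
  have hf0 : ext γ (τ 0) = 0 := by rw [hF.1.zero, hext0]
  have hswap : ∀ s : ℝ, ∀ t ∈ I, flow B A r τ (ext γ) n (1 - s) t =
      ext γ t - flow A B r τ (ext γ) n s t := by
    intro s t ht
    obtain ⟨i, hi, hi'⟩ := exists_mem_Icc hF.1 ht
    obtain ⟨h1, h2⟩ := flow_swap hm0 hf0 hdA s i hi.le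
    rw [flow_eq hF.1.mono hi hi', flow_eq hF.1.mono hi hi', h1, h2 hi]
    push_cast
    ring
  have hzero : ∀ C D : Set ℂ, (0 : ℂ) ∈ C → ∀ t ∈ I, flow C D r τ (ext γ) n 0 t = 0 := by
    intro C D hC t ht
    obtain ⟨i, hi, hi'⟩ := exists_mem_Icc hF.1 ht
    rw [flow_eq hF.1.mono hi hi', (flow_zero hC i).1, (flow_zero hC i).2]
    simp
  have hc1 := continuous_flow (n := n) hcont hm0 hdA
  -- By the symmetry, the complement of the particle with label `1` has label `0`, so it rests at
  -- `0`.
  have hone : ∀ t : I, flow A B r τ (ext γ) n 1 t = γ t := by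
    intro t
    have h1 := hswap 1 t t.2
    rw [sub_self, hzero B A hB0 t t.2, ext_coe] at h1
    exact (sub_eq_zero.1 h1.symm).symm
  have hfA : ∀ (s : I) (h : C(I, ℂ)), 0 < s → (∀ t : I, h t = flow A B r τ (ext γ) n s t) →
      IsForward 0 θ α L h ∧ ∀ t, 0 < t → h t ∉ A := fun s h hs hh =>
    flow_isForward hα hF hc hγ.1 hγ.2.2.1 hr0 hm0 hA ⟨0, hA0⟩ hdA hmesh' hosc (hsm A hAr)
      ⟨hs, s.2.2⟩ h hh
  have hfB : ∀ (s : I) (h : C(I, ℂ)), s < 1 →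
      (∀ t : I, h t = γ t - flow A B r τ (ext γ) n s t) →
      IsForward 0 θ α L h ∧ ∀ t, 0 < t → h t ∉ B := fun s h hs hh =>
    flow_isForward hα hF hc hγ.1 hγ.2.2.1 hr0 hm0 hB ⟨0, hB0⟩ hdB hmesh' hosc (hsm B hBr)
      (s := 1 - s) ⟨sub_pos.2 hs, by linarith [s.2.1]⟩ h
      fun t => by rw [hh, hswap s t t.2, ext_coe]
  obtain ⟨H, hHc, hH⟩ : ∃ H : I × I → ℂ, Continuous H ∧
      ∀ s t : I, H (s, t) = flow A B r τ (ext γ) n s t :=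
    ⟨_, Continuous.comp (f := fun p : I × I => ((p.1 : ℝ), (p.2 : ℝ))) hc1 (by fun_prop),
      fun _ _ => rfl⟩
  have hH0 : ∀ t, H (0, t) = 0 := fun t => by
    rw [hH, Set.Icc.coe_zero]; exact hzero A B hA0 t t.2
  refine ⟨H, hHc, fun s => ?_, hH0, fun t => by rw [hH, Set.Icc.coe_one, hone],
    fun s h => ⟨fun hs hh => hfA s h hs fun t => by rw [hh, hH],
      fun hs hh => hfB s h hs fun t => by rw [hh, hH]⟩⟩
  rcases eq_or_lt_of_le (show (0 : I) ≤ s from s.2.1) with h | h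
  · rw [← h]; exact hH0 0
  · have := (hfA s ⟨fun t : I => H (s, t), by fun_prop⟩ h fun t => hH s t).1.1
    exact this

/-! ### Continuation of the convolution product around sums -/

/-- Covers the two extreme labels, whose trajectories rest at `0` and are not forward paths. -/
theorem continuableAlong_of_const {f : ℂ → ℂ} (hf : AnalyticAt ℂ f 0) {γ : C(I, ℂ)}
    (h : ∀ t, γ t = 0) : ContinuableAlong f γ :=
  ⟨fun _ => f, fun s => by rw [h]; exact hf, EventuallyEq.rfl, fun s =>
    Filter.Eventually.of_forall fun _ => EventuallyEq.rfl⟩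

theorem norm_eq_xc_of_mem {θ : ℝ} {G : Set ℂ} (hG : G ⊆ ray 0 θ) {a : ℂ} (ha : a ∈ G ∪ {0}) :
    0 ≤ xc θ a ∧ yc θ a = 0 ∧ ‖a‖ = xc θ a := by
  have h : 0 ≤ xc θ a ∧ yc θ a = 0 := by
    rcases ha with ha | ha
    · have := (mem_ray_iff a).1 (hG ha)
      exact ⟨this.1.le, this.2⟩
    · rw [Set.mem_singleton_iff] at ha
      simp [ha]
  exact ⟨h.1, h.2, norm_eq_xc h.2 h.1⟩

/-- On a closed half-line from `0` norms add up, so a sum of norm `< L` has both terms of norm `<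
L`. -/
theorem finite_add_inter_ball {θ : ℝ} {G G' : Set ℂ} (hG : G ⊆ ray 0 θ) (hG' : G' ⊆ ray 0 θ)
    (hf : ∀ L : ℝ, (G ∩ Metric.ball 0 L).Finite) (hf' : ∀ L : ℝ, (G' ∩ Metric.ball 0 L).Finite)
    (L : ℝ) : (((G ∪ {0}) + (G' ∪ {0})) ∩ Metric.ball 0 L).Finite := by
  have h : ∀ G : Set ℂ, (G ∩ Metric.ball 0 L).Finite → ((G ∪ {0}) ∩ Metric.ball 0 L).Finite := by
    intro G hG
    rw [Set.union_inter_distrib_right]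
    exact hG.union ((Set.finite_singleton _).inter_of_left _)
  refine ((h G (hf L)).add (h G' (hf' L))).subset ?_
  rintro _ ⟨⟨a, ha, b, hb, rfl⟩, hab⟩
  obtain ⟨a1, a2, a3⟩ := norm_eq_xc_of_mem hG ha
  obtain ⟨b1, b2, b3⟩ := norm_eq_xc_of_mem hG' hb
  have h1 : ‖a + b‖ = xc θ a + xc θ b := by
    rw [← map_add]
    exact norm_eq_xc (by rw [map_add, a2, b2, add_zero]) (by rw [map_add]; linarith)
  rw [mem_ball_zero_iff] at hab
  simp only at hab
  exact Set.add_mem_add ⟨ha, by rw [mem_ball_zero_iff]; linarith⟩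
    ⟨hb, by rw [mem_ball_zero_iff]; linarith⟩

theorem exists_ball_of_locallyFinite {θ : ℝ} {G : Set ℂ} (hG : G ⊆ ray 0 θ)
    (hf : ∀ L : ℝ, (G ∩ Metric.ball 0 L).Finite) : ∃ r > 0, ∀ a ∈ G ∪ {0}, ‖a‖ < r → a = 0 := by
  have h0 : (0 : ℂ) ∉ G := fun h => by simpa using ((mem_ray_iff 0).1 (hG h)).1
  obtain ⟨r, hr, hsub⟩ := Metric.mem_nhds_iff.1
    ((isClosed_of_locallyFinite hf).isOpen_compl.mem_nhds h0)
  refine ⟨r, hr, fun a ha hn => ?_⟩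
  rcases ha with ha | ha
  · exact absurd ha (hsub (by simpa using hn))
  · exact ha

theorem isClosed_union_zero {G : Set ℂ} (hf : ∀ L : ℝ, (G ∩ Metric.ball 0 L).Finite) :
    IsClosed (G ∪ {0}) := (isClosed_of_locallyFinite hf).union isClosed_singleton

/-- The convolution product continues around the sums of the points around which the factors
continue. -/
theorem continuesAround_conv {θ : ℝ} {φ ψ : ℂ → ℂ} {G G' : Set ℂ} (hφ : AnalyticAt ℂ φ 0)
    (hψ : AnalyticAt ℂ ψ 0) (hG : G ⊆ ray 0 θ) (hG' : G' ⊆ ray 0 θ)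
    (hf : ∀ L : ℝ, (G ∩ Metric.ball 0 L).Finite) (hf' : ∀ L : ℝ, (G' ∩ Metric.ball 0 L).Finite)
    (hcφ : ContinuesAround φ 0 θ G) (hcψ : ContinuesAround ψ 0 θ G') :
    ContinuesAround (conv φ ψ) 0 θ (((G ∪ {0}) + (G' ∪ {0})) \ {0}) := by
  intro L hL
  obtain ⟨α₁, hα₁, h₁⟩ := hcφ L hL
  obtain ⟨α₂, hα₂, h₂⟩ := hcψ L hL
  have hα : min α₁ α₂ ∈ Set.Ioo 0 (Real.pi / 2) :=
    ⟨lt_min hα₁.1 hα₂.1, (min_le_left _ _).trans_lt hα₁.2⟩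
  refine ⟨min α₁ α₂, hα, fun γ hγ hav => ?_⟩
  obtain ⟨ra, hra, hra'⟩ := exists_ball_of_locallyFinite hG hf
  obtain ⟨rb, hrb, hrb'⟩ := exists_ball_of_locallyFinite hG' hf'
  obtain ⟨H, hHc, hH0, h0, h1, hH⟩ := exists_flow hα hγ (isClosed_union_zero hf)
    (isClosed_union_zero hf') (Or.inr rfl) (Or.inr rfl) (lt_min hra hrb)
    (fun a ha h => hra' a ha (h.trans_le (min_le_left _ _)))
    (fun a ha h => hrb' a ha (h.trans_le (min_le_right _ _)))
    (isClosed_of_locallyFinite (finite_add_inter_ball hG hG' hf hf')) (fun t ht hmem => by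
      refine hav t ⟨hmem, fun hz => ?_⟩
      have := hγ.strictMono hα ht
      simp only [hγ.1, map_zero] at this
      rw [Set.mem_singleton_iff] at hz
      rw [hz, map_zero] at this
      exact lt_irrefl _ this)
  have havoid : ∀ {G : Set ℂ} {h : C(I, ℂ)}, G ⊆ ray 0 θ → h 0 = 0 →
      (∀ t, 0 < t → h t ∉ G ∪ {0}) → ∀ t, h t ∉ G := by
    intro G h hG hh0 hh t ht
    rcases eq_or_lt_of_le (show (0 : I) ≤ t from t.2.1) with h3 | h3
    · rw [← h3, hh0] at ht
      simpa using ((mem_ray_iff 0).1 (hG ht)).1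
    · exact hh t h3 (Or.inl ht)
  obtain ⟨Φ, hΦ, hΦ0⟩ := exists_germField_prod (f := φ) hHc hH0 fun s => by
    rcases eq_or_lt_of_le (show (0 : I) ≤ s from s.2.1) with h3 | h3
    · exact continuableAlong_of_const hφ fun t => by
        change H (s, t) = 0
        rw [← h3, h0]
    · obtain ⟨h4, h5⟩ := (hH s ⟨fun t => H (s, t), by fun_prop⟩).1 h3 fun t => rfl
      exact h₁ _ (h4.mono (min_le_left _ _) le_rfl) (havoid hG h4.1 h5)
  obtain ⟨Ψ, hΨ, hΨ0⟩ := exists_germField_prod (f := ψ) (H := fun p : I × I => γ p.2 - H p)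
    (c₀ := 0) (by fun_prop) (fun s => by simp [hH0, hγ.1]) fun s => by
      rcases eq_or_lt_of_le (show s ≤ (1 : I) from s.2.2) with h3 | h3
      · exact continuableAlong_of_const hψ fun t => by
          change γ t - H (s, t) = 0
          rw [h3, h1, sub_self]
      · obtain ⟨h4, h5⟩ := (hH s ⟨fun t => γ t - H (s, t), by fun_prop⟩).2 h3 fun t => rfl
        exact h₂ _ (h4.mono (min_le_right _ _) le_rfl) (havoid hG' h4.1 h5)
  exact continuableAlong_conv_of_germField hHc hH0 hγ.1 h0 h1 hΦ hΨ hΦ0 hΨ0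


/-! ### Allowed paths -/

theorem center_mem {c : ℂ} (Ω : DiscreteFilteredSet c) {L : ℝ} (hL : 0 < L) : c ∈ Ω L := by
  obtain ⟨ε, hε, h⟩ := Ω.eq_center'
  have h1 := h (min ε L) (lt_min hε hL) (min_le_left _ _)
  exact Ω.mono' _ _ (lt_min hε hL) (min_le_right _ _) (by rw [h1]; rfl)

/-- A path that does not return to `c` after having left it. -/
def Emanates (c : ℂ) (γ : C(I, ℂ)) : Prop := ∀ s s' : I, s ≤ s' → γ s' = c → γ s = c

/-- The resting time `t₀` is replaced by two conditions free of choices: the path does not come back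
to `c`, and it meets `Ω L` only at `c`. Deformations are checked in this form. -/
theorem allowedAt_iff {c : ℂ} {Ω : DiscreteFilteredSet c} {L : ℝ} (hL : 0 < L) {γ : C(I, ℂ)} :
    AllowedAt Ω L γ ↔ γ 0 = c ∧ PiecewiseC1 γ ∧ length γ < L ∧ Emanates c γ ∧
      ∀ s, γ s ∈ Ω L → γ s = c := by
  constructor
  · rintro ⟨h1, h2, h3, h4 | ⟨t₀, ht₀, h5, h6⟩⟩
    · exact ⟨h1, h2, h3, fun s _ _ _ => h4 s, fun s _ => h4 s⟩
    · have h7 : ∀ s, γ s ∈ Ω L → s ≤ t₀ := fun s hs => by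
        by_contra h
        exact (h6 s (not_le.1 h)).2 hs
      refine ⟨h1, h2, h3, fun s s' hss hs' => ?_, fun s hs => h5 s (h7 s hs)⟩
      exact h5 s (hss.trans (h7 s' (by rw [hs']; exact center_mem Ω hL)))
  · rintro ⟨h1, h2, h3, h4, h5⟩
    refine ⟨h1, h2, h3, ?_⟩
    by_cases hc : ∀ s, γ s = c
    · exact Or.inl hc
    · right
      have hcl : IsClosed {s : I | γ s = c} := isClosed_eq γ.continuous continuous_const
      have hne : {s : I | γ s = c}.Nonempty := ⟨0, h1⟩
      have hmem : sSup {s : I | γ s = c} ∈ {s : I | γ s = c} := hcl.isCompact.sSup_mem hne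
      -- The resting time is the last visit to `c`, attained because the set of visits is closed.
      refine ⟨sSup {s : I | γ s = c}, lt_of_le_of_ne unitInterval.le_one' fun h => ?_,
        fun s hs => h4 s _ hs hmem, fun s hs => ?_⟩
      · rw [h] at hmem
        exact hc fun s => h4 s 1 unitInterval.le_one' hmem
      · refine ⟨?_, fun h => ?_⟩
        · rw [mem_ball_iff_norm, ← h1]
          exact (h2.norm_sub_le_length s).trans_lt h3
        · exact not_lt.2 (le_sSup (show s ∈ {s : I | γ s = c} from h5 s h)) hs

theorem Allowed.emanates {c : ℂ} {Ω : DiscreteFilteredSet c} {γ : C(I, ℂ)} (h : Allowed Ω γ) :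
    Emanates c γ := by
  obtain ⟨L, hL, h⟩ := h
  exact ((allowedAt_iff hL).1 h).2.2.2.1

/-! ### Paths followed by two segments -/

/-- The real number `x` clamped to `[0,1]`. -/
noncomputable def clamp (x : ℝ) : ℝ := Set.projIcc (0 : ℝ) 1 zero_le_one x

theorem continuous_clamp : Continuous clamp := continuous_subtype_val.comp continuous_projIcc

theorem clamp_mem (x : ℝ) : clamp x ∈ I := Subtype.coe_prop _

theorem clamp_of_nonpos {x : ℝ} (h : x ≤ 0) : clamp x = 0 := by
  rw [clamp, Set.projIcc_of_le_left zero_le_one h]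

theorem clamp_of_one_le {x : ℝ} (h : 1 ≤ x) : clamp x = 1 := by
  rw [clamp, Set.projIcc_of_right_le zero_le_one h]

theorem clamp_of_mem {x : ℝ} (h : x ∈ I) : clamp x = x := by
  rw [clamp, Set.projIcc_of_mem zero_le_one h]

/-- The value at `s` of the path that follows `γ` on `[0, b]`, a segment to `p` on `[b, d]` and a
segment to `q` on `[d, 1]`. -/
noncomputable def polyFun (γ : ℝ → ℂ) (b d : ℝ) (p q : ℂ) (s : ℝ) : ℂ :=
  γ (s / b) + clamp ((s - b) / (d - b)) * (p - γ 1) + clamp ((s - d) / (1 - d)) * (q - p)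

theorem polyFun_of_le {γ : C(I, ℂ)} {b d : ℝ} {p q : ℂ} (_ : 0 < b) (hbd : b < d) (hd : d < 1)
    {s : ℝ} (hs : s ≤ b) : polyFun (ext γ) b d p q s = ext γ (s / b) := by
  rw [polyFun, clamp_of_nonpos (div_nonpos_of_nonpos_of_nonneg (by linarith) (by linarith)),
    clamp_of_nonpos (div_nonpos_of_nonpos_of_nonneg (by linarith) (by linarith))]
  simp

theorem ext_of_one_le (γ : C(I, ℂ)) {t : ℝ} (ht : 1 ≤ t) : ext γ t = γ 1 := by
  rw [ext, Set.IccExtend_of_right_le _ _ ht]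
  rfl

theorem polyFun_of_mem {γ : C(I, ℂ)} {b d : ℝ} {p q : ℂ} (hb : 0 < b) (hbd : b < d) (hd : d < 1)
    {s : ℝ} (hs : s ∈ Set.Icc b d) :
    polyFun (ext γ) b d p q s = γ 1 + ((s - b) / (d - b) : ℝ) * (p - γ 1) := by
  rw [polyFun, clamp_of_mem ⟨div_nonneg (by linarith [hs.1]) (by linarith),
      (div_le_one (by linarith)).2 (by linarith [hs.2])⟩,
    clamp_of_nonpos (div_nonpos_of_nonpos_of_nonneg (by linarith [hs.2]) (by linarith)),
    ext_of_one_le γ ((one_le_div hb).2 hs.1), ext_of_one_le γ le_rfl]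
  simp

theorem polyFun_of_ge {γ : C(I, ℂ)} {b d : ℝ} {p q : ℂ} (hb : 0 < b) (hbd : b < d) (hd : d < 1)
    {s : ℝ} (hs : s ∈ Set.Icc d 1) :
    polyFun (ext γ) b d p q s = p + ((s - d) / (1 - d) : ℝ) * (q - p) := by
  rw [polyFun, clamp_of_one_le ((one_le_div (by linarith)).2 (by linarith [hs.1])),
    clamp_of_mem ⟨div_nonneg (by linarith [hs.1]) (by linarith),
      (div_le_one (by linarith)).2 (by linarith [hs.2])⟩,
    ext_of_one_le γ ((one_le_div hb).2 (by linarith [hs.1])), ext_of_one_le γ le_rfl]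
  simp

/-- The path that follows `γ` on `[0, b]`, a segment to `p` on `[b, d]` and a segment to `q` on
`[d, 1]`. -/
noncomputable def polyPath (γ : C(I, ℂ)) (b d : ℝ) (p q : ℂ) : C(I, ℂ) :=
  ⟨fun s => polyFun (ext γ) b d p q s, by
    have h1 := continuous_ext γ
    have h2 := continuous_clamp
    unfold polyFun
    fun_prop⟩

theorem polyPath_apply (γ : C(I, ℂ)) (b d : ℝ) (p q : ℂ) (s : I) :
    polyPath γ b d p q s = polyFun (ext γ) b d p q s := rfl

theorem ext_polyPath (γ : C(I, ℂ)) (b d : ℝ) (p q : ℂ) {s : ℝ} (hs : s ∈ I) :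
    ext (polyPath γ b d p q) s = polyFun (ext γ) b d p q s := by
  rw [ext_of_mem _ hs]; rfl

theorem polyPath_zero {γ : C(I, ℂ)} {b d : ℝ} {p q : ℂ} (hb : 0 < b) (hbd : b < d) (hd : d < 1) :
    polyPath γ b d p q 0 = γ 0 := by
  rw [polyPath_apply, Set.Icc.coe_zero, polyFun_of_le hb hbd hd hb.le, zero_div]
  exact ext_coe γ 0

theorem polyPath_one {γ : C(I, ℂ)} {b d : ℝ} {p q : ℂ} (hb : 0 < b) (hbd : b < d) (hd : d < 1) :
    polyPath γ b d p q 1 = q := by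
  rw [polyPath_apply, Set.Icc.coe_one, polyFun_of_ge hb hbd hd ⟨hd.le, le_rfl⟩,
    div_self (by linarith)]
  simp

theorem appendSegment_apply (γ : C(I, ℂ)) (z : ℂ) (s : I) : appendSegment γ z s =
    if (s : ℝ) ≤ 1 / 2 then ext γ (2 * s) else γ 1 + ((2 * s - 1 : ℝ) : ℂ) * (z - γ 1) := by
  change ((⟨γ, rfl, rfl⟩ : Path (γ 0) (γ 1)).trans (Path.segment (γ 1) z)) s = _
  rw [Path.trans_apply]
  split_ifs with h
  · rw [ext_of_mem γ ⟨by linarith [s.2.1], by linarith⟩]; rfl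
  · rw [Path.segment_apply, AffineMap.lineMap_apply, vsub_eq_sub, vadd_eq_add, Complex.real_smul]
    ring

/-- Cutting the segment at its midpoint puts one appended segment into the same family as two
appended segments, so that one can be deformed into the other. -/
theorem appendSegment_eq (γ : C(I, ℂ)) (z : ℂ) :
    appendSegment γ z = polyPath γ (1 / 2) (3 / 4) ((γ 1 + z) / 2) z := by
  apply ContinuousMap.ext
  intro s
  rw [appendSegment_apply, polyPath_apply]
  split_ifs with h
  · rw [polyFun_of_le (by norm_num) (by norm_num) (by norm_num) h]
    congr 1; ring
  · rw [not_le] at h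
    rcases le_total (s : ℝ) (3 / 4) with h1 | h1
    · rw [polyFun_of_mem (by norm_num) (by norm_num) (by norm_num) ⟨h.le, h1⟩]
      push_cast; ring
    · rw [polyFun_of_ge (by norm_num) (by norm_num) (by norm_num) ⟨h1, s.2.2⟩]
      push_cast; ring

theorem appendSegment_one (γ : C(I, ℂ)) (z : ℂ) : appendSegment γ z 1 = z := by
  rw [appendSegment_eq, polyPath_one] <;> norm_num

theorem appendSegment_appendSegment_eq (γ : C(I, ℂ)) (z₀ z : ℂ) :
    appendSegment (appendSegment γ z₀) z = polyPath γ (1 / 4) (1 / 2) z₀ z := by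
  apply ContinuousMap.ext
  intro s
  rw [appendSegment_apply, polyPath_apply, appendSegment_one]
  split_ifs with h
  · have hs2 : 2 * (s : ℝ) ∈ I := ⟨by linarith [s.2.1], by linarith⟩
    rw [ext_of_mem _ hs2, appendSegment_apply]
    split_ifs with h1
    · simp only at h1
      rw [polyFun_of_le (by norm_num) (by norm_num) (by norm_num) (by linarith)]
      congr 1; simp only; ring
    · simp only [not_le] at h1
      rw [polyFun_of_mem (by norm_num) (by norm_num) (by norm_num) ⟨by linarith, h⟩]
      simp only; push_cast; ring
  · rw [not_le] at h
    rw [polyFun_of_ge (by norm_num) (by norm_num) (by norm_num) ⟨h.le, s.2.2⟩]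
    push_cast; ring

/-- A criterion for a path followed by two segments to emanate from `c`. -/
theorem emanates_polyPath {c : ℂ} {γ : C(I, ℂ)} {b d : ℝ} {p q : ℂ} (hb : 0 < b) (hbd : b < d)
    (hd : d < 1) (h1 : Emanates c γ)
    (h2 : ∀ u : ℝ, u ∈ I → γ 1 + u * (p - γ 1) = c → γ 1 = c ∧ (u = 0 ∨ p = c))
    (h3 : ∀ u : ℝ, u ∈ I → p + u * (q - p) = c → γ 1 = c ∧ p = c ∧ (u = 0 ∨ q = c)) :
    Emanates c (polyPath γ b d p q) := by
  have hγ : ∀ s : I, γ 1 = c → γ s = c := fun s h => h1 s 1 s.2.2 h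
  have hlow : ∀ s : I, (s : ℝ) ≤ b → γ 1 = c → polyFun (ext γ) b d p q s = c := by
    intro s hs h
    rw [polyFun_of_le hb hbd hd hs,
      ext_of_mem γ ⟨div_nonneg s.2.1 hb.le, (div_le_one hb).2 hs⟩]
    exact hγ _ h
  intro s s' hss h
  have hss' : (s : ℝ) ≤ s' := hss
  rw [polyPath_apply] at h ⊢
  rcases le_total (s' : ℝ) b with hs' | hs'
  · have hs : (s : ℝ) ≤ b := hss'.trans hs'
    rw [polyFun_of_le hb hbd hd hs', ext_of_mem γ ⟨div_nonneg s'.2.1 hb.le, (div_le_one hb).2 hs'⟩] at h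
    rw [polyFun_of_le hb hbd hd hs, ext_of_mem γ ⟨div_nonneg s.2.1 hb.le, (div_le_one hb).2 hs⟩]
    exact h1 _ _ (div_le_div_of_nonneg_right hss' hb.le) h
  rcases le_total (s' : ℝ) d with hs'' | hs''
  · rw [polyFun_of_mem hb hbd hd ⟨hs', hs''⟩] at h
    obtain ⟨h4, h5⟩ := h2 _ ⟨div_nonneg (by linarith) (by linarith),
      (div_le_one (by linarith)).2 (by linarith)⟩ h
    rcases le_total (s : ℝ) b with hs | hs
    · exact hlow s hs h4
    · rw [polyFun_of_mem hb hbd hd ⟨hs, hss'.trans hs''⟩, h4]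
      rcases h5 with h5 | h5
      · rw [div_eq_zero_iff] at h5
        have h6 : (s : ℝ) - b = 0 := by
          rcases h5 with h5 | h5 <;> linarith
        rw [h6]; simp
      · rw [h5]; simp
  · rw [polyFun_of_ge hb hbd hd ⟨hs'', s'.2.2⟩] at h
    obtain ⟨h4, h5, h6⟩ := h3 _ ⟨div_nonneg (by linarith) (by linarith),
      (div_le_one (by linarith)).2 (by linarith [s'.2.2])⟩ h
    rcases le_total (s : ℝ) b with hs | hs
    · exact hlow s hs h4
    rcases le_total (s : ℝ) d with hsd | hsd
    · rw [polyFun_of_mem hb hbd hd ⟨hs, hsd⟩, h4, h5]; simp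
    · rw [polyFun_of_ge hb hbd hd ⟨hsd, s.2.2⟩, h5]
      rcases h6 with h6 | h6
      · rw [div_eq_zero_iff] at h6
        have h7 : (s : ℝ) - d = 0 := by
          rcases h6 with h6 | h6 <;> linarith
        rw [h7]; simp
      · rw [h6]; simp

/-- The image of a path followed by two segments. -/
theorem polyPath_mem {γ : C(I, ℂ)} {b d : ℝ} {p q : ℂ} (hb : 0 < b) (hbd : b < d) (hd : d < 1)
    (s : I) : (∃ t, polyPath γ b d p q s = γ t) ∨ polyPath γ b d p q s ∈ segment ℝ (γ 1) p ∨
      polyPath γ b d p q s ∈ segment ℝ p q := by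
  have hseg : ∀ (x y : ℂ) (u : ℝ), u ∈ I → x + u * (y - x) ∈ segment ℝ x y := fun x y u hu => by
    rw [segment_eq_image']
    exact ⟨u, hu, by simp only [Complex.real_smul]⟩
  rw [polyPath_apply]
  rcases le_total (s : ℝ) b with hs | hs
  · left
    rw [polyFun_of_le hb hbd hd hs, ext_of_mem γ ⟨div_nonneg s.2.1 hb.le, (div_le_one hb).2 hs⟩]
    exact ⟨_, rfl⟩
  rcases le_total (s : ℝ) d with hsd | hsd
  · right; left
    rw [polyFun_of_mem hb hbd hd ⟨hs, hsd⟩]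
    exact hseg _ _ _ ⟨div_nonneg (by linarith) (by linarith),
      (div_le_one (by linarith)).2 (by linarith)⟩
  · right; right
    rw [polyFun_of_ge hb hbd hd ⟨hsd, s.2.2⟩]
    exact hseg _ _ _ ⟨div_nonneg (by linarith) (by linarith),
      (div_le_one (by linarith)).2 (by linarith [s.2.2])⟩


/-! ### Families of paths -/

theorem slice_apply (m : C(I × I, ℂ)) (t s : I) : slice m t s = m (s, t) := rfl

theorem PiecewiseC1InS.piecewiseC1 {m : C(I × I, ℂ)} (hm : PiecewiseC1InS m) (t : I) :
    PiecewiseC1 (slice m t) := by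
  obtain ⟨n, τ, -, h2, h3, h4, h5⟩ := hm
  refine piecewiseC1_iff.2 ⟨n, fun i => τ i t, ⟨h2 t, h3 t, h4 t⟩, fun i hi => ?_⟩
  obtain ⟨D, hD, hD'⟩ := h5 i hi
  refine ⟨fun s => D (s, t), hD.comp (by fun_prop) fun s hs => hs, fun s hs => hD' t s hs⟩

/-- The family of paths constantly equal to `γ`. -/
noncomputable def constFam (γ : C(I, ℂ)) : C(I × I, ℂ) := γ.comp ContinuousMap.fst

theorem piecewiseC1InS_constFam {γ : C(I, ℂ)} (h : PiecewiseC1 γ) :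
    PiecewiseC1InS (constFam γ) := by
  obtain ⟨n, τ, hτ, h⟩ := piecewiseC1_iff.1 h
  refine ⟨n, fun i _ => τ i, fun i => continuous_const, fun _ => hτ.mono, fun _ => hτ.zero,
    fun _ => hτ.one, fun i hi => ?_⟩
  obtain ⟨g, hg⟩ := h i hi
  exact ⟨fun x => g x.1, hg.1.comp (by fun_prop) fun x hx => hx, fun t s hs => hg.2 s hs⟩

theorem hasDerivAt_affine (x y : ℂ) (b e s : ℝ) :
    HasDerivAt (fun s : ℝ => x + ((s - b) / e : ℝ) * y) (y / e) s := by
  have h1 : HasDerivAt (fun s : ℝ => (((s - b) / e : ℝ) : ℂ)) ((1 / e : ℝ) : ℂ) s :=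
    (((hasDerivAt_id s).sub_const b).div_const e).ofReal_comp
  have h2 := (h1.mul_const y).const_add x
  exact h2.congr_deriv (by push_cast; ring)

theorem hasDerivWithinAt_comp_div {f : ℝ → ℂ} {g : ℂ} {x y b s : ℝ} (hb : 0 < b)
    (h : HasDerivWithinAt f g (Set.Icc x y) (s / b)) :
    HasDerivWithinAt (fun s => f (s / b)) (g / b) (Set.Icc (x * b) (y * b)) s := by
  have h1 : HasDerivWithinAt (fun s : ℝ => s / b) (1 / b) (Set.Icc (x * b) (y * b)) s :=
    ((hasDerivAt_id s).div_const b).hasDerivWithinAt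
  have hmaps : Set.MapsTo (fun s : ℝ => s / b) (Set.Icc (x * b) (y * b)) (Set.Icc x y) :=
    fun u hu => ⟨(le_div_iff₀ hb).2 hu.1, (div_le_iff₀ hb).2 hu.2⟩
  refine (HasDerivWithinAt.scomp s h h1 hmaps).congr_deriv ?_
  rw [Complex.real_smul]
  push_cast
  ring

/-- Families of paths followed by two segments are piecewise `C¹`. -/
theorem exists_polyFam {m : C(I × I, ℂ)} (hm : PiecewiseC1InS m) (k : C(I, I)) {b d : I → ℝ}
    {p q : I → ℂ} (hb : Continuous b) (hd : Continuous d) (hp : Continuous p) (hq : Continuous q)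
    (hb0 : ∀ t, 0 < b t) (hbd : ∀ t, b t < d t) (hd1 : ∀ t, d t < 1) :
    ∃ K : C(I × I, ℂ), PiecewiseC1InS K ∧
      ∀ t, slice K t = polyPath (slice m (k t)) (b t) (d t) (p t) (q t) := by
  have hdb : ∀ t, d t - b t ≠ 0 := fun t => by linarith [hbd t]
  have hd1' : ∀ t, 1 - d t ≠ 0 := fun t => by linarith [hd1 t]
  have hKc : Continuous fun x : I × I => polyFun (ext (slice m (k x.2))) (b x.2) (d x.2) (p x.2)
      (q x.2) x.1 := by
    have h1 : Continuous fun x : I × I => ext (slice m (k x.2)) (x.1 / b x.2) := by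
      have : Continuous fun x : I × I =>
          m (Set.projIcc (0 : ℝ) 1 zero_le_one (x.1 / b x.2), k x.2) := by
        have h3 : Continuous fun x : I × I => (x.1 : ℝ) / b x.2 :=
          (by fun_prop : Continuous fun x : I × I => (x.1 : ℝ)).div (by fun_prop)
            fun x => (hb0 x.2).ne'
        exact m.continuous.comp ((continuous_projIcc.comp h3).prodMk (by fun_prop))
      exact this
    have h2 : Continuous fun x : I × I => ext (slice m (k x.2)) 1 := by
      have : Continuous fun x : I × I =>
          m (Set.projIcc (0 : ℝ) 1 zero_le_one 1, k x.2) := by fun_prop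
      exact this
    have h3 : Continuous fun x : I × I => clamp (((x.1 : ℝ) - b x.2) / (d x.2 - b x.2)) :=
      continuous_clamp.comp ((by fun_prop : Continuous fun x : I × I => (x.1 : ℝ) - b x.2).div
        (by fun_prop) fun x => hdb x.2)
    have h4 : Continuous fun x : I × I => clamp (((x.1 : ℝ) - d x.2) / (1 - d x.2)) :=
      continuous_clamp.comp ((by fun_prop : Continuous fun x : I × I => (x.1 : ℝ) - d x.2).div
        (by fun_prop) fun x => hd1' x.2)
    unfold polyFun
    fun_prop
  refine ⟨⟨_, hKc⟩, ?_, fun t => rfl⟩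
  obtain ⟨n, τ, h1, h2, h3, h4, h5⟩ := hm
  have hslice : ∀ t, slice ⟨_, hKc⟩ t = polyPath (slice m (k t)) (b t) (d t) (p t) (q t) :=
    fun t => rfl
  have hle1 : ∀ i ≤ n, ∀ t, τ i (k t) ≤ 1 := fun i hi t => by
    rw [← h4 (k t)]; exact h2 (k t) hi
  have hnn : ∀ i, ∀ t, 0 ≤ τ i (k t) := fun i t => by
    rw [← h3 (k t)]; exact h2 (k t) (Nat.zero_le i)
  -- The break points of the slice are contracted to `[0, b t]`, the `n`-th becoming `b t`; then
  -- come `d t` and `1`.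
  refine ⟨n + 2, fun i t => if i ≤ n then τ i (k t) * b t else if i = n + 1 then d t else 1,
    fun i => ?_, fun t => monotone_nat_of_le_succ fun i => ?_, fun t => ?_, fun t => ?_,
    fun i hi => ?_⟩
  · dsimp only
    split_ifs
    · exact ((h1 i).comp k.continuous).mul hb
    · exact hd
    · exact continuous_const
  · dsimp only
    rcases lt_trichotomy i n with h | rfl | h
    · rw [if_pos h.le, if_pos (by omega)]
      exact mul_le_mul_of_nonneg_right (h2 (k t) (Nat.le_succ i)) (hb0 t).le
    · rw [if_pos le_rfl, if_neg (by omega), if_pos rfl, h4]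
      linarith [hbd t]
    · rw [if_neg (show ¬ i ≤ n by omega), if_neg (show ¬ i + 1 ≤ n by omega),
        if_neg (show ¬ i + 1 = n + 1 by omega)]
      split_ifs
      · exact (hd1 t).le
      · exact le_rfl
  · simp [h3]
  · simp
  · rcases lt_trichotomy i n with h | rfl | h
    · obtain ⟨D, hD, hD'⟩ := h5 i h
      simp only [if_pos h.le, if_pos (show i + 1 ≤ n by omega)]
      have hmem : ∀ t s, s ∈ Set.Icc (τ i (k t) * b t) (τ (i + 1) (k t) * b t) →
          s / b t ∈ Set.Icc (τ i (k t)) (τ (i + 1) (k t)) := fun t s hs =>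
        ⟨(le_div_iff₀ (hb0 t)).2 hs.1, (div_le_iff₀ (hb0 t)).2 hs.2⟩
      refine ⟨fun x => D (x.1 / b x.2, k x.2) / b x.2, ?_, fun t s hs => ?_⟩
      · refine ContinuousOn.div (hD.comp (ContinuousOn.prodMk ?_ (by fun_prop)) ?_)
          (by fun_prop) fun x _ => by exact_mod_cast (hb0 x.2).ne'
        · exact (continuous_fst.div (hb.comp continuous_snd) fun x => (hb0 x.2).ne').continuousOn
        · exact fun x hx => hmem x.2 x.1 hx
      · have heq : ∀ u ∈ Set.Icc (τ i (k t) * b t) (τ (i + 1) (k t) * b t),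
            ext (slice ⟨_, hKc⟩ t) u = ext (slice m (k t)) (u / b t) := fun u hu => by
          have hub : u ≤ b t := hu.2.trans (mul_le_of_le_one_left (hb0 t).le (hle1 _ h t))
          rw [hslice, ext_polyPath _ _ _ _ _ ⟨le_trans (mul_nonneg (hnn i t) (hb0 t).le) hu.1,
            by linarith [hbd t, hd1 t]⟩, polyFun_of_le (hb0 t) (hbd t) (hd1 t) hub]
        exact (hasDerivWithinAt_comp_div (hb0 t) (hD' (k t) _ (hmem t s hs))).congr heq (heq s hs)
    · simp only [if_pos le_rfl, if_neg (show ¬ i + 1 ≤ i by omega), if_true, h4, one_mul]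
      refine ⟨fun x => (p x.2 - slice m (k x.2) 1) / ((d x.2 - b x.2 : ℝ) : ℂ), ?_,
        fun t s hs => ?_⟩
      · simp only [slice_apply]
        exact (Continuous.div (by fun_prop) (by fun_prop) fun x => by
          exact_mod_cast hdb x.2).continuousOn
      · have heq : ∀ u ∈ Set.Icc (b t) (d t), ext (slice ⟨_, hKc⟩ t) u =
            slice m (k t) 1 + ((u - b t) / (d t - b t) : ℝ) * (p t - slice m (k t) 1) :=
          fun u hu => by
            rw [hslice, ext_polyPath _ _ _ _ _ ⟨(hb0 t).le.trans hu.1, hu.2.trans (hd1 t).le⟩,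
              polyFun_of_mem (hb0 t) (hbd t) (hd1 t) hu]
        exact (hasDerivAt_affine _ _ _ _ _).hasDerivWithinAt.congr heq (heq s hs)
    · obtain rfl : i = n + 1 := by omega
      simp only [if_neg (show ¬ n + 1 ≤ n by omega), if_neg (show ¬ n + 1 + 1 ≤ n by omega),
        if_true, if_neg (show ¬ n + 1 + 1 = n + 1 by omega)]
      refine ⟨fun x => (q x.2 - p x.2) / ((1 - d x.2 : ℝ) : ℂ), ?_, fun t s hs => ?_⟩
      · exact (Continuous.div (by fun_prop) (by fun_prop) fun x => by
          exact_mod_cast hd1' x.2).continuousOn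
      · have heq : ∀ u ∈ Set.Icc (d t) 1, ext (slice ⟨_, hKc⟩ t) u =
            p t + ((u - d t) / (1 - d t) : ℝ) * (q t - p t) :=
          fun u hu => by
            rw [hslice, ext_polyPath _ _ _ _ _ ⟨((hb0 t).trans (hbd t)).le.trans hu.1, hu.2⟩,
              polyFun_of_ge (hb0 t) (hbd t) (hd1 t) hu]
        exact (hasDerivAt_affine _ _ _ _ _).hasDerivWithinAt.congr heq (heq s hs)

theorem PiecewiseC1.polyPath {γ : C(I, ℂ)} (h : PiecewiseC1 γ) {b d : ℝ} {p q : ℂ} (hb : 0 < b)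
    (hbd : b < d) (hd : d < 1) : PiecewiseC1 (polyPath γ b d p q) := by
  obtain ⟨K, hK, hK'⟩ := exists_polyFam (piecewiseC1InS_constFam h) (ContinuousMap.id I)
    (b := fun _ => b) (d := fun _ => d) (p := fun _ => p) (q := fun _ => q) continuous_const
    continuous_const continuous_const continuous_const (fun _ => hb) (fun _ => hbd) fun _ => hd
  have := hK.piecewiseC1 0
  rwa [hK' 0] at this

/-! ### Lengths -/

theorem length_polyPath {γ : C(I, ℂ)} (h : PiecewiseC1 γ) {b d : ℝ} {p q : ℂ} (hb : 0 < b)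
    (hbd : b < d) (hd : d < 1) :
    length (polyPath γ b d p q) = length γ + ‖p - γ 1‖ + ‖q - p‖ := by
  set f := ext (polyPath γ b d p q) with hf
  have hint : IntervalIntegrable (fun t => ‖deriv f t‖) MeasureTheory.volume 0 1 :=
    (h.polyPath hb hbd hd).intervalIntegrable.norm
  have hsub : ∀ x y : ℝ, 0 ≤ x → x ≤ y → y ≤ 1 →
      IntervalIntegrable (fun t => ‖deriv f t‖) MeasureTheory.volume x y := fun x y hx hxy hy =>
    hint.mono_set (by
      rw [Set.uIcc_of_le hxy, Set.uIcc_of_le zero_le_one]; exact Set.Icc_subset_Icc hx hy)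
  have hcongr : ∀ x y : ℝ, x ≤ y → ∀ u : ℝ → ℝ, (∀ t ∈ Set.Ioo x y, ‖deriv f t‖ = u t) →
      ∫ t in x..y, ‖deriv f t‖ = ∫ t in x..y, u t := fun x y hxy u hu => by
    rw [intervalIntegral.integral_of_le hxy, intervalIntegral.integral_of_le hxy,
      MeasureTheory.integral_Ioc_eq_integral_Ioo, MeasureTheory.integral_Ioc_eq_integral_Ioo]
    exact MeasureTheory.setIntegral_congr_fun measurableSet_Ioo hu
  have hnear : ∀ x y : ℝ, ∀ g : ℝ → ℂ, (∀ t ∈ Set.Ioo x y, f t = g t) → ∀ t ∈ Set.Ioo x y,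
      deriv f t = deriv g t := fun x y g hg t ht =>
    Filter.EventuallyEq.deriv_eq (eventually_of_mem (Ioo_mem_nhds ht.1 ht.2) hg)
  have e1 : ∫ t in (0 : ℝ)..b, ‖deriv f t‖ = length γ := by
    rw [hcongr 0 b hb.le (fun t => b⁻¹ * ‖deriv (ext γ) (t / b)‖)]
    · rw [intervalIntegral.integral_const_mul, intervalIntegral.integral_comp_div (fun t => ‖deriv (ext γ) t‖) hb.ne', zero_div,
        div_self hb.ne', smul_eq_mul, inv_mul_cancel_left₀ hb.ne']
      rfl
    · intro t ht
      rw [hnear 0 b (fun t => ext γ (b⁻¹ * t)) (fun u hu => ?_) t ht, deriv_comp_mul_left,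
        norm_smul, Real.norm_of_nonneg (inv_pos.2 hb).le, div_eq_inv_mul t]
      rw [hf, ext_polyPath _ _ _ _ _ ⟨hu.1.le, by linarith [hu.2]⟩,
        polyFun_of_le hb hbd hd hu.2.le, inv_mul_eq_div]
  have e2 : ∫ t in b..d, ‖deriv f t‖ = ‖p - γ 1‖ := by
    rw [hcongr b d hbd.le (fun t => ‖p - γ 1‖ / (d - b))]
    · rw [intervalIntegral.integral_const, smul_eq_mul, mul_div_cancel₀ _ (by linarith)]
    · intro t ht
      rw [hnear b d (fun t => γ 1 + ((t - b) / (d - b) : ℝ) * (p - γ 1)) (fun u hu => ?_) t ht,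
        (hasDerivAt_affine _ _ _ _ _).deriv, norm_div, Complex.norm_real,
        Real.norm_of_nonneg (by linarith)]
      rw [hf, ext_polyPath _ _ _ _ _ ⟨by linarith [hu.1], by linarith [hu.2]⟩,
        polyFun_of_mem hb hbd hd ⟨hu.1.le, hu.2.le⟩]
  have e3 : ∫ t in d..1, ‖deriv f t‖ = ‖q - p‖ := by
    rw [hcongr d 1 hd.le (fun t => ‖q - p‖ / (1 - d))]
    · rw [intervalIntegral.integral_const, smul_eq_mul, mul_div_cancel₀ _ (by linarith)]
    · intro t ht
      rw [hnear d 1 (fun t => p + ((t - d) / (1 - d) : ℝ) * (q - p)) (fun u hu => ?_) t ht,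
        (hasDerivAt_affine _ _ _ _ _).deriv, norm_div, Complex.norm_real,
        Real.norm_of_nonneg (by linarith)]
      rw [hf, ext_polyPath _ _ _ _ _ ⟨by linarith [hu.1], by linarith [hu.2]⟩,
        polyFun_of_ge hb hbd hd ⟨hu.1.le, hu.2.le⟩]
  rw [length, ← intervalIntegral.integral_add_adjacent_intervals (hsub 0 d le_rfl (by linarith) hd.le)
    (hsub d 1 (by linarith) hd.le le_rfl), ← intervalIntegral.integral_add_adjacent_intervals
    (hsub 0 b le_rfl hb.le (by linarith)) (hsub b d hb.le hbd.le hd.le), e1, e2, e3]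

/-- After rescaling each moving piece to `[0,1]`, the speed is jointly continuous in the parameters
and the domain of integration is fixed. -/
theorem PiecewiseC1InS.continuous_length {m : C(I × I, ℂ)} (hm : PiecewiseC1InS m) :
    Continuous fun t => length (slice m t) := by
  have hpc := hm.piecewiseC1
  obtain ⟨n, τ, h1, h2, h3, h4, h5⟩ := hm
  choose! D hD hD' using h5
  have hle : ∀ i t, τ i t ≤ τ (i + 1) t := fun i t => h2 t (Nat.le_succ i)
  -- The clamp changes nothing on `[0,1]`; it keeps the argument of `D i` in its domain for all real
  -- `u`.
  have key : ∀ t, length (slice m t) = ∑ i ∈ Finset.range n, ∫ u in (0 : ℝ)..1,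
      (τ (i + 1) t - τ i t) * ‖D i (τ i t + (τ (i + 1) t - τ i t) * clamp u, t)‖ := by
    intro t
    have hsub : IsSubdivision n (fun i => τ i t) := ⟨h2 t, h3 t, h4 t⟩
    have hint := (hpc t).intervalIntegrable.norm
    rw [length, ← h4 t]
    conv_lhs => rw [← h3 t]
    rw [← intervalIntegral.sum_integral_adjacent_intervals (a := fun i => τ i t)]
    · refine Finset.sum_congr rfl fun i hi => ?_
      rw [Finset.mem_range] at hi
      have e1 : ∫ s in τ i t..τ (i + 1) t, ‖deriv (ext (slice m t)) s‖ =
          ∫ s in τ i t..τ (i + 1) t, ‖D i (s, t)‖ := by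
        rw [intervalIntegral.integral_of_le (hle i t), intervalIntegral.integral_of_le (hle i t),
          MeasureTheory.integral_Ioc_eq_integral_Ioo, MeasureTheory.integral_Ioc_eq_integral_Ioo]
        refine MeasureTheory.setIntegral_congr_fun measurableSet_Ioo fun s hs => ?_
        rw [((hD' i hi t s (Set.Ioo_subset_Icc_self hs)).hasDerivAt
          (Icc_mem_nhds hs.1 hs.2)).deriv]
      rw [e1, intervalIntegral.integral_const_mul]
      have e2 := intervalIntegral.smul_integral_comp_add_mul (a := 0) (b := 1)
        (fun s => ‖D i (s, t)‖) (τ (i + 1) t - τ i t) (τ i t)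
      rw [mul_zero, add_zero, mul_one, add_sub_cancel, smul_eq_mul] at e2
      rw [← e2, h4 t]
      congr 1
      refine intervalIntegral.integral_congr fun u hu => ?_
      rw [Set.uIcc_of_le zero_le_one] at hu
      rw [clamp_of_mem hu]
    · intro i hi
      refine hint.mono_set ?_
      rw [Set.uIcc_of_le (hle i t), Set.uIcc_of_le zero_le_one]
      exact Set.Icc_subset_Icc (hsub.nonneg i) (hsub.le_one hi)
  rw [show (fun t => length (slice m t)) = _ from funext key]
  refine continuous_finsetSum _ fun i hi => ?_
  rw [Finset.mem_range] at hi
  refine intervalIntegral.continuous_parametric_intervalIntegral_of_continuous' ?_ 0 1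
  have hc : Continuous fun x : I × ℝ => (τ i x.1 + (τ (i + 1) x.1 - τ i x.1) * clamp x.2, x.1) := by
    have := continuous_clamp
    have := h1 i
    have := h1 (i + 1)
    fun_prop
  have hDc : Continuous fun x : I × ℝ =>
      D i (τ i x.1 + (τ (i + 1) x.1 - τ i x.1) * clamp x.2, x.1) := by
    refine (hD i hi).comp_continuous hc fun x => ?_
    have h6 := clamp_mem x.2
    have h7 := hle i x.1
    exact ⟨by nlinarith [h6.1, h6.2], by nlinarith [h6.1, h6.2]⟩
  have := h1 i
  have := h1 (i + 1)
  exact Continuous.mul (by fun_prop) hDc.norm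


/-! ### Allowed paths followed by two segments -/

theorem add_mul_sub_mem_segment (x y : ℂ) {u : ℝ} (hu : u ∈ I) : x + u * (y - x) ∈ segment ℝ x y := by
  rw [segment_eq_image']
  exact ⟨u, hu, by simp only [Complex.real_smul]⟩

theorem allowedAt_polyPath {c : ℂ} {Ω : DiscreteFilteredSet c} {L : ℝ} (hL : 0 < L) {γ : C(I, ℂ)}
    (h0 : γ 0 = c) (hpc : PiecewiseC1 γ) (hΩ : ∀ s, γ s ∈ Ω L → γ s = c) {b d : ℝ} {p q : ℂ}
    (hb : 0 < b) (hbd : b < d) (hd : d < 1) (hem : Emanates c (polyPath γ b d p q))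
    (hlen : length γ + ‖p - γ 1‖ + ‖q - p‖ < L) (h1 : ∀ w ∈ segment ℝ (γ 1) p, w ∈ Ω L → w = c)
    (h2 : ∀ w ∈ segment ℝ p q, w ∈ Ω L → w = c) : AllowedAt Ω L (polyPath γ b d p q) := by
  rw [allowedAt_iff hL]
  refine ⟨by rw [polyPath_zero hb hbd hd, h0], hpc.polyPath hb hbd hd,
    by rwa [length_polyPath hpc hb hbd hd], hem, fun s hs => ?_⟩
  rcases polyPath_mem (γ := γ) (p := p) (q := q) hb hbd hd s with ⟨t, ht⟩ | h | h
  · rw [ht] at hs ⊢; exact hΩ t hs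
  · exact h1 _ h hs
  · exact h2 _ h hs

theorem emanates_polyPath_of_notMem {c : ℂ} {γ : C(I, ℂ)} (hγ : Emanates c γ) {b d : ℝ} {p q : ℂ}
    (hb : 0 < b) (hbd : b < d) (hd : d < 1) {C : Set ℂ} (hC : Convex ℝ C) (hc : c ∉ C)
    (h1 : γ 1 ∈ C) (hp : p ∈ C) (hq : q ∈ C) : Emanates c (polyPath γ b d p q) := by
  refine emanates_polyPath hb hbd hd hγ (fun u hu h => ?_) (fun u hu h => ?_)
  · exact absurd (h ▸ hC.segment_subset h1 hp (add_mul_sub_mem_segment _ _ hu)) hc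
  · exact absurd (h ▸ hC.segment_subset hp hq (add_mul_sub_mem_segment _ _ hu)) hc

/-- From a path resting at `c`, both segments run outwards along the same line through `c`, so `c`
is not met again once left. -/
theorem emanates_polyPath_radial {c : ℂ} {γ : C(I, ℂ)} (hγ : ∀ s, γ s = c) {b d μ : ℝ} {p z : ℂ}
    (hb : 0 < b) (hbd : b < d) (hd : d < 1) (hμ : μ ∈ I) (hp : p = c + μ * (z - c)) :
    Emanates c (polyPath γ b d p z) := by
  refine emanates_polyPath hb hbd hd (fun s _ _ _ => hγ s) (fun u hu h => ?_) (fun u hu h => ?_)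
  · refine ⟨hγ 1, ?_⟩
    rw [hγ 1] at h
    have h3 : (u : ℂ) * (p - c) = 0 := by linear_combination h
    rcases mul_eq_zero.1 h3 with h3 | h3
    · left; exact_mod_cast h3
    · right; linear_combination h3
  · have h3 : ((μ + u * (1 - μ) : ℝ) : ℂ) * (z - c) = 0 := by
      rw [hp] at h; push_cast; linear_combination h
    rcases mul_eq_zero.1 h3 with h3 | h3
    · have h4 : μ + u * (1 - μ) = 0 := by exact_mod_cast h3
      have h5 : 0 ≤ u * (1 - μ) := mul_nonneg hu.1 (by linarith [hμ.2])
      have h6 : μ = 0 := by linarith [hμ.1]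
      have h7 : u = 0 := by rw [h6] at h4; linarith
      exact ⟨hγ 1, by rw [hp, h6]; simp, Or.inl h7⟩
    · exact ⟨hγ 1, by rw [hp, h3]; simp, Or.inr (by linear_combination h3)⟩

/-- The open half-plane facing `θ` is convex and excludes its boundary point `c`; a segment starting
at `c` and ending inside leaves `c` at once. -/
theorem emanates_polyPath_halfPlane {c : ℂ} {γ : C(I, ℂ)} (hγ : Emanates c γ) {θ b d : ℝ}
    {p z : ℂ} (hb : 0 < b) (hbd : b < d) (hd : d < 1) (h1 : γ 1 = c ∨ 0 < xc θ (γ 1 - c))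
    (hp : 0 < xc θ (p - c) ∨ p = c ∧ γ 1 = c) (hz : 0 < xc θ (z - c)) :
    Emanates c (polyPath γ b d p z) := by
  have hx : ∀ (x y : ℂ) (u : ℝ), x + u * (y - x) = c →
      (1 - u) * xc θ (x - c) + u * xc θ (y - c) = 0 := fun x y u h => by
    have h2 : ((1 - u : ℝ) : ℂ) * (x - c) + (u : ℂ) * (y - c) = 0 := by
      push_cast; linear_combination h
    rw [← xc_ofReal_mul, ← xc_ofReal_mul, ← map_add, h2, map_zero]
  refine emanates_polyPath hb hbd hd hγ (fun u hu h => ?_) (fun u hu h => ?_)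
  · have h3 := hx _ _ _ h
    rcases h1 with h1 | h1
    · refine ⟨h1, ?_⟩
      rcases hp with hp | hp
      · rw [h1, sub_self, map_zero, mul_zero, zero_add] at h3
        exact Or.inl ((mul_eq_zero.1 h3).resolve_right hp.ne')
      · exact Or.inr hp.1
    · rcases hp with hp | hp
      · nlinarith [hu.1, hu.2, mul_nonneg hu.1 hp.le, mul_nonneg (sub_nonneg.2 hu.2) h1.le]
      · rw [hp.2, sub_self, map_zero] at h1
        exact absurd h1 (lt_irrefl _)
  · have h3 := hx _ _ _ h
    rcases hp with hp | hp
    · nlinarith [hu.1, hu.2, mul_nonneg hu.1 hz.le, mul_nonneg (sub_nonneg.2 hu.2) hp.le]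
    · refine ⟨hp.2, hp.1, Or.inl ?_⟩
      rw [hp.1, sub_self, map_zero, mul_zero, zero_add] at h3
      exact (mul_eq_zero.1 h3).resolve_right hz.ne'

/-- Perturbations of an allowed path followed by a segment. -/
theorem eventually_allowedAt_polyPath {c : ℂ} {Ω : DiscreteFilteredSet c} {m : C(I × I, ℂ)}
    (hm : PiecewiseC1InS m) (hall : ∀ t, Allowed Ω (slice m t)) (t₀ : I) {L : ℝ} {z₀ : ℂ}
    (hΩ : ∀ s, m (s, t₀) ∈ Ω L → m (s, t₀) = c)
    (hlen : length (slice m t₀) + ‖z₀ - m (1, t₀)‖ < L)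
    (hseg : ∀ w ∈ segment ℝ (m (1, t₀)) z₀, w ∈ Ω L → w = c) :
    ∃ δ > 0, ∀ᶠ t in 𝓝 t₀, ∀ p' ∈ segment ℝ (m (1, t₀)) z₀, ∀ p, ‖p - p'‖ < δ →
      ∀ q, ‖q - z₀‖ < δ → ∀ b d, 0 < b → b < d → d < 1 →
      (c ∉ segment ℝ (m (1, t₀)) z₀ ∨ Emanates c (polyPath (slice m t) b d p q)) →
      AllowedAt Ω L (polyPath (slice m t) b d p q) := by
  have hL : 0 < L := by linarith [length_nonneg (slice m t₀), norm_nonneg (z₀ - m (1, t₀))]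
  set K := segment ℝ (m (1, t₀)) z₀ with hK
  have hKc : IsCompact K := by
    rw [hK, segment_eq_image']
    exact isCompact_Icc.image (by fun_prop)
  set T : Set ℂ := {w ∈ Ω L | w = c → c ∉ K} with hT
  have hTf : T.Finite := (Ω.finite' L hL).subset fun w hw => hw.1
  obtain ⟨δ₀, hδ₀, hthick⟩ := hKc.exists_thickening_subset_open hTf.isClosed.isOpen_compl
    fun w hw hw' => hw'.2 (hseg w hw hw'.1) (hseg w hw hw'.1 ▸ hw)
  have hconv : Convex ℝ (Metric.thickening δ₀ K) := (convex_segment _ _).thickening _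
  have hth1 : ∀ w ∈ Metric.thickening δ₀ K, w ∈ Ω L → w = c := fun w hw hw' => by
    by_contra h
    exact hthick hw ⟨hw', fun h' => absurd h' h⟩
  have hth2 : c ∉ K → c ∉ Metric.thickening δ₀ K := fun h h' =>
    hthick h' ⟨center_mem Ω hL, fun _ => h⟩
  set η := L - (length (slice m t₀) + ‖z₀ - m (1, t₀)‖) with hη
  have hη0 : 0 < η := by linarith
  -- The length of the slice may grow by `δ` and each of the two segments by `2 δ`; the total stays
  -- below `6 δ ≤ η`.
  refine ⟨min δ₀ (η / 6), lt_min hδ₀ (by linarith), ?_⟩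
  set δ := min δ₀ (η / 6) with hδ
  have hδ0 : 0 < δ := lt_min hδ₀ (by linarith)
  have hδ1 : δ ≤ δ₀ := min_le_left _ _
  have hδ2 : δ ≤ η / 6 := min_le_right _ _
  have hmem : ∀ x ∈ K, ∀ y, ‖y - x‖ < δ → y ∈ Metric.thickening δ₀ K := fun x hx y hy =>
    Metric.mem_thickening_iff.2 ⟨x, hx, by rw [dist_eq_norm]; exact hy.trans_le hδ1⟩
  have ev1 : ∀ᶠ t in 𝓝 t₀, length (slice m t) < length (slice m t₀) + δ :=
    hm.continuous_length.continuousAt.eventually (gt_mem_nhds (by linarith))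
  have ev2 : ∀ᶠ t in 𝓝 t₀, ‖m (1, t) - m (1, t₀)‖ < δ := by
    have hc : Continuous fun t => ‖m (1, t) - m (1, t₀)‖ := by fun_prop
    exact hc.continuousAt.eventually (gt_mem_nhds (by simpa using hδ0))
  have ev3 : ∀ᶠ t in 𝓝 t₀, ∀ s ∈ (Set.univ : Set I), m (s, t) ∈ (Ω L \ {c})ᶜ := by
    refine isCompact_univ.eventually_forall_of_forall_eventually fun s _ => ?_
    have hc : Continuous fun x : I × I => m (x.2, x.1) := by fun_prop
    refine hc.continuousAt.eventually (IsOpen.mem_nhds ?_ ?_)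
    · exact ((Ω.finite' L hL).subset Set.sdiff_subset).isClosed.isOpen_compl
    · exact fun h => h.2 (hΩ s h.1)
  filter_upwards [ev1, ev2, ev3] with t h1 h2 h3 p' hp' p hp q hq b d hb hbd hd hem
  obtain ⟨L', hL', hat⟩ := hall t
  have hat' := (allowedAt_iff hL').1 hat
  have hz₀ : z₀ ∈ K := right_mem_segment ℝ _ _
  have m1 : slice m t 1 ∈ Metric.thickening δ₀ K := hmem _ (left_mem_segment ℝ _ _) _ h2
  have m2 := hmem _ hp' _ hp
  have m3 := hmem _ hz₀ _ hq
  have hdist := dist_add_dist_of_mem_segment hp'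
  rw [dist_eq_norm, dist_eq_norm, dist_eq_norm] at hdist
  refine allowedAt_polyPath hL hat'.1 hat'.2.1 (fun s hs => ?_) hb hbd hd ?_ ?_
    (fun w hw => hth1 w (hconv.segment_subset m1 m2 hw))
    fun w hw => hth1 w (hconv.segment_subset m2 m3 hw)
  · by_contra h
    exact h3 s trivial ⟨hs, h⟩
  · rcases hem with hem | hem
    · exact emanates_polyPath_of_notMem hat'.2.2.2.1 hb hbd hd hconv (hth2 hem) m1 m2 m3
    · exact hem
  · have e1 : ‖p - slice m t 1‖ ≤ ‖p - p'‖ + ‖m (1, t₀) - p'‖ + ‖m (1, t) - m (1, t₀)‖ := by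
      calc ‖p - slice m t 1‖ = ‖(p - p') - (m (1, t₀) - p') - (m (1, t) - m (1, t₀))‖ := by
            rw [slice_apply]; congr 1; ring
        _ ≤ _ := (norm_sub_le _ _).trans (add_le_add_left (norm_sub_le _ _) _)
    have e2 : ‖q - p‖ ≤ ‖q - z₀‖ + ‖p' - z₀‖ + ‖p - p'‖ := by
      calc ‖q - p‖ = ‖(q - z₀) - (p' - z₀) - (p - p')‖ := by congr 1; ring
        _ ≤ _ := (norm_sub_le _ _).trans (add_le_add_left (norm_sub_le _ _) _)
    have e3 : ‖m (1, t₀) - z₀‖ = ‖z₀ - m (1, t₀)‖ := norm_sub_rev _ _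
    linarith

/-- The segment from `t` to `t₀` in the unit interval. -/
noncomputable def lineI (t t₀ : I) : C(I, I) :=
  ⟨fun v => ⟨(1 - v) * t + v * t₀, by
    have := v.2.1; have := v.2.2; have := t.2.1; have := t.2.2; have := t₀.2.1; have := t₀.2.2
    constructor <;> nlinarith⟩, by fun_prop⟩

theorem lineI_zero (t t₀ : I) : lineI t t₀ 0 = t := Subtype.ext (by simp [lineI])

theorem lineI_one (t t₀ : I) : lineI t t₀ 1 = t₀ := Subtype.ext (by simp [lineI])

theorem dist_lineI_le (t t₀ v : I) : dist (lineI t t₀ v) t₀ ≤ dist t t₀ := by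
  rw [Subtype.dist_eq, Subtype.dist_eq, Real.dist_eq, Real.dist_eq]
  have : ((lineI t t₀ v : I) : ℝ) - t₀ = (1 - v) * (t - t₀) := by
    change (1 - (v : ℝ)) * t + v * t₀ - t₀ = _; ring
  rw [this, abs_mul, abs_of_nonneg (by linarith [v.2.2])]
  exact mul_le_of_le_one_left (abs_nonneg _) (by linarith [v.2.1])

/-- The intermediate vertex in the deformation of a path followed by one segment to a path followed
by two segments. -/
noncomputable def vertex (y z₀ z : ℂ) (v : I) : ℂ :=
  (1 - (v : ℝ) : ℝ) * ((y + z) / 2) + (v : ℝ) * z₀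

/-- The deformation of a path followed by one segment to a path followed by two segments. -/
noncomputable def deform (m : C(I × I, ℂ)) (t₀ t : I) (z₀ z : ℂ) (v : I) : C(I, ℂ) :=
  polyPath (slice m (lineI t t₀ v)) (1 / 2 - v / 4) (3 / 4 - v / 4) (vertex (m (1, t)) z₀ z v) z

/-- The homotopy is `deform` itself: it moves the parameter from `t` to `t₀` while the vertex goes
from the midpoint of the segment to `z₀`, the terminal point being fixed. -/
theorem cl_appendSegment_eq {c : ℂ} {Ω : DiscreteFilteredSet c} {m : C(I × I, ℂ)}
    (hm : PiecewiseC1InS m) {t₀ t : I} {z₀ z : ℂ} (hall : ∀ v, Allowed Ω (deform m t₀ t z₀ z v)) :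
    ∃ h h', cl Ω ⟨appendSegment (slice m t) z, h⟩ =
      cl Ω ⟨appendSegment (appendSegment (slice m t₀) z₀) z, h'⟩ := by
  have e0 : deform m t₀ t z₀ z 0 = appendSegment (slice m t) z := by
    rw [deform, lineI_zero, appendSegment_eq, vertex, slice_apply]
    simp
  have e1 : deform m t₀ t z₀ z 1 = appendSegment (appendSegment (slice m t₀) z₀) z := by
    rw [deform, lineI_one, appendSegment_appendSegment_eq, vertex]
    norm_num
  have hb : ∀ v : I, (0 : ℝ) < 1 / 2 - v / 4 := fun v => by linarith [v.2.2]
  have hbd : ∀ v : I, 1 / 2 - (v : ℝ) / 4 < 3 / 4 - v / 4 := fun v => by linarith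
  have hd : ∀ v : I, 3 / 4 - (v : ℝ) / 4 < 1 := fun v => by linarith [v.2.1]
  obtain ⟨K, hK, hK'⟩ := exists_polyFam hm (lineI t t₀) (b := fun v => 1 / 2 - v / 4)
    (d := fun v => 3 / 4 - v / 4) (p := vertex (m (1, t)) z₀ z) (q := fun _ => z)
    (by fun_prop) (by fun_prop) (by unfold vertex; fun_prop) (by fun_prop) hb hbd hd
  have hK2 : ∀ v, slice K v = deform m t₀ t z₀ z v := hK'
  refine ⟨e0 ▸ hall 0, e1 ▸ hall 1, Quot.sound ⟨K, hK, fun v => hK2 v ▸ hall v, ?_, ?_, fun v => ?_⟩⟩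
  · exact (hK2 0).trans e0
  · exact (hK2 1).trans e1
  · rw [← slice_apply, hK', polyPath_one (hb v) (hbd v) (hd v), appendSegment_one]

/-- For nearby data every vertex of the deformation is close to the segment from `m (1, t₀)` to
`z₀`, so all intermediate paths are allowed for the same `L`. If that segment contains `c`, nearness
does not prevent a return to `c`, and this must be supplied separately. -/
theorem eventually_cl_appendSegment_eq {c : ℂ} {Ω : DiscreteFilteredSet c} {m : C(I × I, ℂ)}
    (hm : PiecewiseC1InS m) (hall : ∀ t, Allowed Ω (slice m t)) (t₀ : I) {L : ℝ} {z₀ : ℂ}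
    (hΩ : ∀ s, m (s, t₀) ∈ Ω L → m (s, t₀) = c)
    (hlen : length (slice m t₀) + ‖z₀ - m (1, t₀)‖ < L)
    (hseg : ∀ w ∈ segment ℝ (m (1, t₀)) z₀, w ∈ Ω L → w = c) :
    ∀ᶠ x in 𝓝 (t₀, z₀), (c ∉ segment ℝ (m (1, t₀)) z₀ ∨
      ∀ v, Emanates c (deform m t₀ x.1 z₀ x.2 v)) →
      ∃ h h', cl Ω ⟨appendSegment (slice m x.1) x.2, h⟩ =
        cl Ω ⟨appendSegment (appendSegment (slice m t₀) z₀) x.2, h'⟩ := by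
  have hL : 0 < L := by linarith [length_nonneg (slice m t₀), norm_nonneg (z₀ - m (1, t₀))]
  obtain ⟨δ, hδ, hev⟩ := eventually_allowedAt_polyPath hm hall t₀ hΩ hlen hseg
  obtain ⟨ρ, hρ, hball⟩ := Metric.eventually_nhds_iff.1 hev
  have ev1 : ∀ᶠ x : I × ℂ in 𝓝 (t₀, z₀), x.1 ∈ Metric.ball t₀ ρ :=
    continuous_fst.continuousAt.eventually_mem (Metric.ball_mem_nhds t₀ hρ)
  have ev2 : ∀ᶠ x : I × ℂ in 𝓝 (t₀, z₀), ‖x.2 - z₀‖ < δ := by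
    have hc : Continuous fun x : I × ℂ => ‖x.2 - z₀‖ := by fun_prop
    exact hc.continuousAt.eventually (gt_mem_nhds (by simpa using hδ))
  have ev3 : ∀ᶠ x : I × ℂ in 𝓝 (t₀, z₀), ‖m (1, x.1) - m (1, t₀)‖ < δ := by
    have hc : Continuous fun x : I × ℂ => ‖m (1, x.1) - m (1, t₀)‖ := by fun_prop
    exact hc.continuousAt.eventually (gt_mem_nhds (by simpa using hδ))
  filter_upwards [ev1, ev2, ev3] with x h1 h2 h3 hem
  refine cl_appendSegment_eq hm fun v => ⟨L, hL, ?_⟩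
  refine hball ((dist_lineI_le x.1 t₀ v).trans_lt h1) (vertex (m (1, t₀)) z₀ z₀ v) ?_ _ ?_ x.2 h2 _ _
    (by linarith [v.2.2]) (by linarith) (by linarith [v.2.1]) (hem.imp_right fun h => h v)
  -- The reference vertex sits on the segment at proportion `(1 + v) / 2`.
  · have : vertex (m (1, t₀)) z₀ z₀ v =
        m (1, t₀) + ((1 + v) / 2 : ℝ) * (z₀ - m (1, t₀)) := by
      rw [vertex]; push_cast; ring
    rw [this]
    exact add_mul_sub_mem_segment _ _ ⟨by linarith [v.2.1], by linarith [v.2.2]⟩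
  · have : vertex (m (1, x.1)) z₀ x.2 v - vertex (m (1, t₀)) z₀ z₀ v =
        ((1 - v) / 2 : ℝ) * ((m (1, x.1) - m (1, t₀)) + (x.2 - z₀)) := by
      rw [vertex, vertex]; push_cast; ring
    rw [this, norm_mul, Complex.norm_real, Real.norm_of_nonneg (by linarith [v.2.2])]
    have h4 := norm_add_le (m (1, x.1) - m (1, t₀)) (x.2 - z₀)
    have h5 := norm_nonneg (m (1, x.1) - m (1, t₀) + (x.2 - z₀))
    nlinarith [v.2.1, v.2.2]


/-! ### The topology of the surface -/

theorem AllowedAt.pos {c : ℂ} {Ω : DiscreteFilteredSet c} {L : ℝ} {γ : C(I, ℂ)}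
    (h : AllowedAt Ω L γ) : 0 < L := (length_nonneg γ).trans_lt h.2.2.1

theorem Allowed.piecewiseC1 {c : ℂ} {Ω : DiscreteFilteredSet c} {γ : C(I, ℂ)} (h : Allowed Ω γ) :
    PiecewiseC1 γ := h.choose_spec.2.2.1

theorem appendSegment_segment (γ : C(I, ℂ)) (z : ℂ) {w : ℂ} (hw : w ∈ segment ℝ (γ 1) z) :
    ∃ s, appendSegment γ z s = w := by
  rw [segment_eq_image'] at hw
  obtain ⟨u, hu, rfl⟩ := hw
  refine ⟨⟨(1 + u) / 2, by linarith [hu.1], by linarith [hu.2]⟩, ?_⟩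
  rw [appendSegment_apply]
  simp only [Complex.real_smul]
  split_ifs with h
  · have hu0 : u = 0 := by linarith [hu.1]
    subst hu0
    rw [ext_of_one_le γ (by norm_num)]; simp
  · push_cast; ring

theorem appendSegment_half (γ : C(I, ℂ)) (z : ℂ) (s : I) :
    appendSegment γ z ⟨s / 2, by linarith [s.2.1], by linarith [s.2.2]⟩ = γ s := by
  rw [appendSegment_apply, if_pos (by simp only; linarith [s.2.2]), ← ext_coe]
  congr 1
  simp only
  ring

theorem length_appendSegment {γ : C(I, ℂ)} (h : PiecewiseC1 γ) (z : ℂ) :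
    length (appendSegment γ z) = length γ + ‖z - γ 1‖ := by
  rw [appendSegment_eq, length_polyPath h (by norm_num) (by norm_num) (by norm_num)]
  have e1 : (γ 1 + z) / 2 - γ 1 = (1 / 2 : ℝ) * (z - γ 1) := by push_cast; ring
  have e2 : z - (γ 1 + z) / 2 = (1 / 2 : ℝ) * (z - γ 1) := by push_cast; ring
  rw [e1, e2, norm_mul, Complex.norm_real, Real.norm_of_nonneg (by norm_num)]
  ring

theorem AllowedAt.of_appendSegment {c : ℂ} {Ω : DiscreteFilteredSet c} {L : ℝ} {γ : C(I, ℂ)} {z : ℂ}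
    (hγ : PiecewiseC1 γ) (h : AllowedAt Ω L (appendSegment γ z)) :
    AllowedAt Ω L γ ∧ length γ + ‖z - γ 1‖ < L ∧ ∀ w ∈ segment ℝ (γ 1) z, w ∈ Ω L → w = c := by
  have hL := h.pos
  obtain ⟨h1, h2, h3, h4, h5⟩ := (allowedAt_iff hL).1 h
  rw [length_appendSegment hγ] at h3
  refine ⟨(allowedAt_iff hL).2 ⟨?_, hγ, by linarith [norm_nonneg (z - γ 1)], fun s s' hs hs' => ?_,
    fun s hs => ?_⟩, h3, fun w hw hw' => ?_⟩
  · rw [← appendSegment_half γ z 0, ← h1]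
    congr 1
    exact Subtype.ext (by simp)
  · rw [← appendSegment_half γ z] at hs' ⊢
    exact h4 _ _ (Subtype.mk_le_mk.2 (div_le_div_of_nonneg_right (Subtype.coe_le_coe.2 hs)
      zero_le_two)) hs'
  · rw [← appendSegment_half γ z] at hs ⊢
    exact h5 _ hs
  · obtain ⟨s, rfl⟩ := appendSegment_segment γ z hw
    exact h5 s hw'

/-- An allowed path that ends at `c` is constant. -/
theorem Allowed.eq_center {c : ℂ} {Ω : DiscreteFilteredSet c} {γ : C(I, ℂ)} (h : Allowed Ω γ)
    (h1 : γ 1 = c) (s : I) : γ s = c := h.emanates s 1 unitInterval.le_one' h1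

/-- Away from `c` nearness suffices. A path of the family that ends at `c` is constant, and the
appended segment is then radial. -/
theorem eventually_allowed_appendSegment_fam {c : ℂ} {Ω : DiscreteFilteredSet c} {m : C(I × I, ℂ)}
    (hm : PiecewiseC1InS m) (hall : ∀ t, Allowed Ω (slice m t)) (t₀ : I) :
    ∀ᶠ x in 𝓝 (m (1, t₀), t₀), (m (1, t₀) ≠ c ∨ m (1, x.2) = c) →
      Allowed Ω (appendSegment (slice m x.2) x.1) := by
  obtain ⟨L, hL, hat⟩ := hall t₀
  have hat' := (allowedAt_iff hL).1 hat
  obtain ⟨δ, hδ, hev⟩ := eventually_allowedAt_polyPath hm hall t₀ (z₀ := m (1, t₀)) hat'.2.2.2.2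
    (by rw [sub_self, norm_zero, add_zero]; exact hat'.2.2.1) (by
      intro w hw hw'
      rw [segment_same, Set.mem_singleton_iff] at hw
      subst hw
      exact hat'.2.2.2.2 1 hw')
  rw [segment_same] at hev
  have hc1 : Continuous fun x : ℂ × I => ‖x.1 - m (1, t₀)‖ := by fun_prop
  have hc2 : Continuous fun x : ℂ × I => ‖(m (1, x.2) + x.1) / 2 - m (1, t₀)‖ := by fun_prop
  filter_upwards [continuous_snd.continuousAt.eventually hev,
    hc1.continuousAt.eventually (gt_mem_nhds (by simpa using hδ)),
    hc2.continuousAt.eventually (gt_mem_nhds (by simpa using hδ))] with x h1 h2 h3 h4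
  rw [appendSegment_eq]
  refine ⟨L, hL, h1 _ rfl _ h3 _ h2 _ _ (by norm_num) (by norm_num) (by norm_num) ?_⟩
  rcases h4 with h4 | h4
  · exact Or.inl fun h => h4 (Set.mem_singleton_iff.1 h).symm
  · refine Or.inr (emanates_polyPath_radial (μ := 1 / 2) ((hall x.2).eq_center h4) (by norm_num)
      (by norm_num) (by norm_num) ⟨by norm_num, by norm_num⟩ ?_)
    rw [h4]; push_cast; ring

theorem eventually_allowed_appendSegment {c : ℂ} {Ω : DiscreteFilteredSet c} {γ : C(I, ℂ)}
    (h : Allowed Ω γ) : ∀ᶠ z in 𝓝 (γ 1), Allowed Ω (appendSegment γ z) := by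
  have h1 := eventually_allowed_appendSegment_fam (piecewiseC1InS_constFam h.piecewiseC1)
    (fun _ => h) 0
  have h2 : Continuous fun z : ℂ => (z, (0 : I)) := by fun_prop
  filter_upwards [h2.continuousAt.eventually h1] with z hz
  exact hz (ne_or_eq _ _)

/-- The homotopy parameter ranges over a compact interval, so one neighbourhood of the common end
point serves all stages, and the homotopy extends by the segment to `z`. -/
theorem Homotopic.eventually_cl_appendSegment {c : ℂ} {Ω : DiscreteFilteredSet c}
    {a b : AllowedPath Ω} (h : Homotopic Ω a b) : a.1 1 = b.1 1 ∧
    ∀ᶠ z in 𝓝 (a.1 1), ∃ h h', cl Ω ⟨appendSegment a.1 z, h⟩ = cl Ω ⟨appendSegment b.1 z, h'⟩ := by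
  obtain ⟨H, hH, hall, h0, h1, hend⟩ := h
  refine ⟨by rw [← h1, slice_apply, hend], ?_⟩
  have hev : ∀ᶠ z in 𝓝 (a.1 1), ∀ t ∈ (Set.univ : Set I), Allowed Ω (appendSegment (slice H t) z) := by
    refine isCompact_univ.eventually_forall_of_forall_eventually fun t _ => ?_
    have := eventually_allowed_appendSegment_fam hH hall t
    rw [hend] at this
    filter_upwards [this] with x hx
    exact hx (by rw [hend]; exact ne_or_eq _ _)
  filter_upwards [hev] with z hz
  obtain ⟨K, hK, hK'⟩ := exists_polyFam hH (ContinuousMap.id I) (b := fun _ => 1 / 2)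
    (d := fun _ => 3 / 4) (p := fun t => (slice H t 1 + z) / 2) (q := fun _ => z)
    (by fun_prop) (by fun_prop) (by simp only [slice_apply]; fun_prop) (by fun_prop)
    (fun _ => by norm_num) (fun _ => by norm_num) (fun _ => by norm_num)
  have hK2 : ∀ t, slice K t = appendSegment (slice H t) z := fun t => by
    rw [hK', appendSegment_eq]; rfl
  refine ⟨h0 ▸ hz 0 trivial, h1 ▸ hz 1 trivial, Quot.sound ⟨K, hK, fun t => hK2 t ▸ hz t trivial,
    ?_, ?_, fun t => ?_⟩⟩
  · exact (hK2 0).trans (congrArg (appendSegment · z) h0)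
  · exact (hK2 1).trans (congrArg (appendSegment · z) h1)
  · rw [← slice_apply, hK2, appendSegment_one, appendSegment_one]

/-- Equality in the quotient is the equivalence relation generated by `Homotopic`, so the property
is carried along chains of homotopies. -/
theorem eventually_cl_appendSegment_of_cl_eq {c : ℂ} {Ω : DiscreteFilteredSet c}
    {a b : AllowedPath Ω} (h : cl Ω a = cl Ω b) : a.1 1 = b.1 1 ∧
    ∀ᶠ z in 𝓝 (a.1 1), ∃ h h', cl Ω ⟨appendSegment a.1 z, h⟩ = cl Ω ⟨appendSegment b.1 z, h'⟩ := by
  induction Quot.eqvGen_exact h with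
  | rel a b hab => exact hab.eventually_cl_appendSegment
  | refl a =>
    refine ⟨rfl, ?_⟩
    filter_upwards [eventually_allowed_appendSegment a.2] with z hz
    exact ⟨hz, hz, rfl⟩
  | symm a b hab ih =>
    obtain ⟨h1, h2⟩ := ih (Quot.eqvGen_sound hab)
    refine ⟨h1.symm, ?_⟩
    rw [← h1]
    filter_upwards [h2] with z ⟨h3, h4, h5⟩
    exact ⟨h4, h3, h5.symm⟩
  | trans a b e hab hbe ih1 ih2 =>
    obtain ⟨h1, h2⟩ := ih1 (Quot.eqvGen_sound hab)
    obtain ⟨h3, h4⟩ := ih2 (Quot.eqvGen_sound hbe)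
    refine ⟨h1.trans h3, ?_⟩
    rw [← h1] at h4
    filter_upwards [h2, h4] with z ⟨h5, h6, h7⟩ ⟨h8, h9, h10⟩
    exact ⟨h5, h9, h7.trans h10⟩

theorem vertex_self (z₀ z : ℂ) (v : I) :
    vertex z₀ z₀ z v = z₀ + ((1 - v) / 2 : ℝ) * (z - z₀) := by
  rw [vertex]; push_cast; ring

/-- Going to `z` directly, or through `z₀`, gives the same class for `z` near `z₀`: star-shapedness
keeps the segment to `z₀` inside `V`, where `Ω L` offers no obstacle. -/
theorem eventually_cl_appendSegment_of_sheet {c : ℂ} {Ω : DiscreteFilteredSet c} {γ : C(I, ℂ)}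
    {L r : ℝ} {V : Set ℂ} (hγ : AllowedAt Ω L γ) (hr : length γ + r < L)
    (hstar : StarConvex ℝ (γ 1) V) (hball : V ⊆ Metric.ball (γ 1) r)
    (hVΩ : V ∩ Ω L ⊆ {γ 1}) {z₀ : ℂ} (hz₀ : z₀ ∈ V) :
    ∀ᶠ z in 𝓝 z₀, ∃ h h', cl Ω ⟨appendSegment γ z, h⟩ =
      cl Ω ⟨appendSegment (appendSegment γ z₀) z, h'⟩ := by
  have hL := hγ.pos
  obtain ⟨g0, g1, g2, g3, g4⟩ := (allowedAt_iff hL).1 hγ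
  have hall : Allowed Ω γ := ⟨L, hL, hγ⟩
  have hsub : segment ℝ (γ 1) z₀ ⊆ V := hstar.segment_subset hz₀
  have hVc : ∀ w ∈ V, w ∈ Ω L → w = c := fun w hw hw' => by
    have h3 : w = γ 1 := hVΩ ⟨hw, hw'⟩
    rw [h3] at hw' ⊢
    exact g4 1 hw'
  have hmain := eventually_cl_appendSegment_eq (piecewiseC1InS_constFam g1) (fun _ => hall) 0
    (L := L) (z₀ := z₀) g4 (by
      have := mem_ball_iff_norm.1 (hball hz₀)
      change length γ + ‖z₀ - γ 1‖ < L
      linarith) fun w hw hw' => hVc w (hsub hw) hw'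
  have hcont : Continuous fun z : ℂ => ((0 : I), z) := by fun_prop
  have hmain2 := hcont.continuousAt.eventually hmain
  -- If `γ` ends at `c` it is constant, and not returning to `c` is checked directly: radially when
  -- `z₀ = c`, in the half-plane facing `z₀` otherwise. If not, `V` misses `c`.
  by_cases hc : γ 1 = c
  · have hγc := hall.eq_center hc
    have hdef : ∀ z v, deform (constFam γ) 0 0 z₀ z v =
        polyPath γ (1 / 2 - v / 4) (3 / 4 - v / 4) (vertex c z₀ z v) z := fun z v => by
      rw [← hc]; rfl
    have hb : ∀ v : I, (0 : ℝ) < 1 / 2 - v / 4 := fun v => by linarith [v.2.2]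
    have hbd : ∀ v : I, 1 / 2 - (v : ℝ) / 4 < 3 / 4 - v / 4 := fun v => by linarith
    have hd : ∀ v : I, 3 / 4 - (v : ℝ) / 4 < 1 := fun v => by linarith [v.2.1]
    by_cases hz : z₀ = c
    · filter_upwards [hmain2] with z h2
      refine h2 (Or.inr fun v => ?_)
      rw [hdef, hz, vertex_self]
      exact emanates_polyPath_radial hγc (hb v) (hbd v) (hd v)
        ⟨by linarith [v.2.2], by linarith [v.2.1]⟩ rfl
    · set θ := Complex.arg (z₀ - c) with hθ
      have hx : 0 < xc θ (z₀ - c) := by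
        have h3 : z₀ - c = (‖z₀ - c‖ : ℂ) * dir θ := (Complex.norm_mul_exp_arg_mul_I _).symm
        rw [h3, xc_ofReal_mul, xc_dir, mul_one]
        exact norm_pos_iff.2 (sub_ne_zero.2 hz)
      have hcx : Continuous fun z => xc θ (z - c) := by fun_prop
      filter_upwards [hmain2, hcx.continuousAt.eventually (lt_mem_nhds hx)] with z h2 h3
      refine h2 (Or.inr fun v => ?_)
      rw [hdef]
      refine emanates_polyPath_halfPlane g3 (hb v) (hbd v) (hd v) (Or.inl hc) (Or.inl ?_) h3
      have e : vertex c z₀ z v - c = ((1 - v) / 2 : ℝ) * (z - c) + (v : ℝ) * (z₀ - c) := by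
        rw [vertex]; push_cast; ring
      rw [e, map_add, xc_ofReal_mul, xc_ofReal_mul]
      nlinarith [v.2.1, v.2.2, mul_nonneg v.2.1 hx.le, mul_nonneg (sub_nonneg.2 v.2.2) h3.le]
  · filter_upwards [hmain2] with z h2
    refine h2 (Or.inl fun h => hc ?_)
    exact (hVΩ ⟨hsub h, center_mem Ω hL⟩ : c = γ 1).symm

/-- A neighbourhood of a point of the surface contains the nearby points of the sheets through it. -/
theorem eventually_cl_appendSegment_mem {c : ℂ} {Ω : DiscreteFilteredSet c} {U : Set (Surface Ω)}
    (hU : IsOpen U) (b : AllowedPath Ω) (hb : cl Ω b ∈ U) :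
    ∀ᶠ z in 𝓝 (b.1 1), ∃ h, cl Ω ⟨appendSegment b.1 z, h⟩ ∈ U := by
  induction hU with
  | basic U hU =>
    obtain ⟨a, L, r, V, h1, -, h2, hV, -, h4, h5, h6, rfl⟩ := hU
    obtain ⟨w, hw, h, heq⟩ := hb
    -- Short continuations of `b` have the classes of those of `a` followed by the segment to `w`;
    -- the two segments merge into one, and the class stays in the sheet.
    obtain ⟨e1, e2⟩ := eventually_cl_appendSegment_of_cl_eq heq
    simp only [appendSegment_one] at e1
    rw [e1] at e2 ⊢
    filter_upwards [e2, eventually_cl_appendSegment_of_sheet h1 h2 h4 h5 h6 hw,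
      hV.mem_nhds hw] with z ⟨h7, h8, h9⟩ ⟨h10, h11, h12⟩ hz
    exact ⟨h7, z, hz, h10, h9.trans h12.symm⟩
  | univ =>
    filter_upwards [eventually_allowed_appendSegment b.2] with z hz
    exact ⟨hz, trivial⟩
  | inter s t _ _ ih1 ih2 =>
    filter_upwards [ih1 hb.1, ih2 hb.2] with z ⟨h1, h2⟩ ⟨_, h3⟩
    exact ⟨h1, h2, h3⟩
  | sUnion S _ ih =>
    obtain ⟨s, hs, hbs⟩ := hb
    filter_upwards [ih s hs hbs] with z ⟨h1, h2⟩
    exact ⟨h1, s, hs, h2⟩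

/-- The projection of the surface is an open map. -/
theorem eventually_of_eventually_proj {c : ℂ} {Ω : DiscreteFilteredSet c} {ζ : Surface Ω}
    {P : ℂ → Prop} (h : ∀ᶠ ξ in 𝓝 ζ, P (proj Ω ξ)) : ∀ᶠ z in 𝓝 (proj Ω ζ), P z := by
  obtain ⟨U, hU, hUo, hζ⟩ := eventually_nhds_iff.1 h
  obtain ⟨b, rfl⟩ := Quot.exists_rep ζ
  filter_upwards [eventually_cl_appendSegment_mem hUo b hζ] with z ⟨h1, h2⟩
  have h3 := hU _ h2
  have h4 : proj Ω (cl Ω ⟨appendSegment b.1 z, h1⟩) = z := appendSegment_one b.1 z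
  rwa [h4] at h3

/-! ### Continuation along liftable paths, and a criterion for lifts -/

/-- The germ at time `s` is the local expression of `Φ` at the lifted point. Two local expressions
agree on a neighbourhood in the surface, hence, the projection being open, on a neighbourhood in the
plane. -/
theorem ContinuableTo.continuableAlong {c : ℂ} {Ω : DiscreteFilteredSet c} {φ : ℂ → ℂ}
    (hφ : ContinuableTo Ω φ) {γ : C(I, ℂ)} (hγ : Liftable Ω γ) : ContinuableAlong φ γ := by
  obtain ⟨-, Φ, hΦ, hbase⟩ := hφ
  obtain ⟨Λ, h0, hproj⟩ := hγ
  choose g hg1 hg2 using hΦ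
  refine ⟨fun s => g (Λ s), fun s => hproj s ▸ hg1 (Λ s), ?_, fun s => ?_⟩
  · rw [← hproj 0]
    simp only [h0]
    refine eventually_of_eventually_proj (P := fun z => g (base Ω) z = φ z) ?_
    filter_upwards [hbase, hg2 (base Ω)] with ξ h1 h2
    rw [← h1, ← h2]
  · filter_upwards [Λ.continuous.continuousAt.eventually (hg2 (Λ s)).eventually_nhds] with s' hs'
    rw [← hproj s']
    refine eventually_of_eventually_proj (P := fun z => g (Λ s') z = g (Λ s) z) ?_
    filter_upwards [hs', hg2 (Λ s')] with ξ h1 h2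
    rw [← h1, ← h2]

/-- A criterion for the continuity of a path of the surface. -/
theorem continuous_cl_appendSegment {c : ℂ} {Ω : DiscreteFilteredSet c} (θ : ℝ) {m : C(I × I, ℂ)}
    (hm : PiecewiseC1InS m) (z : C(I, ℂ)) (hall : ∀ t, Allowed Ω (appendSegment (slice m t) (z t)))
    (hm0 : ∀ s, m (s, 0) = c) (hz0 : z 0 = c) (hm1 : ∀ t, 0 < t → 0 < xc θ (m (1, t) - c))
    (hz1 : ∀ t, 0 < t → 0 < xc θ (z t - c)) :
    Continuous fun t => cl Ω ⟨appendSegment (slice m t) (z t), hall t⟩ := by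
  have hsl : ∀ t, Allowed Ω (slice m t) := fun t => by
    obtain ⟨L, hL, h⟩ := hall t
    exact ⟨L, hL, (h.of_appendSegment (hm.piecewiseC1 t)).1⟩
  refine continuous_iff_continuousAt.2 fun t₀ => ?_
  rw [ContinuousAt, tendsto_nhds]
  intro U hU hmem
  obtain ⟨L, hL, hat⟩ := hall t₀
  obtain ⟨h1, h2, h3⟩ := hat.of_appendSegment (hm.piecewiseC1 t₀)
  have hev := eventually_cl_appendSegment_eq hm hsl t₀ ((allowedAt_iff hL).1 h1).2.2.2.2 h2 h3
  have hcz : Continuous fun t => (t, z t) := by fun_prop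
  have hev2 := eventually_cl_appendSegment_mem hU _ hmem
  rw [appendSegment_one] at hev2
  filter_upwards [hcz.continuousAt.eventually hev, z.continuous.continuousAt.eventually hev2] with
    t h4 ⟨h5, h6⟩
  -- For `t₀ > 0` the half-plane condition keeps the segment away from `c`. For `t₀ = 0` it is the
  -- point `c`, and the half-plane condition on the nearby paths prevents a return.
  suffices h : c ∉ segment ℝ (m (1, t₀)) (z t₀) ∨ t = t₀ ∨
      ∀ v, Emanates c (deform m t₀ t (z t₀) (z t) v) by
    rcases h with h | rfl | h
    · obtain ⟨h7, h8, h9⟩ := h4 (Or.inl h)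
      exact (h9 ▸ h6 : cl Ω ⟨appendSegment (slice m t) (z t), h7⟩ ∈ U)
    · exact hmem
    · obtain ⟨h7, h8, h9⟩ := h4 (Or.inr h)
      exact (h9 ▸ h6 : cl Ω ⟨appendSegment (slice m t) (z t), h7⟩ ∈ U)
  rcases eq_or_lt_of_le (show 0 ≤ t₀ from t₀.2.1) with h0 | h0
  · subst h0
    rcases eq_or_lt_of_le (show 0 ≤ t from t.2.1) with ht | ht
    · exact Or.inr (Or.inl ht.symm)
    · refine Or.inr (Or.inr fun v => ?_)
      have hline : ((lineI t 0 v : I) : ℝ) = (1 - v) * t := by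
        change (1 - (v : ℝ)) * t + v * ((0 : I) : ℝ) = _; simp
      have htpos : (0 : ℝ) < t := ht
      have hx := hm1 t ht
      have hx2 := hz1 t ht
      rw [deform, hz0]
      refine emanates_polyPath_halfPlane (hsl _).emanates (θ := θ) (by linarith [v.2.2])
        (by linarith) (by linarith [v.2.1]) ?_ ?_ hx2
      · rcases eq_or_lt_of_le (show 0 ≤ lineI t 0 v from (lineI t 0 v).2.1) with h | h
        · left; rw [← h]; exact hm0 1
        · right; exact hm1 _ h
      · rcases eq_or_lt_of_le v.2.2 with h | h
        · right
          have hv : v = 1 := Subtype.ext h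
          subst hv
          rw [lineI_one]
          exact ⟨by rw [vertex]; simp, hm0 1⟩
        · left
          have e : vertex (m (1, t)) c (z t) v - c =
              ((1 - v) / 2 : ℝ) * ((m (1, t) - c) + (z t - c)) := by
            rw [vertex]; push_cast; ring
          rw [e, xc_ofReal_mul, map_add]
          exact mul_pos (by linarith) (by linarith)
  · left
    intro h
    rw [segment_eq_image'] at h
    obtain ⟨u, hu, h⟩ := h
    have h7 : ((1 - u : ℝ) : ℂ) * (m (1, t₀) - c) + (u : ℂ) * (z t₀ - c) = 0 := by
      simp only [Complex.real_smul] at h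
      push_cast; linear_combination h
    have h8 := congrArg (xc θ) h7
    rw [map_add, xc_ofReal_mul, xc_ofReal_mul, map_zero] at h8
    have hx := hm1 t₀ h0
    have hx2 := hz1 t₀ h0
    nlinarith [hu.1, hu.2, mul_nonneg hu.1 hx2.le, mul_nonneg (sub_nonneg.2 hu.2) hx.le]


theorem allowedAt_appendSegment {c : ℂ} {Ω : DiscreteFilteredSet c} {L θ : ℝ} (hL : 0 < L)
    {γ : C(I, ℂ)} {z : ℂ} (h0 : γ 0 = c) (hpc : PiecewiseC1 γ) (hem : Emanates c γ)
    (hΩ : ∀ s, γ s ∈ Ω L → γ s = c) (h1 : 0 < xc θ (γ 1 - c)) (hz : 0 < xc θ (z - c))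
    (hlen : length γ + ‖z - γ 1‖ < L) (hseg : ∀ w ∈ segment ℝ (γ 1) z, w ∈ Ω L → w = c) :
    AllowedAt Ω L (appendSegment γ z) := by
  have hmid : (γ 1 + z) / 2 = γ 1 + ((1 / 2 : ℝ) : ℂ) * (z - γ 1) := by push_cast; ring
  have hmem : (γ 1 + z) / 2 ∈ segment ℝ (γ 1) z := by
    rw [hmid]; exact add_mul_sub_mem_segment _ _ ⟨by norm_num, by norm_num⟩
  have e1 : (γ 1 + z) / 2 - γ 1 = (1 / 2 : ℝ) * (z - γ 1) := by push_cast; ring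
  have e2 : z - (γ 1 + z) / 2 = (1 / 2 : ℝ) * (z - γ 1) := by push_cast; ring
  have e3 : (γ 1 + z) / 2 - c = (1 / 2 : ℝ) * ((γ 1 - c) + (z - c)) := by push_cast; ring
  rw [appendSegment_eq]
  refine allowedAt_polyPath hL h0 hpc hΩ (by norm_num) (by norm_num) (by norm_num)
    (emanates_polyPath_halfPlane hem (θ := θ) (by norm_num) (by norm_num) (by norm_num) (Or.inr h1)
      (Or.inl ?_) hz) ?_ (fun w hw => hseg w ((convex_segment _ _).segment_subset
      (left_mem_segment ℝ _ _) hmem hw)) fun w hw => hseg w ((convex_segment _ _).segment_subset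
      hmem (right_mem_segment ℝ _ _) hw)
  · rw [e3, xc_ofReal_mul, map_add]
    linarith
  · rw [e1, e2, norm_mul, Complex.norm_real, Real.norm_of_nonneg (by norm_num)]
    linarith

/-! ### Flattened paths -/

/-- The real linear map that multiplies the coordinate transverse to `e^{iθ}` by `κ`. -/
noncomputable def flat (θ κ : ℝ) : ℂ →L[ℝ] ℂ :=
  (xc θ).smulRight (dir θ) + κ • (yc θ).smulRight (Complex.I * dir θ)

theorem flat_apply (θ κ : ℝ) (w : ℂ) :
    flat θ κ w = xc θ w * dir θ + ((κ * yc θ w : ℝ) : ℂ) * (Complex.I * dir θ) := by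
  simp only [flat, add_apply, smul_apply,
    ContinuousLinearMap.smulRight_apply, Complex.real_smul]
  push_cast; ring

theorem xc_add_I_dir (θ a b : ℝ) : xc θ (a * dir θ + b * (Complex.I * dir θ)) = a := by
  rw [map_add, xc_ofReal_mul, xc_ofReal_mul, xc_dir, xc_I_dir]; ring

theorem yc_add_I_dir (θ a b : ℝ) : yc θ (a * dir θ + b * (Complex.I * dir θ)) = b := by
  rw [map_add, yc_ofReal_mul, yc_ofReal_mul, yc_dir, yc_I_dir]; ring

theorem xc_flat (θ κ : ℝ) (w : ℂ) : xc θ (flat θ κ w) = xc θ w := by rw [flat_apply, xc_add_I_dir]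

theorem yc_flat (θ κ : ℝ) (w : ℂ) : yc θ (flat θ κ w) = κ * yc θ w := by
  rw [flat_apply, yc_add_I_dir]

theorem norm_flat_le {θ κ : ℝ} (hκ : κ ∈ I) (w : ℂ) : ‖flat θ κ w‖ ≤ ‖w‖ := by
  refine abs_le_of_sq_le_sq' ?_ (norm_nonneg _) |>.2
  rw [norm_sq_coord θ, norm_sq_coord θ, xc_flat, yc_flat, mul_pow]
  nlinarith [mul_le_one₀ hκ.2 hκ.1 hκ.2, sq_nonneg (yc θ w)]

theorem norm_le_coord (θ : ℝ) (w : ℂ) : ‖w‖ ≤ |xc θ w| + |yc θ w| := by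
  refine abs_le_of_sq_le_sq' ?_ (by positivity) |>.2
  rw [norm_sq_coord θ, add_sq, sq_abs, sq_abs]
  linarith [mul_nonneg (abs_nonneg (xc θ w)) (abs_nonneg (yc θ w))]

/-- The paths that follow a flattening of `γ` and a bump up to the time `t` and then rest. -/
noncomputable def flatFam (θ : ℝ) (γ : C(I, ℂ)) (κ : C(I, ℝ)) (ε : ℝ) : C(I × I, ℂ) :=
  ⟨fun x => flat θ (κ x.2) (γ (min x.1 x.2)) +
    ((ε * ((min x.1 x.2 : I) * (x.2 - (min x.1 x.2 : I))) : ℝ) : ℂ) * (Complex.I * dir θ), by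
    simp only [flat_apply]; fun_prop⟩

section flatFam

variable {θ : ℝ} {γ : C(I, ℂ)} {κ : C(I, ℝ)} {ε : ℝ}

theorem xc_flatFam (s t : I) : xc θ (flatFam θ γ κ ε (s, t)) = xc θ (γ (min s t)) := by
  change xc θ (flat θ (κ t) (γ (min s t)) + _) = _
  rw [map_add, xc_flat, xc_ofReal_mul, xc_I_dir]; ring

theorem yc_flatFam (s t : I) : yc θ (flatFam θ γ κ ε (s, t)) =
    κ t * yc θ (γ (min s t)) + ε * ((min s t : I) * (t - (min s t : I))) := by
  change yc θ (flat θ (κ t) (γ (min s t)) + _) = _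
  rw [map_add, yc_flat, yc_ofReal_mul, yc_I_dir]; ring

theorem ext_flatFam_of_le (t : I) {u : ℝ} (hu : u ∈ Set.Icc (0 : ℝ) t) :
    ext (slice (flatFam θ γ κ ε) t) u = flat θ (κ t) (ext γ u) +
      ((ε * (u * (t - u)) : ℝ) : ℂ) * (Complex.I * dir θ) := by
  have hu' : u ∈ I := ⟨hu.1, hu.2.trans t.2.2⟩
  have hmin : min (⟨u, hu'⟩ : I) t = ⟨u, hu'⟩ := min_eq_left hu.2
  rw [ext_of_mem _ hu', ext_of_mem _ hu', slice_apply]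
  change flat θ (κ t) (γ (min _ t)) + _ = _
  simp only [hmin]

theorem ext_flatFam_of_ge (t : I) {u : ℝ} (hu : u ∈ Set.Icc (t : ℝ) 1) :
    ext (slice (flatFam θ γ κ ε) t) u = flat θ (κ t) (γ t) := by
  have hu' : u ∈ I := ⟨t.2.1.trans hu.1, hu.2⟩
  have hmin : min (⟨u, hu'⟩ : I) t = t := min_eq_right hu.1
  rw [ext_of_mem _ hu', slice_apply]
  change flat θ (κ t) (γ (min _ t)) + _ = _
  simp only [hmin]
  simp

theorem flatFam_one (t : I) : flatFam θ γ κ ε (1, t) = flat θ (κ t) (γ t) := by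
  have h := ext_flatFam_of_ge (θ := θ) (γ := γ) (κ := κ) (ε := ε) t (u := 1) ⟨t.2.2, le_rfl⟩
  rwa [ext_of_mem _ ⟨zero_le_one, le_rfl⟩] at h

/-- The break points are `min (τ i) t` and a final `1`: on the last piece the path rests. -/
theorem piecewiseC1InS_flatFam (hγ : PiecewiseC1 γ) : PiecewiseC1InS (flatFam θ γ κ ε) := by
  obtain ⟨n, τ, hτ, hd⟩ := piecewiseC1_iff.1 hγ
  refine ⟨n + 1, fun i t => if i ≤ n then min (τ i) t else 1, fun i => ?_,
    fun t => monotone_nat_of_le_succ fun i => ?_, fun t => ?_, fun t => ?_, fun i hi => ?_⟩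
  · dsimp only
    split_ifs <;> fun_prop
  · dsimp only
    rcases lt_trichotomy i n with h | rfl | h
    · rw [if_pos h.le, if_pos (by omega)]
      exact min_le_min_right _ (hτ.mono (Nat.le_succ i))
    · rw [if_pos le_rfl, if_neg (by omega)]
      exact (min_le_right _ _).trans t.2.2
    · rw [if_neg (by omega), if_neg (by omega)]
  · simp only [zero_le, if_true, hτ.zero]
    exact min_eq_left t.2.1
  · simp
  · rcases lt_or_eq_of_le (Nat.lt_succ_iff.1 hi) with h | rfl
    · obtain ⟨g, hg⟩ := hd i h
      simp only [if_pos h.le, if_pos (show i + 1 ≤ n by omega)]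
      have hle : τ i ≤ τ (i + 1) := hτ.mono (Nat.le_succ i)
      -- The projection extends `g` continuously beyond its piece.
      refine ⟨fun x => flat θ (κ x.2) (g (Set.projIcc (τ i) (τ (i + 1)) hle x.1)) +
        ((ε * (x.2 - 2 * x.1) : ℝ) : ℂ) * (Complex.I * dir θ), ?_, fun t s hs => ?_⟩
      · have hgc : Continuous fun x : ℝ × I => g (Set.projIcc (τ i) (τ (i + 1)) hle x.1) :=
          hg.1.comp_continuous (continuous_subtype_val.comp (continuous_projIcc.comp continuous_fst))
            fun x => Subtype.coe_prop _
        simp only [flat_apply]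
        have hx : Continuous fun x : ℝ × I =>
            xc θ (g (Set.projIcc (τ i) (τ (i + 1)) hle x.1)) := (xc θ).continuous.comp hgc
        have hy : Continuous fun x : ℝ × I =>
            yc θ (g (Set.projIcc (τ i) (τ (i + 1)) hle x.1)) := (yc θ).continuous.comp hgc
        refine Continuous.continuousOn ?_
        fun_prop
      -- When `t ≤ τ i` both ends of the piece equal `t`, and nothing has to be proved.
      · rcases le_or_gt (t : ℝ) (τ i) with ht | ht
        · have hba : min (τ (i + 1)) (t : ℝ) ≤ min (τ i) t := by
            rw [min_eq_right ht, min_eq_right (ht.trans hle)]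
          exact (pieceDeriv_of_le hba (fun s => flat θ (κ t) (g (Set.projIcc (τ i) (τ (i + 1)) hle s)) +
            ((ε * (t - 2 * s) : ℝ) : ℂ) * (Complex.I * dir θ))).2 s hs
        · rw [min_eq_left ht.le] at hs ⊢
          have hsub : Set.Icc (τ i) (min (τ (i + 1)) t) ⊆ Set.Icc (τ i) (τ (i + 1)) :=
            Set.Icc_subset_Icc le_rfl (min_le_left _ _)
          have h1 := (hg.2 s (hsub hs)).mono hsub
          have h2 := ((flat θ (κ t)).hasFDerivAt.comp_hasDerivWithinAt s h1).add
            (hasDerivAt_bump θ ε t s).hasDerivWithinAt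
          have heq : ∀ u ∈ Set.Icc (τ i) (min (τ (i + 1)) (t : ℝ)),
              ext (slice (flatFam θ γ κ ε) t) u = flat θ (κ t) (ext γ u) +
                ((ε * (u * (t - u)) : ℝ) : ℂ) * (Complex.I * dir θ) := fun u hu =>
            ext_flatFam_of_le t ⟨(hτ.nonneg i).trans hu.1, hu.2.trans (min_le_right _ _)⟩
          refine (h2.congr heq (heq s hs)).congr_deriv ?_
          simp only [Set.projIcc_of_mem hle (hsub hs)]
    · have hmin : ∀ t : I, min (τ i) (t : ℝ) = t := fun t => by
        rw [hτ.one]; exact min_eq_right t.2.2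
      simp only [if_pos le_rfl, if_neg (show ¬ i + 1 ≤ i by omega), hmin]
      refine ⟨fun _ => 0, continuousOn_const, fun t s hs => ?_⟩
      exact (hasDerivWithinAt_const s _ (flat θ (κ t) (γ t))).congr
        (fun u hu => ext_flatFam_of_ge t hu) (ext_flatFam_of_ge t hs)

theorem exists_finite_deriv_flatFam (hγ : PiecewiseC1 γ) (t : I) : ∃ S : Set ℝ, S.Finite ∧
    ∀ s ∈ Set.Ioo (0 : ℝ) 1 \ S, HasDerivAt (ext γ) (deriv (ext γ) s) s ∧
      (s < t ∧ deriv (ext (slice (flatFam θ γ κ ε) t)) s = flat θ (κ t) (deriv (ext γ) s) +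
        ((ε * (t - 2 * s) : ℝ) : ℂ) * (Complex.I * dir θ) ∨
      deriv (ext (slice (flatFam θ γ κ ε) t)) s = 0) := by
  obtain ⟨S, hS, hd⟩ := hγ.exists_finite
  refine ⟨S ∪ {(t : ℝ)}, hS.union (Set.finite_singleton _), fun s hs => ?_⟩
  have hsS : s ∉ S := fun h => hs.2 (Or.inl h)
  have hst : s ≠ t := fun h => hs.2 (Or.inr h)
  have h1 := hd s ⟨hs.1, hsS⟩
  refine ⟨h1, ?_⟩
  rcases lt_or_gt_of_ne hst with h | h
  · left
    refine ⟨h, ?_⟩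
    have h2 := ((flat θ (κ t)).hasFDerivAt.comp_hasDerivAt s h1).add (hasDerivAt_bump θ ε t s)
    refine (h2.congr_of_eventuallyEq ?_).deriv
    filter_upwards [Ioo_mem_nhds hs.1.1 h] with u hu
    exact ext_flatFam_of_le t ⟨hu.1.le, hu.2.le⟩
  · right
    refine ((hasDerivAt_const s (flat θ (κ t) (γ t))).congr_of_eventuallyEq ?_).deriv
    filter_upwards [Ioo_mem_nhds h hs.1.2] with u hu
    exact ext_flatFam_of_ge t ⟨hu.1.le, hu.2.le⟩

theorem abs_sub_two_mul_le {s : ℝ} {t : I} (hs : 0 ≤ s) (hst : s ≤ t) : |(t : ℝ) - 2 * s| ≤ 1 :=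
  abs_le.2 ⟨by linarith [t.2.2], by linarith [t.2.2]⟩

theorem length_flatFam_le (hγ : PiecewiseC1 γ) (t : I) (hκ : κ t ∈ I) (hε : 0 ≤ ε) :
    length (slice (flatFam θ γ κ ε) t) ≤ length γ + ε := by
  obtain ⟨S, hS, hd⟩ := exists_finite_deriv_flatFam (θ := θ) (κ := κ) (ε := ε) hγ t
  have hint := hγ.intervalIntegrable.norm
  refine (length_le_integral ((piecewiseC1InS_flatFam hγ).piecewiseC1 t)
    (u := fun s => ‖deriv (ext γ) s‖ + ε) (hint.add intervalIntegrable_const) hS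
    fun s hs => ?_).trans_eq ?_
  · rcases (hd s hs).2 with ⟨h1, h2⟩ | h2
    · rw [h2]
      refine (norm_add_le _ _).trans (add_le_add (norm_flat_le hκ _) ?_)
      rw [norm_mul, norm_I_dir, mul_one, Complex.norm_real, Real.norm_eq_abs, abs_mul,
        abs_of_nonneg hε]
      exact mul_le_of_le_one_right hε (abs_sub_two_mul_le hs.1.1.le h1.le)
    · rw [h2, norm_zero]; positivity
  · rw [intervalIntegral.integral_add hint intervalIntegrable_const]
    simp [length]

/-- The speed is at most `x' + |y'|`. Since `x' ≥ 0`, its integral is just the abscissa reached,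
while the transverse part costs at most `κ` times the length of `γ`, plus the bump. So strong
flattening makes the length nearly the distance along the ray. -/
theorem length_flatFam_le_xc {α L : ℝ} (hα : α ∈ Set.Ioo 0 (Real.pi / 2))
    (hγ : IsForward 0 θ α L γ) (t : I) (hκ : 0 ≤ κ t) (hε : 0 ≤ ε) :
    length (slice (flatFam θ γ κ ε) t) ≤ xc θ (γ t) + κ t * length γ + ε := by
  have hpc := hγ.2.1
  obtain ⟨S, hS, hd⟩ := exists_finite_deriv_flatFam (θ := θ) (κ := κ) (ε := ε) hpc t
  have hpc' := (piecewiseC1InS_flatFam (θ := θ) (κ := κ) (ε := ε) hpc).piecewiseC1 t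
  set m := slice (flatFam θ γ κ ε) t with hm
  have hint := hpc.intervalIntegrable.norm
  have hint' := hpc'.intervalIntegrable
  have hxint : IntervalIntegrable (fun s => xc θ (deriv (ext m) s)) MeasureTheory.volume 0 1 :=
    ⟨(xc θ).integrable_comp hint'.1, (xc θ).integrable_comp hint'.2⟩
  have hint2 := hint.const_mul (κ t)
  refine (length_le_integral hpc'
    (u := fun s => xc θ (deriv (ext m) s) + (κ t * ‖deriv (ext γ) s‖ + ε))
    (hxint.add (hint2.add intervalIntegrable_const)) hS fun s hs => ?_).trans_eq ?_
  · obtain ⟨h1, h2⟩ := hd s hs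
    have hx : 0 ≤ xc θ (deriv (ext γ) s) := by
      have h3 := hγ.2.2.2.1 s ⟨hs.1.1.le, hs.1.2⟩
      rw [h1.hasDerivWithinAt.derivWithin (uniqueDiffWithinAt_Ici s)] at h3
      exact ((mem_cone_iff hα).1 h3).1.le
    rcases h2 with ⟨h2, h3⟩ | h3
    · refine (norm_le_coord θ _).trans ?_
      rw [h3, map_add, map_add, xc_flat, yc_flat, xc_ofReal_mul, yc_ofReal_mul, xc_I_dir, yc_I_dir,
        mul_zero, add_zero, mul_one, abs_of_nonneg hx]
      refine add_le_add le_rfl ((abs_add_le _ _).trans (add_le_add ?_ ?_))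
      · rw [abs_mul, abs_of_nonneg hκ]
        exact mul_le_mul_of_nonneg_left (abs_yc_le_norm _ _) hκ
      · rw [abs_mul, abs_of_nonneg hε]
        exact mul_le_of_le_one_right hε (abs_sub_two_mul_le hs.1.1.le h2.le)
    · rw [h3, map_zero, norm_zero]; positivity
  · rw [intervalIntegral.integral_add hxint (hint2.add intervalIntegrable_const),
      intervalIntegral.integral_add hint2 intervalIntegrable_const,
      intervalIntegral.integral_const_mul, (xc θ).intervalIntegral_comp_comm hint']
    obtain ⟨S', hS', hd'⟩ := hpc'.exists_finite
    rw [MeasureTheory.integral_eq_of_hasDerivAt_off_countable_of_le _ _ zero_le_one hS'.countable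
      (continuous_ext m).continuousOn hd' hint']
    have e1 : ext m 1 = flatFam θ γ κ ε (1, t) := by
      rw [ext_of_mem m ⟨zero_le_one, le_rfl⟩]; rfl
    have e0 : ext m 0 = flatFam θ γ κ ε (0, t) := by
      rw [ext_of_mem m ⟨le_rfl, zero_le_one⟩]; rfl
    have hmin : min (0 : I) t = 0 := min_eq_left t.2.1
    rw [map_sub, e1, e0, xc_flatFam, xc_flatFam, hmin, hγ.1, map_zero,
      min_eq_right unitInterval.le_one']
    simp only [length, intervalIntegral.integral_const, sub_zero, smul_eq_mul, one_mul]
    ring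

end flatFam


/-! ### The set of glimpsed points of a discrete filtered set -/

/-- The points `w` of the ray that belong to `Ω L` for all `L > ‖w‖`. -/
def persistent (Ω : DiscreteFilteredSet 0) (θ : ℝ) : Set ℂ :=
  {w | w ∈ ray 0 θ ∧ ∀ L : ℝ, ‖w‖ < L → w ∈ Ω L}

theorem persistent_subset_ray (Ω : DiscreteFilteredSet 0) (θ : ℝ) : persistent Ω θ ⊆ ray 0 θ :=
  fun _ h => h.1

theorem persistent_inter_ball_subset (Ω : DiscreteFilteredSet 0) (θ L : ℝ) :
    persistent Ω θ ∩ Metric.ball 0 L ⊆ onRay Ω θ L := fun w hw => by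
  have h := mem_ball_zero_iff.1 hw.2
  exact (mem_onRay_iff w).2 ⟨hw.1.2 L h, hw.1.1, h⟩

theorem finite_persistent_inter_ball (Ω : DiscreteFilteredSet 0) (θ L : ℝ) :
    (persistent Ω θ ∩ Metric.ball 0 L).Finite := by
  rcases le_or_gt L 0 with hL | hL
  · rw [Metric.ball_eq_empty.2 hL, Set.inter_empty]
    exact Set.finite_empty
  · exact (Ω.finite' L hL).subset fun w hw => (persistent_inter_ball_subset Ω θ L hw).1

/-- The finitely many points of `Ω L` off the ray have a positive least angular distance to it. -/
theorem exists_isAngle (Ω : DiscreteFilteredSet 0) (θ : ℝ) {L : ℝ} (hL : 0 < L) :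
    ∃ α, IsAngle Ω θ L α := by
  have hfin : {z | z ∈ Ω L ∧ z ∉ ray 0 θ}.Finite := (Ω.finite' L hL).subset fun z hz => hz.1
  -- The value `1` is a default for points with nonpositive abscissa, which no cone under
  -- consideration contains.
  obtain ⟨ε, hε, h⟩ := exists_pos_forall_lt hfin
    (v := fun z => if 0 < xc θ z then Real.arctan (|yc θ z| / xc θ z) else 1) (by
      rintro z ⟨-, hz⟩
      split_ifs with hx
      · have hy : yc θ z ≠ 0 := fun hy => hz ((mem_ray_iff z).2 ⟨hx, hy⟩)
        exact Real.arctan_pos.2 (div_pos (abs_pos.2 hy) hx)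
      · exact one_pos)
  have hpi := Real.pi_pos
  have hα : min ε (Real.pi / 4) ∈ Set.Ioo 0 (Real.pi / 2) :=
    ⟨lt_min hε (by linarith), (min_le_right _ _).trans_lt (by linarith)⟩
  refine ⟨min ε (Real.pi / 4), hα, Set.ext fun z => ?_⟩
  rw [mem_onRay_iff, Set.mem_inter_iff, mem_sector_iff]
  constructor
  · rintro ⟨h1, h2, h3⟩
    refine ⟨h1, ?_, h3⟩
    by_contra hz
    obtain ⟨hx, hy⟩ := (mem_cone_iff hα).1 h2
    have h4 := h z ⟨h1, hz⟩
    simp only [if_pos hx] at h4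
    have h5 : Real.tan (min ε (Real.pi / 4)) < Real.tan (Real.arctan (|yc θ z| / xc θ z)) :=
      Real.tan_lt_tan_of_lt_of_lt_pi_div_two (by linarith [hα.1]) (Real.arctan_lt_pi_div_two _)
        ((min_le_left _ _).trans_lt h4)
    rw [Real.tan_arctan, lt_div_iff₀ hx] at h5
    exact lt_asymm hy h5
  · rintro ⟨h1, h2, h3⟩
    have h4 := (mem_ray_iff z).1 h2
    refine ⟨h1, (mem_cone_iff hα).2 ⟨h4.1, ?_⟩, h3⟩
    rw [h4.2, abs_zero]
    exact mul_pos (tan_pos_of_mem hα) h4.1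

theorem IsAngle.yc_eq_zero {Ω : DiscreteFilteredSet 0} {θ L α : ℝ} (hα : IsAngle Ω θ L α) {w : ℂ}
    (hw : w ∈ Ω L) (hx : 0 < xc θ w) (hy : |yc θ w| < Real.tan α * xc θ w) (hn : ‖w‖ < L) :
    w ∈ ray 0 θ := by
  have h : w ∈ Ω L ∩ sector 0 θ α L := ⟨hw, (mem_sector_iff w).2 ⟨(mem_cone_iff hα.1).2 ⟨hx, hy⟩, hn⟩⟩
  rw [hα.2] at h
  exact ((mem_onRay_iff w).1 h).2.1

theorem appendSegment_const (c : ℂ) : appendSegment (ContinuousMap.const I c) c =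
    ContinuousMap.const I c := by
  ext s
  rw [appendSegment_apply]
  split_ifs
  · rfl
  · simp

theorem flat_eq_self {θ κ : ℝ} {w : ℂ} (hw : yc θ w = 0) : flat θ κ w = w :=
  coord_ext (θ := θ) (xc_flat _ _ _) (by rw [yc_flat, hw, mul_zero])

theorem exists_flat_of_mem_segment {θ κ : ℝ} (hκ : κ ∈ I) {w z : ℂ}
    (hw : w ∈ segment ℝ (flat θ κ z) z) : ∃ κ' ∈ Set.Icc κ 1, w = flat θ κ' z := by
  rw [segment_eq_image'] at hw
  obtain ⟨u, hu, rfl⟩ := hw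
  refine ⟨κ + u * (1 - κ), ⟨?_, ?_⟩, ?_⟩
  · nlinarith [mul_nonneg hu.1 (sub_nonneg.2 hκ.2)]
  · nlinarith [mul_nonneg (sub_nonneg.2 hu.2) (sub_nonneg.2 hκ.2)]
  · refine coord_ext (θ := θ) ?_ ?_
    · simp only [Complex.real_smul]
      rw [map_add, xc_ofReal_mul, map_sub, xc_flat, xc_flat]; ring
    · simp only [Complex.real_smul]
      rw [map_add, yc_ofReal_mul, map_sub, yc_flat, yc_flat]; ring

/-- A margin for leaving the non-persistent points of `Ω L` on the ray. -/
theorem exists_margin (Ω : DiscreteFilteredSet 0) (θ : ℝ) {L : ℝ} (hL : 0 < L) :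
    ∃ ρ > 0, ∀ w ∈ Ω L, w ∈ ray 0 θ → w ∉ persistent Ω θ → w ∉ Ω (‖w‖ + ρ) := by
  have hex : ∀ w ∈ {w | w ∈ Ω L ∧ w ∈ ray 0 θ ∧ w ∉ persistent Ω θ}, ∃ L', ‖w‖ < L' ∧ w ∉ Ω L' := by
    rintro w ⟨-, h1, h2⟩
    by_contra! h
    exact h2 ⟨h1, h⟩
  choose! v hv using hex
  obtain ⟨ρ, hρ, h⟩ := exists_pos_forall_lt
    ((Ω.finite' L hL).subset fun w (hw : w ∈ {w | w ∈ Ω L ∧ w ∈ ray 0 θ ∧ w ∉ persistent Ω θ}) => hw.1)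
    (v := fun w => v w - ‖w‖) fun w hw => sub_pos.2 (hv w hw).1
  refine ⟨ρ, hρ, fun w h1 h2 h3 h4 => (hv w ⟨h1, h2, h3⟩).2 ?_⟩
  have := h w ⟨h1, h2, h3⟩
  exact Ω.mono' _ _ (by linarith [norm_nonneg w]) (by linarith) h4

/-- `γ` may run through a non-persistent point `w` of `Ω L` after travelling much farther than
`‖w‖`, and then `γ` itself is not allowed at any suitable length. The lift uses instead `flatFam`,
whose transverse coordinate is scaled by `κ t`, then a segment back to `γ t`. If `γ t ∈ Ω L`, then
`κ t = κ₀` is tiny, no segment is needed, and the path is allowed for `‖γ t‖ + ρ`. Otherwise it is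
allowed for `L`. The bump makes the flattened path bypass the points of `Ω L` on the ray that `γ`
met earlier. -/
theorem liftsAround_persistent (Ω : DiscreteFilteredSet 0) (θ : ℝ) :
    LiftsAround Ω θ (persistent Ω θ) := by
  intro L hL α hα γ hγ havoid
  have htan := tan_pos_of_mem hα.1
  have hpc := hγ.2.1
  have hγ0 := hγ.1
  obtain ⟨c, hc, hslack⟩ := hγ.exists_xc_le hα.1
  have hsl : ∀ s : I, c * s ≤ xc θ (γ s) ∧ |yc θ (γ s)| + c * s ≤ Real.tan α * xc θ (γ s) :=
    fun s => by
      have := hslack 0 s s.2.1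
      rw [hγ0, sub_zero, Set.Icc.coe_zero, sub_zero] at this
      exact this
  have hxpos : ∀ s : I, 0 < s → 0 < xc θ (γ s) := fun s hs =>
    (mul_pos hc hs).trans_le (hsl s).1
  have hycone : ∀ s : I, 0 < s → |yc θ (γ s)| < Real.tan α * xc θ (γ s) := fun s hs => by
    have : (0 : ℝ) < c * s := mul_pos hc hs
    linarith [(hsl s).2]
  obtain ⟨ρ, hρ, hmargin⟩ := exists_margin Ω θ hL
  -- Only below the ray could the upward bump cancel the flattened ordinate; at the abscissas of `Ω
  -- L` this concerns finitely many times, with depth more than `δ`.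
  have hUfin : {s : I | xc θ (γ s) ∈ xc θ '' Ω L ∧ yc θ (γ s) < 0}.Finite :=
    (((Ω.finite' L hL).image (xc θ)).preimage (hγ.strictMono hα.1).injective.injOn).subset
      fun s hs => hs.1
  obtain ⟨δ, hδ, hcross⟩ := exists_pos_forall_lt hUfin (v := fun s => -yc θ (γ s))
    fun s hs => neg_pos.2 hs.2
  set ℓ := length γ with hℓ
  have hℓ0 : 0 ≤ ℓ := length_nonneg γ
  have hℓL : ℓ < L := hγ.2.2.1
  set η := (L - ℓ) / 2 with hη
  have hη0 : 0 < η := by linarith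
  obtain ⟨κ₀, hκ₀, hκ₁, hκℓ⟩ : ∃ κ₀ > 0, κ₀ ≤ 1 ∧ κ₀ * ℓ ≤ ρ / 2 := by
    refine ⟨min 1 (ρ / 2 / (ℓ + 1)), lt_min one_pos (by positivity), min_le_left _ _, ?_⟩
    calc min 1 (ρ / 2 / (ℓ + 1)) * ℓ ≤ ρ / 2 / (ℓ + 1) * (ℓ + 1) :=
          mul_le_mul (min_le_right _ _) (by linarith) hℓ0 (by positivity)
      _ = ρ / 2 := div_mul_cancel₀ _ (by positivity)
  -- The four bounds keep, in order: the length below `‖γ t‖ + ρ`, the length with the segment below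
  -- `L`, the path in the cone, and the bump too small to cancel a flattened depth of `κ₀ δ`.
  obtain ⟨ε, hε, h1⟩ : ∃ ε > 0, ε < ρ / 2 ∧ ε < η ∧ ε < c ∧ ε < κ₀ * δ := by
    obtain ⟨ε, hε, h⟩ := exists_between
      (show 0 < min (min (ρ / 2) η) (min c (κ₀ * δ)) from
        lt_min (lt_min (by linarith) hη0) (lt_min hc (by positivity)))
    simp only [lt_min_iff] at h
    exact ⟨ε, hε, h.1.1, h.1.2, h.2.1, h.2.2⟩
  obtain ⟨hερ, hεη, hεc, hεδ⟩ := h1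
  -- `κ` equals `κ₀` when `γ t` is on the ray and grows with the ordinate, so that the connecting
  -- segment, of length `(1 - κ t) |y|`, never exceeds `η`.
  set κ : C(I, ℝ) := ⟨fun t => min 1 (κ₀ + |yc θ (γ t)| / η), by
    have : Continuous fun t : I => |yc θ (γ t)| := by fun_prop
    fun_prop⟩ with hκ
  have hκa : ∀ t, κ t = min 1 (κ₀ + |yc θ (γ t)| / η) := fun t => rfl
  have hκ0 : ∀ t, κ₀ ≤ κ t := fun t => by
    rw [hκa]
    exact le_min hκ₁ (le_add_of_nonneg_right (by positivity))
  have hκI : ∀ t, κ t ∈ I := fun t => ⟨hκ₀.le.trans (hκ0 t), min_le_left _ _⟩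
  set m := flatFam θ γ κ ε with hm
  have hmpc : PiecewiseC1InS m := piecewiseC1InS_flatFam hpc
  have hmin0 : ∀ t : I, min (0 : I) t = 0 := fun t => min_eq_left t.2.1
  have hm0 : ∀ t, m (0, t) = 0 := fun t => by
    refine coord_ext (θ := θ) ?_ ?_
    · rw [xc_flatFam, hmin0, hγ0]
    · rw [yc_flatFam, hmin0, hγ0]; simp
  have hm1 : ∀ t, m (1, t) = flat θ (κ t) (γ t) := flatFam_one
  have hmge : ∀ s t : I, t ≤ s → m (s, t) = m (1, t) := fun s t hst => by
    refine coord_ext (θ := θ) ?_ ?_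
    · rw [xc_flatFam, xc_flatFam, min_eq_right hst, min_eq_right unitInterval.le_one']
    · rw [yc_flatFam, yc_flatFam, min_eq_right hst, min_eq_right unitInterval.le_one']
  have hlen : ∀ t, length (slice m t) ≤ ℓ + ε := fun t => length_flatFam_le hpc t (hκI t) hε.le
  have hkey : ∀ s t : I, 0 < s → s < t → m (s, t) ∉ Ω L := by
    intro s t hs hst hmem
    have hs' : (0 : ℝ) < s := hs
    have hst' : (s : ℝ) < t := hst
    have ht1 : (t : ℝ) ≤ 1 := t.2.2
    have hx := xc_flatFam (θ := θ) (γ := γ) (κ := κ) (ε := ε) s t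
    have hy := yc_flatFam (θ := θ) (γ := γ) (κ := κ) (ε := ε) s t
    rw [min_eq_left hst.le, ← hm] at hx hy
    have hb0 : 0 < ε * (s * (t - s)) := mul_pos hε (mul_pos hs' (by linarith))
    have hbc : ε * (s * (t - s)) < c * s := by
      have h1 : (s : ℝ) * (t - s) ≤ s * 1 := mul_le_mul_of_nonneg_left (by linarith) hs'.le
      nlinarith
    have hbε : ε * (s * (t - s)) ≤ ε := by
      have h1 : (s : ℝ) * (t - s) ≤ 1 * 1 := mul_le_mul s.2.2 (by linarith) (by linarith) zero_le_one
      nlinarith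
    have hn : ‖m (s, t)‖ < L := by
      have h2 := (hmpc.piecewiseC1 t).norm_sub_le_length s
      rw [slice_apply, slice_apply, hm0, sub_zero] at h2
      linarith [hlen t]
    have hyb : |yc θ (m (s, t))| < Real.tan α * xc θ (m (s, t)) := by
      rw [hx, hy]
      have h2 : |κ t * yc θ (γ s)| ≤ |yc θ (γ s)| := by
        rw [abs_mul, abs_of_nonneg (hκI t).1]
        exact mul_le_of_le_one_left (abs_nonneg _) (hκI t).2
      have h3 := abs_add_le (κ t * yc θ (γ s)) (ε * (s * (t - s)))
      rw [abs_of_pos hb0] at h3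
      linarith [(hsl s).2]
    have hray := hα.yc_eq_zero hmem (by rw [hx]; exact hxpos s hs) hyb hn
    have hy0 := ((mem_ray_iff _).1 hray).2
    rw [hy] at hy0
    have hyneg : yc θ (γ s) < 0 := by
      by_contra h
      nlinarith [mul_nonneg (hκI t).1 (not_lt.1 h)]
    have h4 := hcross s ⟨⟨_, hmem, hx⟩, hyneg⟩
    have h5 : κ₀ * δ < κ t * -yc θ (γ s) := by
      have := hκ0 t
      calc κ₀ * δ < κ₀ * -yc θ (γ s) := mul_lt_mul_of_pos_left h4 hκ₀
        _ ≤ κ t * -yc θ (γ s) := mul_le_mul_of_nonneg_right this (by linarith)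
    linarith
  have hseg : ∀ t : I, 0 < t → ∀ w ∈ segment ℝ (m (1, t)) (γ t), w ∈ Ω L →
      yc θ (γ t) = 0 ∧ w = γ t := by
    intro t ht w hw hwΩ
    rw [hm1] at hw
    obtain ⟨κ', hκ', rfl⟩ := exists_flat_of_mem_segment (hκI t) hw
    have hκ'0 : 0 < κ' := hκ₀.trans_le ((hκ0 t).trans hκ'.1)
    have hy : |yc θ (flat θ κ' (γ t))| ≤ |yc θ (γ t)| := by
      rw [yc_flat, abs_mul, abs_of_pos hκ'0]
      exact mul_le_of_le_one_left (abs_nonneg _) hκ'.2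
    have hray := hα.yc_eq_zero hwΩ (by rw [xc_flat]; exact hxpos t ht)
      (by rw [xc_flat]; exact hy.trans_lt (hycone t ht))
      ((norm_flat_le ⟨hκ'0.le, hκ'.2⟩ _).trans_lt (hγ.norm_lt t))
    have h0 := ((mem_ray_iff _).1 hray).2
    rw [yc_flat] at h0
    have h1 := (mul_eq_zero.1 h0).resolve_left hκ'0.ne'
    exact ⟨h1, flat_eq_self h1⟩
  have hxm1 : ∀ t : I, 0 < t → 0 < xc θ (m (1, t)) := fun t ht => by
    rw [hm1, xc_flat]; exact hxpos t ht
  have hem : ∀ t : I, 0 < t → Emanates 0 (slice m t) := by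
    intro t ht s s' hss h
    rw [slice_apply] at h ⊢
    have hs' : s' = 0 := by
      by_contra hne
      have hpos : 0 < min s' t := lt_min (lt_of_le_of_ne s'.2.1 (Ne.symm hne)) ht
      have := hxpos _ hpos
      rw [← xc_flatFam (κ := κ) (ε := ε), ← hm, h, map_zero] at this
      exact lt_irrefl _ this
    rw [hs'] at hss
    rw [le_antisymm hss s.2.1]
    exact hm0 t
  have hpoints : ∀ t : I, ∀ L' ≤ L, 0 < L' → (m (1, t) ∉ Ω L') → ∀ s, slice m t s ∈ Ω L' →
      slice m t s = 0 := by
    intro t L' hL' hL'0 h s hs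
    rw [slice_apply] at hs ⊢
    rcases eq_or_lt_of_le (show 0 ≤ s from s.2.1) with h0 | h0
    · rw [← h0]; exact hm0 t
    rcases lt_or_ge s t with hst | hst
    · exact absurd (Ω.mono' _ _ hL'0 hL' hs) (hkey s t h0 hst)
    · rw [hmge s t hst] at hs
      exact absurd hs h
  have hslice0 : slice m 0 = ContinuousMap.const I 0 := by
    ext s
    rw [slice_apply, hmge s 0 s.2.1, hm1, hγ0, map_zero]; rfl
  have hbase : appendSegment (slice m 0) (γ 0) = ContinuousMap.const I 0 := by
    rw [hslice0, hγ0, appendSegment_const]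
  have hall : ∀ t, Allowed Ω (appendSegment (slice m t) (γ t)) := by
    intro t
    rcases eq_or_lt_of_le (show 0 ≤ t from t.2.1) with h0 | h0
    · rw [← h0, hbase]; exact allowed_const Ω
    by_cases hΩ : γ t ∈ Ω L
    · have hray := hα.yc_eq_zero hΩ (hxpos t h0) (hycone t h0) (hγ.norm_lt t)
      have hy0 := ((mem_ray_iff _).1 hray).2
      -- Being avoided by the persistent set, `γ t` is already missing from `Ω (‖γ t‖ + ρ)`.
      have hnot := hmargin _ hΩ hray fun h =>
        havoid t ⟨h, mem_ball_zero_iff.2 (hγ.norm_lt t)⟩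
      have hLt : ‖γ t‖ + ρ ≤ L := by
        by_contra h
        exact hnot (Ω.mono' _ _ hL (not_le.1 h).le hΩ)
      have hLpos : 0 < ‖γ t‖ + ρ := by positivity
      have hmγ : m (1, t) = γ t := by rw [hm1, flat_eq_self hy0]
      refine ⟨‖γ t‖ + ρ, hLpos, allowedAt_appendSegment (θ := θ) hLpos (hm0 t)
        (hmpc.piecewiseC1 t) (hem t h0) (hpoints t _ hLt hLpos (by rwa [hmγ])) ?_ ?_ ?_ ?_⟩
      · rw [sub_zero]; exact hxm1 t h0
      · rw [sub_zero]; exact hxpos t h0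
      · have h2 := length_flatFam_le_xc (κ := κ) (ε := ε) hα.1 hγ t (hκI t).1 hε.le
        have h3 : κ t = κ₀ := by rw [hκa, hy0, abs_zero, zero_div, add_zero, min_eq_right hκ₁]
        rw [h3, ← hm, ← hℓ] at h2
        rw [slice_apply, hmγ, sub_self, norm_zero]
        linarith [xc_le_norm θ (γ t)]
      · intro w hw hw'
        rw [slice_apply, hmγ, segment_same, Set.mem_singleton_iff] at hw
        rw [hw] at hw'
        exact absurd hw' hnot
    · have hmΩ : m (1, t) ∉ Ω L := fun h => by
        have := (hseg t h0 _ (left_mem_segment ℝ _ _) h).2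
        rw [this] at h
        exact hΩ h
      refine ⟨L, hL, allowedAt_appendSegment (θ := θ) hL (hm0 t) (hmpc.piecewiseC1 t) (hem t h0)
        (hpoints t L le_rfl hL hmΩ) ?_ ?_ ?_ ?_⟩
      · rw [sub_zero]; exact hxm1 t h0
      · rw [sub_zero]; exact hxpos t h0
      · have h2 : ‖γ t - m (1, t)‖ ≤ η := by
          refine (norm_le_coord θ _).trans ?_
          rw [map_sub, map_sub, hm1, xc_flat, yc_flat, sub_self, abs_zero, zero_add]
          have e : yc θ (γ t) - κ t * yc θ (γ t) = (1 - κ t) * yc θ (γ t) := by ring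
          rw [e, abs_mul, abs_of_nonneg (by linarith [(hκI t).2])]
          rcases le_total 1 (κ₀ + |yc θ (γ t)| / η) with h3 | h3
          · rw [hκa, min_eq_left h3, sub_self, zero_mul]; exact hη0.le
          · have h4 : |yc θ (γ t)| ≤ η := by
              have : |yc θ (γ t)| / η ≤ 1 := by linarith
              rwa [div_le_one hη0] at this
            exact (mul_le_of_le_one_left (abs_nonneg _) (by linarith [(hκI t).1])).trans h4
        rw [slice_apply]
        linarith [hlen t]
      · intro w hw hw'
        have := (hseg t h0 w hw hw').2
        rw [this] at hw'
        exact absurd hw' hΩ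
  refine ⟨⟨fun t => cl Ω ⟨appendSegment (slice m t) (γ t), hall t⟩,
    continuous_cl_appendSegment θ hmpc γ hall (fun s => ?_) hγ0 (fun t ht => ?_) fun t ht => ?_⟩,
    ?_, fun s => ?_⟩
  · rw [hmge s 0 s.2.1, hm1, hγ0, map_zero]
  · rw [sub_zero]; exact hxm1 t ht
  · rw [sub_zero]; exact hxpos t ht
  · exact congrArg (cl Ω) (Subtype.ext hbase)
  · exact appendSegment_one _ _

/-! ### The persistent points as a glimpsed set -/

/-- No point of the surface lies over a persistent point. -/
theorem proj_notMem_persistent {Ω : DiscreteFilteredSet 0} {θ : ℝ} (ζ : Surface Ω) :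
    proj Ω ζ ∉ persistent Ω θ := by
  obtain ⟨b, rfl⟩ := Quot.exists_rep ζ
  change b.1 1 ∉ persistent Ω θ
  intro h
  obtain ⟨L, hL, hb⟩ := b.2
  obtain ⟨h1, h2, h3, -, h5⟩ := (allowedAt_iff hL).1 hb
  have h4 := h2.norm_sub_le_length 1
  rw [h1, sub_zero] at h4
  have h6 := h5 1 (h.2 L (h4.trans_lt h3))
  have h7 := ((mem_ray_iff _).1 h.1).1
  rw [h6, map_zero] at h7
  exact lt_irrefl _ h7

/-- The straight path from `0` to `w`. -/
def straight (w : ℂ) : C(I, ℂ) := ⟨fun s => s * w, by fun_prop⟩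

theorem isForward_straight {θ α : ℝ} (hα : α ∈ Set.Ioo 0 (Real.pi / 2)) {w : ℂ}
    (hw : w ∈ ray 0 θ) {L : ℝ} (hL : ‖w‖ < L) : IsForward 0 θ α L (straight w) := by
  obtain ⟨hx, hy⟩ := (mem_ray_iff w).1 hw
  have htan := tan_pos_of_mem hα
  have hext : Set.EqOn (ext (straight w)) (fun s : ℝ => s * w) (Set.Icc 0 1) := fun s hs => by
    rw [ext_of_mem _ hs]; rfl
  have hder : ∀ s : ℝ, HasDerivAt (fun s : ℝ => (s : ℂ) * w) w s := fun s => by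
    simpa using (hasDerivAt_id s).ofReal_comp.mul_const w
  have hF : Fwd θ α (min (xc θ w) (Real.tan α * xc θ w)) (ext (straight w)) 1 fun i => (i : ℝ) := by
    refine ⟨⟨Nat.mono_cast, by simp, by simp⟩, fun i hi => ⟨fun _ => w, ?_, fun t _ => ?_⟩⟩
    · obtain rfl : i = 0 := by omega
      simp only [Nat.cast_zero, zero_add, Nat.cast_one]
      exact pieceDeriv_congr ⟨continuousOn_const, fun t _ => (hder t).hasDerivWithinAt⟩ hext
    · exact ⟨min_le_left _ _, by rw [hy, abs_zero, zero_add]; exact min_le_right _ _⟩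
  refine hF.isForward hα (lt_min hx (mul_pos htan hx)) (by simp [straight]) ?_
  refine (length_le_integral hF.piecewiseC1 (u := fun _ => ‖w‖) intervalIntegrable_const
    Set.finite_empty fun t ht => ?_).trans_lt (by simpa using hL)
  rw [((hder t).congr_of_eventuallyEq (hext.eventuallyEq_of_mem
    (Icc_mem_nhds ht.1.1 ht.1.2))).deriv]

/-- Minimality: if a persistent `w` is dropped, a perturbed straight path ends at `w` and avoids the
remaining points, so its lift would end over `w`, where the surface has no point. -/
theorem isGlimpsedSet_persistent (Ω : DiscreteFilteredSet 0) (θ : ℝ) :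
    IsGlimpsedSet Ω θ (persistent Ω θ) := by
  have hfin := finite_persistent_inter_ball Ω θ
  refine ⟨isClosed_of_locallyFinite hfin, isDiscrete_of_locallyFinite hfin,
    fun L _ => persistent_inter_ball_subset Ω θ L, liftsAround_persistent Ω θ,
    fun G' hG' hlift => ?_⟩
  obtain ⟨hsub, w, hw, hw'⟩ := Set.ssubset_iff_exists.1 hG'
  have hL : 0 < ‖w‖ + 1 := by positivity
  obtain ⟨α, hα⟩ := exists_isAngle Ω θ hL
  have hfwd := isForward_straight hα.1 hw.1 (lt_add_one ‖w‖)
  obtain ⟨ε, -, h⟩ := hfwd.exists_perturb hα.1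
    ((hfin (‖w‖ + 1)).subset (Set.inter_subset_inter_left _ hsub)) (hsub.trans fun _ h => h.1)
  -- The choice `T = 1` fixes the end point `w` and confines any meeting with `G'` to it.
  obtain ⟨h1, h2⟩ := h 1
  have hend : perturb θ (straight w) ε (1 : I) 1 = w := by simp [perturb, straight]
  obtain ⟨Λ, -, hΛ⟩ := hlift _ hL α hα _ h1 fun s hs => by
    have hs1 := h2 s hs.1
    rw [hs1, hend] at hs
    exact hw' hs.1
  have h3 := hΛ 1
  rw [hend] at h3
  exact proj_notMem_persistent (θ := θ) (Λ 1) (h3 ▸ hw)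

/-- This inclusion is enough for the theorem, whose upper bound increases with the glimpsed sets;
uniqueness of the glimpsed set is not needed. -/
theorem persistent_subset_glimpsed (Ω : DiscreteFilteredSet 0) (θ : ℝ) :
    persistent Ω θ ⊆ glimpsed Ω θ :=
  Set.subset_sUnion_of_mem (isGlimpsedSet_persistent Ω θ)

theorem ContinuableTo.continuesAround {Ω : DiscreteFilteredSet 0} {φ : ℂ → ℂ}
    (hφ : ContinuableTo Ω φ) (θ : ℝ) : ContinuesAround φ 0 θ (persistent Ω θ) := by
  intro L hL
  obtain ⟨α, hα⟩ := exists_isAngle Ω θ hL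
  exact ⟨α, hα.1, fun γ hγ havoid => hφ.continuableAlong
    (liftsAround_persistent Ω θ L hL α hα γ hγ fun s hs => havoid s hs.1)⟩

end Endless

/-! ### The theorem on glimpsed singular points of a convolution product -/

theorem mainTheorem3 (Ω Ω' : Endless.DiscreteFilteredSet 0) (θ : ℝ) (φ ψ : ℂ → ℂ)
    (hφ : Endless.ContinuableTo Ω φ) (hψ : Endless.ContinuableTo Ω' ψ) :
    Endless.IsGlimpsedSingularSet (Endless.conv φ ψ) 0 θ
        (Endless.glimpsedSingular (Endless.conv φ ψ) 0 θ) ∧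
      Endless.glimpsedSingular (Endless.conv φ ψ) 0 θ ⊆
        (Endless.completedGlimpsed Ω θ + Endless.completedGlimpsed Ω' θ) \ {0} := by
  have hr := Endless.persistent_subset_ray Ω θ
  have hr' := Endless.persistent_subset_ray Ω' θ
  have hf := Endless.finite_persistent_inter_ball Ω θ
  have hf' := Endless.finite_persistent_inter_ball Ω' θ
  have hK : ((Endless.persistent Ω θ ∪ {0}) + (Endless.persistent Ω' θ ∪ {0})) \ {0} ⊆
      Endless.ray 0 θ := by
    rintro _ ⟨⟨a, ha, b, hb, rfl⟩, hne⟩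
    obtain ⟨ha1, ha2, -⟩ := Endless.norm_eq_xc_of_mem hr ha
    obtain ⟨hb1, hb2, -⟩ := Endless.norm_eq_xc_of_mem hr' hb
    have hy : Endless.yc θ (a + b) = 0 := by rw [map_add, ha2, hb2, add_zero]
    have hx : 0 ≤ Endless.xc θ (a + b) := by rw [map_add]; exact add_nonneg ha1 hb1
    refine (Endless.mem_ray_iff _).2 ⟨lt_of_le_of_ne hx fun h => hne ?_, hy⟩
    exact Endless.coord_ext (θ := θ) (by rw [map_zero, ← h]) (by rw [map_zero]; exact hy)
  obtain ⟨h1, h2⟩ := Endless.isGlimpsedSingularSet_of_continuesAround hK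
    (fun L => (Endless.finite_add_inter_ball hr hr' hf hf' L).subset
      (Set.inter_subset_inter_left _ Set.sdiff_subset))
    (Endless.continuesAround_conv hφ.1 hψ.1 hr hr' hf hf' (hφ.continuesAround θ)
      (hψ.continuesAround θ))
  refine ⟨h1, h2.trans (Set.sdiff_subset_sdiff_left (Set.add_subset_add ?_ ?_))⟩
  · exact Set.union_subset_union_left _ (Endless.persistent_subset_glimpsed Ω θ)
  · exact Set.union_subset_union_left _ (Endless.persistent_subset_glimpsed Ω' θ)
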